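/- Let $(X,S,Y)$ be a jointly Gaussian zero-mean triple with values in $\mathbb R^{n_x}\times\mathbb R^{n_s}\times\mathbb R^{n_y}$ and $Q_Y\succ0$. For random vectors $U,V,T$ put $Q_{U,V}=\mathrm{cov}(U,V)$, $Q_{U,V|T}=\mathbf E[(U-\mathbf E(U|T))(V-\mathbf E(V|T))^{T}]$ and $Q_{U|T}=Q_{U,U|T}$. For $\Delta_X\ge 0$ let $$R_{S;Z|Y}(\Delta_X)=\inf I(S;Z|Y),\qquad R_{S;\widehat X|Y}(\Delta_X)=\inf I(S;\widehat X|Y),$$ the first infimum over all auxiliary random variables $Z$ (in any measurable space, jointly distributed with $(X,S,Y)$) with $\mathbf P_{Z|X,S,Y}=\mathbf P_{Z|S}$ for which some measurable $f$ gives $\mathbf E\|X-f(Y,Z)\|^2\le\Delta_X$; the second over all $\mathbb R^{n_x}$-valued $\widehat X$ with $\mathbf P_{\widehat X|X,S,Y}=\mathbf P_{\widehat X|S,Y}$ and $\mathbf E\|X-\widehat X\|^2\le\Delta_X$. Here $\inf\emptyset=\infty$. Consider parameters $H\in\mathbb R^{n_x\times n_s}$, $Q_W\succeq0$ and $\Sigma_\Delta$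 with $$HQ_{X,S|Y}^{T}=Q_{X|Y}-\Sigma_\Delta,\quad HQ_{X,S|Y}^{T}=Q_{X,S|Y}H^{T}\succeq0,\quad Q_W=HQ_{X,S|Y}^{T}-HQ_{S|Y}H^{T},\qquad(*)$$ and the test channel $$Z=HS+W,\qquad \widehat X=(Q_{X,Y}-HQ_{S,Y})Q_Y^{-1}Y+Z,$$ with $W\sim N(0,Q_W)$ independent of $(X,S,Y)$. (a) Every test channel satisfying $(*)$ satisfies $\Sigma_\Delta=\mathbf E[(X-\widehat X)(X-\widehat X)^{T}]$ and (i) $\mathbf P_{X|\widehat X,Y,Z}=\mathbf P_{X|\widehat X,Y}=\mathbf P_{X|\widehat X}$; (ii) $\mathbf P_{Z|X,S,Y}=\mathbf P_{Z|S}$; (iii) $I(S;Z|Y)=I(S;\widehat X|Y)$; (iv) $Q_{S|Z,Y}=Q_{S|\widehat X,Y}=Q_{S|Y}-Q_{S|Y}H^{T}Q_{\widehat X|Y}^{\dagger}HQ_{S|Y}$ and $Q_{Z|Y}=Q_{\widehat X|Y}=HQ_{S|Y}H^{T}+Q_W=Q_{X|Y}-\Sigma_\Delta$, where $\dagger$ is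 the Moore–Penrose pseudoinverse; (v) $\mathbf E(X|\widehat X,Y,Z)=\mathbf E(X|\widehat X)=\widehat X$ and $\mathbf E(X|Y)=\mathbf E(\widehat X|Y)$, almost surely. If some auxiliary variable is admissible at distortion $\Delta_X$, then some test channel of this form, with $\Sigma_\Delta\succeq0$ and $\operatorname{tr}\Sigma_\Delta\le\Delta_X$, achieves $R_{S;Z|Y}(\Delta_X)$: $Z$ (with the above $\widehat X$ as reconstruction) and $\widehat X$ are admissible in the respective problems, and $I(S;Z|Y)=R_{S;Z|Y}(\Delta_X)$. (b) For every $\Delta_X\ge0$, side information at the encoder gives no rate gain, and $$R_{S;Z|Y}(\Delta_X)=R_{S;\widehat X|Y}(\Delta_X)=\inf\tfrac12\log\frac{\det Q_{S|Y}}{\det Q_{S|\widehat X,Y}}=\inf\tfrac12\log\frac{\det Q_{\widehat X|Y}}{\det Q_W},$$ where both infima are over the triples $(H,Q_W,\Sigma_\Delta)$ with $(*)$, $\Sigma_\Delta\succeq0$, $\operatorname{tr}\Sigma_\Delta\le\Delta_X$, the first subject also to $Q_{S|Y}\succeq Q_{S|\widehat X,Y}\succeq0$ and the second to $Q_{\widehat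 X|Y}\succeq Q_W\succeq0$, and $Q_{\widehat X|Y}$, $Q_{S|\widehat X,Y}$ are given by the formulas in (iv). If the admissible set is nonempty, the test channel in (a) attains both infima. (A quotient of determinants with numerator matrix $A$ and denominator matrix $B$, $A\succeq B\succeq0$, is $\infty$ if $\operatorname{rank}B<\operatorname{rank}A$, and otherwise the quotient of the products of the nonzero eigenvalues; for nonsingular $A$ and $B$ this is $\det A/\det B$.) -/

import Mathlib

open MeasureTheory ProbabilityTheory Matrix
open scoped ENNReal

noncomputable section

namespace RemoteRDF

/-- `ℝⁿ` with the Euclidean norm. -/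
abbrev Vec (n : ℕ) : Type := EuclideanSpace ℝ (Fin n)

/-- The space of values of a source `(X, S, Y)`. -/
abbrev Src (nx ns ny : ℕ) : Type := Vec nx × Vec ns × Vec ny

section General

variable {Ω : Type*} [MeasurableSpace Ω]

/-- The σ-algebra generated by the random variable `U`. -/
abbrev sig {α : Type*} [MeasurableSpace α] (U : Ω → α) : MeasurableSpace Ω :=
  MeasurableSpace.comap U inferInstance

/-- `P_{Z|U} = P_{Z|V}` almost surely: for every event `B`, the conditional probabilities of
`Z ∈ B` given `U` and given `V` agree almost surely. -/
def CondLawEq {ζ α β : Type*} [MeasurableSpace ζ] [MeasurableSpace α] [MeasurableSpace β]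
    (μ : Measure Ω) (Z : Ω → ζ) (U : Ω → α) (V : Ω → β) : Prop :=
  ∀ B : Set ζ, MeasurableSet B → μ⟦Z ⁻¹' B | sig U⟧ =ᵐ[μ] μ⟦Z ⁻¹' B | sig V⟧

/-- The conditional mutual information `I(S; Z | Y)`: the Kullback-Leibler divergence of the
joint law of `((Y, Z), S)` from the law under which `(Y, Z)` keeps its law and, given `(Y, Z)`,
`S` is drawn from `P_{S|Y}`; that is, `D(P_{Y,Z,S} ‖ P_Y P_{Z|Y} P_{S|Y})`. -/
def condMutualInfo {n : ℕ} {υ ζ : Type*} [MeasurableSpace υ] [MeasurableSpace ζ]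
    (μ : Measure Ω) [IsFiniteMeasure μ] (S : Ω → Vec n) (Z : Ω → ζ) (Y : Ω → υ) : ℝ≥0∞ :=
  InformationTheory.klDiv (μ.map fun ω => ((Y ω, Z ω), S ω))
    ((μ.map fun ω => (Y ω, Z ω)) ⊗ₘ (condDistrib S Y μ).prodMkRight ζ)

/-- The cross-covariance matrix `Q_{U,V}`. -/
def crossCov {m n : ℕ} (μ : Measure Ω) (U : Ω → Vec m) (V : Ω → Vec n) :
    Matrix (Fin m) (Fin n) ℝ :=
  Matrix.of fun i j => cov[fun ω => U ω i, fun ω => V ω j; μ]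

/-- The conditional covariance matrix
`Q_{U,V|T} = E[(U - E[U|T]) (V - E[V|T])ᵀ]` of jointly Gaussian `(U, V, T)`. -/
def condCov {m n : ℕ} {τ : Type*} [MeasurableSpace τ] (μ : Measure Ω)
    (U : Ω → Vec m) (V : Ω → Vec n) (T : Ω → τ) : Matrix (Fin m) (Fin n) ℝ :=
  Matrix.of fun i j =>
    ∫ ω, (U ω - (μ[U | sig T]) ω) i * (V ω - (μ[V | sig T]) ω) j ∂μ

/-- The matrix `E[U Uᵀ]` of second moments. -/
def secondMoment {m : ℕ} (μ : Measure Ω) (U : Ω → Vec m) : Matrix (Fin m) (Fin m) ℝ :=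
  Matrix.of fun i j => ∫ ω, U ω i * U ω j ∂μ

/-- The mean square error `E‖X - X̂‖²`. -/
def mse {n : ℕ} (μ : Measure Ω) (X Xhat : Ω → Vec n) : ℝ≥0∞ :=
  ∫⁻ ω, ‖X ω - Xhat ω‖ₑ ^ 2 ∂μ

/-- Side information at the decoder only: `Z` is an admissible auxiliary variable at distortion
`Δ` with reconstruction `X̂ = f (Y, Z)`, i.e. `P_{Z|X,S,Y} = P_{Z|S}` and
`E‖X - f(Y, Z)‖² ≤ Δ`. -/
structure DecAdmissible {nx ns ny : ℕ} {ζ : Type*} [MeasurableSpace ζ] (μ : Measure Ω)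
    (X : Ω → Vec nx) (S : Ω → Vec ns) (Y : Ω → Vec ny) (Z : Ω → ζ)
    (f : Vec ny × ζ → Vec nx) (Δ : ℝ) : Prop where
  measurable_aux : Measurable Z
  measurable_rec : Measurable f
  markov : CondLawEq μ Z (fun ω => (X ω, S ω, Y ω)) S
  distortion : mse μ X (fun ω => f (Y ω, Z ω)) ≤ ENNReal.ofReal Δ

/-- Side information at encoder and decoder: `X̂` is an admissible reconstruction at distortion
`Δ`, i.e. `P_{X̂|X,S,Y} = P_{X̂|S,Y}` and `E‖X - X̂‖² ≤ Δ`. -/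
structure EncAdmissible {nx ns ny : ℕ} (μ : Measure Ω)
    (X : Ω → Vec nx) (S : Ω → Vec ns) (Y : Ω → Vec ny) (Xhat : Ω → Vec nx) (Δ : ℝ) : Prop where
  measurable_rec : Measurable Xhat
  markov : CondLawEq μ Xhat (fun ω => (X ω, S ω, Y ω)) (fun ω => (S ω, Y ω))
  distortion : mse μ X Xhat ≤ ENNReal.ofReal Δ

end General

section Source

variable {nx ns ny : ℕ}

/-- The coordinates of the source. -/
def srcX (v : Src nx ns ny) : Vec nx := v.1

/-- The coordinates of the source. -/
def srcS (v : Src nx ns ny) : Vec ns := v.2.1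

/-- The coordinates of the source. -/
def srcY (v : Src nx ns ny) : Vec ny := v.2.2

/-- `ρ` is the joint law of `((X, S, Y), Z)` for a source `(X, S, Y)` of law `P` and an auxiliary
variable `Z`, admissible at distortion `Δ` with side information at the decoder only. -/
def IsDecLaw (P : Measure (Src nx ns ny)) (Δ : ℝ) {ζ : Type*} [MeasurableSpace ζ]
    (ρ : ProbabilityMeasure (Src nx ns ny × ζ)) : Prop :=
  (ρ : Measure (Src nx ns ny × ζ)).map Prod.fst = P ∧
  ∃ f : Vec ny × ζ → Vec nx,
    DecAdmissible (ρ : Measure (Src nx ns ny × ζ)) (fun v => srcX v.1) (fun v => srcS v.1)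
      (fun v => srcY v.1) Prod.snd f Δ

/-- `ρ` is the joint law of `((X, S, Y), X̂)` for a source `(X, S, Y)` of law `P` and a
reconstruction `X̂`, admissible at distortion `Δ` with side information at both ends. -/
def IsEncLaw (P : Measure (Src nx ns ny)) (Δ : ℝ)
    (ρ : ProbabilityMeasure (Src nx ns ny × Vec nx)) : Prop :=
  (ρ : Measure (Src nx ns ny × Vec nx)).map Prod.fst = P ∧
  EncAdmissible (ρ : Measure (Src nx ns ny × Vec nx)) (fun v => srcX v.1) (fun v => srcS v.1)
    (fun v => srcY v.1) Prod.snd Δ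

/-- The rate distortion function `R_{S;Z|Y}(Δ)`, side information at the decoder only: the
infimum of `I(S; Z | Y)` over all admissible auxiliary variables, with values in an arbitrary
measurable space (`∞` if there are none). -/
def rdfDec (P : Measure (Src nx ns ny)) (Δ : ℝ) : ℝ≥0∞ :=
  ⨅ (ζ : Type) (_ : MeasurableSpace ζ) (ρ : ProbabilityMeasure (Src nx ns ny × ζ))
    (_ : IsDecLaw P Δ ρ),
    condMutualInfo (ρ : Measure (Src nx ns ny × ζ)) (fun v => srcS v.1) Prod.snd
      (fun v => srcY v.1)

/-- The rate distortion function `R_{S;X̂|Y}(Δ)`, side information at encoder and decoder: the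
infimum of `I(S; X̂ | Y)` over all admissible reconstructions (`∞` if there are none). -/
def rdfEnc (P : Measure (Src nx ns ny)) (Δ : ℝ) : ℝ≥0∞ :=
  ⨅ (ρ : ProbabilityMeasure (Src nx ns ny × Vec nx)) (_ : IsEncLaw P Δ ρ),
    condMutualInfo (ρ : Measure (Src nx ns ny × Vec nx)) (fun v => srcS v.1) Prod.snd
      (fun v => srcY v.1)

/-- `Q_{X,Y}` -/
def covXY (P : Measure (Src nx ns ny)) : Matrix (Fin nx) (Fin ny) ℝ := crossCov P srcX srcY

/-- `Q_{S,Y}` -/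
def covSY (P : Measure (Src nx ns ny)) : Matrix (Fin ns) (Fin ny) ℝ := crossCov P srcS srcY

/-- `Q_Y` -/
def covY (P : Measure (Src nx ns ny)) : Matrix (Fin ny) (Fin ny) ℝ := crossCov P srcY srcY

/-- `Q_{X|Y}` -/
def covXgY (P : Measure (Src nx ns ny)) : Matrix (Fin nx) (Fin nx) ℝ := condCov P srcX srcX srcY

/-- `Q_{S|Y}` -/
def covSgY (P : Measure (Src nx ns ny)) : Matrix (Fin ns) (Fin ns) ℝ := condCov P srcS srcS srcY

/-- `Q_{X,S|Y}` -/
def covXSgY (P : Measure (Src nx ns ny)) : Matrix (Fin nx) (Fin ns) ℝ := condCov P srcX srcS srcY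

/-- The constraints on the parameters `(H, Q_W)` of the test channel, with error covariance
`Σ_Δ = D`. -/
structure IsChannelParam (P : Measure (Src nx ns ny)) (H : Matrix (Fin nx) (Fin ns) ℝ)
    (QW D : Matrix (Fin nx) (Fin nx) ℝ) : Prop where
  noise_posSemidef : QW.PosSemidef
  mul_eq_sub : H * (covXSgY P)ᵀ = covXgY P - D
  mul_symm : H * (covXSgY P)ᵀ = covXSgY P * Hᵀ
  mul_posSemidef : (H * (covXSgY P)ᵀ).PosSemidef
  noise_eq : QW = H * (covXSgY P)ᵀ - H * covSgY P * Hᵀ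

/-- `(X, S, Y)` has law `P`, and `W ∈ G(0, Q_W)` is independent of `(X, S, Y)`. -/
structure IsRealization (P : Measure (Src nx ns ny)) (QW : Matrix (Fin nx) (Fin nx) ℝ)
    {Ω : Type*} [MeasurableSpace Ω] (μ : Measure Ω)
    (X : Ω → Vec nx) (S : Ω → Vec ns) (Y : Ω → Vec ny) (W : Ω → Vec nx) : Prop where
  measurable_X : Measurable X
  measurable_S : Measurable S
  measurable_Y : Measurable Y
  measurable_W : Measurable W
  law_source : μ.map (fun ω => (X ω, S ω, Y ω)) = P
  law_noise : μ.map W = multivariateGaussian 0 QW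
  indep : IndepFun W (fun ω => (X ω, S ω, Y ω)) μ

/-- The test channel `Z = H S + W`. -/
def chanZ {Ω : Type*} (H : Matrix (Fin nx) (Fin ns) ℝ) (S : Ω → Vec ns) (W : Ω → Vec nx)
    (ω : Ω) : Vec nx :=
  toEuclideanLin H (S ω) + W ω

/-- The decoder `(y, z) ↦ (Q_{X,Y} - H Q_{S,Y}) Q_Y⁻¹ y + z`. -/
def chanDec (P : Measure (Src nx ns ny)) (H : Matrix (Fin nx) (Fin ns) ℝ)
    (p : Vec ny × Vec nx) : Vec nx :=
  toEuclideanLin ((covXY P - H * covSY P) * (covY P)⁻¹) p.1 + p.2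

/-- The reconstruction `X̂ = (Q_{X,Y} - H Q_{S,Y}) Q_Y⁻¹ Y + Z`. -/
def chanX {Ω : Type*} (P : Measure (Src nx ns ny)) (H : Matrix (Fin nx) (Fin ns) ℝ)
    (S : Ω → Vec ns) (Y : Ω → Vec ny) (W : Ω → Vec nx) (ω : Ω) : Vec nx :=
  chanDec P H (Y ω, chanZ H S W ω)

end Source

section Characterization

/-- The four Penrose equations: `B` is the Moore-Penrose pseudoinverse of `A`. -/
def IsPinv {m n : ℕ} (A : Matrix (Fin m) (Fin n) ℝ) (B : Matrix (Fin n) (Fin m) ℝ) : Prop :=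
  A * B * A = A ∧ B * A * B = B ∧ (A * B)ᵀ = A * B ∧ (B * A)ᵀ = B * A

open Classical in
/-- The Moore-Penrose pseudoinverse `A†` (it always exists and is unique). -/
def pinv {m n : ℕ} (A : Matrix (Fin m) (Fin n) ℝ) : Matrix (Fin n) (Fin m) ℝ :=
  if h : ∃ B, IsPinv A B then h.choose else 0

/-- The pseudo-determinant, i.e. the product of the nonzero eigenvalues with multiplicity, of a
symmetric matrix. It is `det A` if `A` is nonsingular. -/
def pdet {n : ℕ} (A : Matrix (Fin n) (Fin n) ℝ) : ℝ :=
  (A.charpoly.roots.filter (· ≠ 0)).prod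

/-- `½ log (det A / det B)` for `A ⪰ B ⪰ 0`. If `A` is nonsingular this is the literal expression,
with value `∞` if `det B = 0`. For singular `A`, where the literal quotient is `0 / 0`, the
determinants are taken on the range of `A`; the value is then `∞` if the rank of `B` is smaller. -/
def halfLogDetRatio {n : ℕ} (A B : Matrix (Fin n) (Fin n) ℝ) : ℝ≥0∞ :=
  if A.rank = B.rank then ENNReal.ofReal (1 / 2 * Real.log (pdet A / pdet B)) else ⊤

variable {nx ns ny : ℕ}

/-- `Q_{X̂|Y} = H Q_{S|Y} Hᵀ + Q_W` -/
def covHatgY (P : Measure (Src nx ns ny)) (H : Matrix (Fin nx) (Fin ns) ℝ)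
    (QW : Matrix (Fin nx) (Fin nx) ℝ) : Matrix (Fin nx) (Fin nx) ℝ :=
  H * covSgY P * Hᵀ + QW

/-- `Q_{S|X̂,Y} = Q_{S|Y} - Q_{S|Y} Hᵀ Q_{X̂|Y}† H Q_{S|Y}` -/
def covSgHatY (P : Measure (Src nx ns ny)) (H : Matrix (Fin nx) (Fin ns) ℝ)
    (QW : Matrix (Fin nx) (Fin nx) ℝ) : Matrix (Fin ns) (Fin ns) ℝ :=
  covSgY P - covSgY P * Hᵀ * pinv (covHatgY P H QW) * H * covSgY P

/-- The infimum of `½ log (det Q_{S|Y} / det Q_{S|X̂,Y})` subject to `Σ_Δ ⪰ 0`, `tr Σ_Δ ≤ Δ`,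
`Q_{S|Y} ⪰ Q_{S|X̂,Y} ⪰ 0`. -/
def sourceCharacterization (P : Measure (Src nx ns ny)) (Δ : ℝ) : ℝ≥0∞ :=
  ⨅ (H : Matrix (Fin nx) (Fin ns) ℝ) (QW : Matrix (Fin nx) (Fin nx) ℝ)
    (D : Matrix (Fin nx) (Fin nx) ℝ)
    (_ : IsChannelParam P H QW D ∧ D.PosSemidef ∧ D.trace ≤ Δ ∧
      (covSgY P - covSgHatY P H QW).PosSemidef ∧ (covSgHatY P H QW).PosSemidef),
    halfLogDetRatio (covSgY P) (covSgHatY P H QW)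

/-- The infimum of `½ log (det Q_{X̂|Y} / det Q_W)` subject to `Σ_Δ ⪰ 0`, `tr Σ_Δ ≤ Δ`,
`Q_{X̂|Y} ⪰ Q_W ⪰ 0`. -/
def channelCharacterization (P : Measure (Src nx ns ny)) (Δ : ℝ) : ℝ≥0∞ :=
  ⨅ (H : Matrix (Fin nx) (Fin ns) ℝ) (QW : Matrix (Fin nx) (Fin nx) ℝ)
    (D : Matrix (Fin nx) (Fin nx) ℝ)
    (_ : IsChannelParam P H QW D ∧ D.PosSemidef ∧ D.trace ≤ Δ ∧
      (covHatgY P H QW - QW).PosSemidef ∧ QW.PosSemidef),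
    halfLogDetRatio (covHatgY P H QW) QW

end Characterization

section Structure

variable {nx ns ny : ℕ}

/-- The structural properties of a test channel `(Z, X̂)` with parameters `(H, Q_W)` and error
covariance `D`. -/
structure StructuralProperties (P : Measure (Src nx ns ny)) (H : Matrix (Fin nx) (Fin ns) ℝ)
    (QW D : Matrix (Fin nx) (Fin nx) ℝ)
    {Ω : Type*} [MeasurableSpace Ω] (μ : Measure Ω) [IsFiniteMeasure μ]
    (X : Ω → Vec nx) (S : Ω → Vec ns) (Y : Ω → Vec ny) (Z Xhat : Ω → Vec nx) : Prop where
  /-- `Σ_Δ = E[(X - X̂)(X - X̂)ᵀ]` -/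
  error_cov : secondMoment μ (fun ω => X ω - Xhat ω) = D
  /-- `P_{X|X̂,Y,Z} = P_{X|X̂,Y}` -/
  source_law : CondLawEq μ X (fun ω => (Xhat ω, Y ω, Z ω)) (fun ω => (Xhat ω, Y ω))
  /-- `P_{X|X̂,Y} = P_{X|X̂}` -/
  source_law_hat : CondLawEq μ X (fun ω => (Xhat ω, Y ω)) Xhat
  /-- `P_{Z|X,S,Y} = P_{Z|S}` -/
  aux_markov : CondLawEq μ Z (fun ω => (X ω, S ω, Y ω)) S
  /-- `I(S; Z | Y) = I(S; X̂ | Y)` -/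
  info_eq : condMutualInfo μ S Z Y = condMutualInfo μ S Xhat Y
  /-- `Q_{S|Z,Y} = Q_{S|X̂,Y}` -/
  cov_source_eq : condCov μ S S (fun ω => (Z ω, Y ω)) = condCov μ S S (fun ω => (Xhat ω, Y ω))
  /-- `Q_{X̂|Y} = Q_{Z|Y}` -/
  cov_hat_eq : condCov μ Xhat Xhat Y = condCov μ Z Z Y
  /-- `Q_{S|X̂,Y} = Q_{S|Y} - Q_{S|Y} Hᵀ Q_{X̂|Y}† H Q_{S|Y}` -/
  cov_source_formula : condCov μ S S (fun ω => (Xhat ω, Y ω)) = covSgHatY P H QW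
  /-- `Q_{X̂|Y} = H Q_{S|Y} Hᵀ + Q_W` -/
  cov_hat_formula : condCov μ Xhat Xhat Y = covHatgY P H QW
  /-- `Q_{X̂|Y} = Q_{X|Y} - Σ_Δ` -/
  cov_hat_sub : condCov μ Xhat Xhat Y = covXgY P - D
  /-- `E(X | X̂, Y, Z) = E(X | X̂)` -/
  condExp_eq : μ[X | sig (fun ω => (Xhat ω, Y ω, Z ω))] =ᵐ[μ] μ[X | sig Xhat]
  /-- `E(X | X̂) = X̂` -/
  condExp_hat : μ[X | sig Xhat] =ᵐ[μ] Xhat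
  /-- `E(X | Y) = E(X̂ | Y)` -/
  condExp_side : μ[X | sig Y] =ᵐ[μ] μ[Xhat | sig Y]

end Structure

end RemoteRDF

end

/-!
Subtracting the estimate given `Y` and factoring `Q_{S|Y} = B Bᵀ` with `B` of full column rank
replaces `S` by a white Gaussian vector `N` independent of `Y`, and `I(S; Z | Y)` by
`I((Y, Z); N)`. With `C = E[X Nᵀ]` and `J = H B`, the constraints `(*)` become
`J Cᵀ ⪰ 0` and `J Cᵀ - J Jᵀ = Q_W ⪰ 0`, and the rate of a test channel becomes
`-½ log det (1 - Jᵀ (J Cᵀ)† J)`.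

For the converse, let `V` be the best linear estimate of `X - E[X|Y]` given `f(Y, Z) - E[X|Y]`, and
put `J = E[V Nᵀ]`. The Markov condition makes `X - E[X|S, Y]` independent of `(Y, Z)`, so the normal
equations give `J Cᵀ = E[V Vᵀ]`: thus `J` satisfies the constraints, and its distortion is at most
that of `f(Y, Z)`. By the Donsker–Varadhan formula with a quadratic test function,
`I((Y, Z); N)` is at least `-½ log det` of the error covariance of any estimate of `N` from
`(Y, Z)`; the best linear estimate of `N` from `V` attains the rate of `J`. The optimal `J` exists
because the constraint set is compact and the determinant is upper semicontinuous.
-/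

noncomputable section

namespace RemoteRDF

section PositiveSemidefinite

variable {m n : Type*} [Fintype n]

theorem posSemidef_mul_mul_transpose {A : Matrix n n ℝ} (hA : A.PosSemidef) [Finite m]
    (B : Matrix m n ℝ) : (B * A * Bᵀ).PosSemidef := by
  simpa using hA.mul_mul_conjTranspose_same B

theorem posSemidef_mul_transpose_self [Finite m] (B : Matrix m n ℝ) : (B * Bᵀ).PosSemidef := by
  simpa using posSemidef_self_mul_conjTranspose B

theorem eq_zero_of_posSemidef_neg_mul_transpose [Finite m] {T : Matrix m n ℝ}
    (h : (-(T * Tᵀ)).PosSemidef) : T = 0 := by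
  have := Fintype.ofFinite m
  have hneg := h.trace_nonneg
  have hpos := (posSemidef_mul_transpose_self T).trace_nonneg
  rw [trace_neg] at hneg
  refine trace_mul_conjTranspose_self_eq_zero_iff.1 ?_
  rw [conjTranspose_eq_transpose_of_trivial]
  linarith

theorem exists_eq_mul_diagonal_mul_transpose [DecidableEq n] {A : Matrix n n ℝ}
    (hA : A.PosSemidef) : ∃ (U : Matrix n n ℝ) (σ : n → ℝ),
      Uᵀ * U = 1 ∧ U * Uᵀ = 1 ∧ (∀ i, 0 ≤ σ i) ∧ A = U * diagonal σ * Uᵀ := by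
  refine ⟨hA.1.eigenvectorUnitary, hA.1.eigenvalues, ?_, ?_, hA.eigenvalues_nonneg, ?_⟩
  · simpa [star_eq_conjTranspose] using Unitary.coe_star_mul_self hA.1.eigenvectorUnitary
  · simpa [star_eq_conjTranspose] using Unitary.coe_mul_star_self hA.1.eigenvectorUnitary
  · simpa [star_eq_conjTranspose, Unitary.conjStarAlgAut_apply, Function.comp_def]
      using hA.1.spectral_theorem

theorem exists_eq_mul_transpose {A : Matrix n n ℝ} (hA : A.PosSemidef) :
    ∃ R : Matrix n n ℝ, A = R * Rᵀ := by
  classical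
  obtain ⟨U, σ, -, -, hσ, rfl⟩ := exists_eq_mul_diagonal_mul_transpose hA
  have hsqrt : diagonal σ = diagonal (fun i => √(σ i)) * diagonal fun i => √(σ i) := by
    simp only [diagonal_mul_diagonal, Real.mul_self_sqrt (hσ _)]
  exact ⟨U * diagonal fun i => √(σ i), by
    simp only [hsqrt, transpose_mul, diagonal_transpose, Matrix.mul_assoc]⟩

variable [DecidableEq n]

theorem one_le_det_one_add {C : Matrix n n ℝ} (hC : C.PosSemidef) : 1 ≤ (1 + C).det := by
  obtain ⟨U, σ, -, hU, hσ, hsp⟩ := exists_eq_mul_diagonal_mul_transpose hC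
  have hdiag : 1 + C = U * diagonal (fun i => 1 + σ i) * Uᵀ := by
    have : diagonal (fun i => 1 + σ i) = 1 + diagonal σ := by
      rw [← diagonal_one, diagonal_add]
    rw [this, Matrix.mul_add, Matrix.add_mul, Matrix.mul_one, hU, ← hsp]
  rw [hdiag, det_mul_right_comm, hU, Matrix.one_mul, det_diagonal]
  simpa using Finset.prod_le_prod (s := Finset.univ) (f := fun _ : n => (1 : ℝ))
    (fun _ _ => zero_le_one) fun i _ => by linarith [hσ i]

theorem det_le_det_of_posSemidef_sub {A B : Matrix n n ℝ} (hA : A.PosSemidef)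
    (hAB : (B - A).PosSemidef) : A.det ≤ B.det := by
  by_cases hd : A.det = 0
  · have hB : B.PosSemidef := by simpa using hA.add hAB
    exact hd.trans_le hB.det_nonneg
  obtain ⟨R, rfl⟩ := exists_eq_mul_transpose hA
  have hR : R * R⁻¹ = 1 :=
    mul_nonsing_inv R (isUnit_iff_ne_zero.2 (left_ne_zero_of_mul (det_mul R Rᵀ ▸ hd)))
  have hRt : R⁻¹ᵀ * Rᵀ = 1 := by rw [← transpose_mul, hR, transpose_one]
  have hB : B = R * (1 + R⁻¹ * (B - R * Rᵀ) * R⁻¹ᵀ) * Rᵀ := by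
    calc B = R * Rᵀ + R * R⁻¹ * (B - R * Rᵀ) * (R⁻¹ᵀ * Rᵀ) := by
          rw [hR, hRt, Matrix.one_mul, Matrix.mul_one, add_sub_cancel]
      _ = R * (1 + R⁻¹ * (B - R * Rᵀ) * R⁻¹ᵀ) * Rᵀ := by
          simp only [Matrix.mul_add, Matrix.add_mul, Matrix.mul_one, Matrix.mul_assoc]
  have hone := one_le_det_one_add (posSemidef_mul_mul_transpose hAB R⁻¹)
  rw [hB, det_mul, det_mul, det_mul, det_transpose]
  nlinarith [mul_self_nonneg R.det]

theorem rank_lt_card_of_det_eq_zero {A : Matrix n n ℝ} (hA : A.det = 0) :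
    A.rank < Fintype.card n := by
  refine lt_of_le_of_ne A.rank_le_card_width fun hrank => ?_
  have hrange : LinearMap.range A.mulVecLin = ⊤ :=
    Submodule.eq_top_of_finrank_eq (by rwa [Module.finrank_fintype_fun_eq_card])
  have hunit := mulVec_surjective_iff_isUnit.1 (LinearMap.range_eq_top.1 hrange)
  exact ((isUnit_iff_isUnit_det A).1 hunit).ne_zero hA

theorem isClosed_setOf_posSemidef {n : Type*} [Finite n] :
    IsClosed {M : Matrix n n ℝ | M.PosSemidef} := by
  have := Fintype.ofFinite n
  simp only [posSemidef_iff_dotProduct_mulVec, Set.ofPred_and, Set.ofPred_forall]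
  refine IsClosed.inter ?_ (isClosed_iInter fun x => ?_)
  · exact isClosed_eq (by fun_prop) continuous_id
  · exact isClosed_le continuous_const (by fun_prop)

end PositiveSemidefinite

section FullRankFactorization

variable {n κ l : Type*} [Fintype n] [Fintype κ] [Fintype l] [DecidableEq κ]

/-- A full-rank factorization `Q = B Bᵀ` of a positive semidefinite matrix, together with the left
inverse `L` of `B` for which `B L` is the orthogonal projection onto the range of `Q`. It provides
coordinates in which `Q` becomes the identity matrix. -/
structure IsFullRankFactor (Q : Matrix n n ℝ) (B : Matrix n κ ℝ) (L : Matrix κ n ℝ) : Prop where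
  eq_mul_transpose : Q = B * Bᵀ
  left_inv : L * B = 1
  mul_symm : (B * L)ᵀ = B * L

theorem exists_isFullRankFactor {Q : Matrix n n ℝ} (hQ : Q.PosSemidef) :
    ∃ (r : ℕ) (B : Matrix n (Fin r) ℝ) (L : Matrix (Fin r) n ℝ), IsFullRankFactor Q B L := by
  classical
  obtain ⟨U, σ, hU, -, hσ, hsp⟩ := exists_eq_mul_diagonal_mul_transpose hQ
  let e := (Fintype.equivFin {i // σ i ≠ 0}).symm
  let s : Fin (Fintype.card {i // σ i ≠ 0}) → ℝ := fun k => √(σ (e k).1)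
  have hs : ∀ k, s k ≠ 0 := fun k =>
    (Real.sqrt_pos.2 (lt_of_le_of_ne (hσ _) (e k).2.symm)).ne'
  let V := U.submatrix id fun k => (e k).1
  have hV : Vᵀ * V = 1 := by
    rw [transpose_submatrix, ← submatrix_mul _ _ _ _ _ Function.bijective_id, hU,
      submatrix_one (fun k => (e k).1) (Subtype.val_injective.comp e.injective)]
  have hQV : Q = V * diagonal (fun k => σ (e k).1) * Vᵀ := by
    ext i j
    rw [hsp]
    rw [mul_apply, mul_apply]
    simp only [mul_diagonal, transpose_apply, V, submatrix_apply, id]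
    rw [Equiv.sum_comp e (fun k : {i // σ i ≠ 0} => U i k.1 * σ k.1 * U j k.1),
      ← Finset.sum_subtype (Finset.univ.filter fun i => σ i ≠ 0) (by simp)
        (fun k => U i k * σ k * U j k), Finset.sum_filter]
    exact Finset.sum_congr rfl fun k _ => by split_ifs with h <;> simp_all
  have hinv : diagonal (fun k => (s k)⁻¹) * diagonal s = 1 := by
    simp [diagonal_mul_diagonal, hs]
  have hsq : diagonal s * diagonal s = diagonal fun k => σ (e k).1 := by
    simp [diagonal_mul_diagonal, s, Real.mul_self_sqrt (hσ _)]
  have hinv' : diagonal s * diagonal (fun k => (s k)⁻¹) = 1 := mul_eq_one_comm.1 hinv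
  refine ⟨_, V * diagonal s, diagonal (fun k => (s k)⁻¹) * Vᵀ, ?_, ?_, ?_⟩
  · rw [hQV, ← hsq]
    simp only [transpose_mul, diagonal_transpose, Matrix.mul_assoc]
  · rw [Matrix.mul_assoc, ← Matrix.mul_assoc Vᵀ, hV, Matrix.one_mul, hinv]
  · have hproj : V * diagonal s * (diagonal (fun k => (s k)⁻¹) * Vᵀ) = V * Vᵀ := by
      rw [Matrix.mul_assoc, ← Matrix.mul_assoc (diagonal s), hinv', Matrix.one_mul]
    rw [hproj, transpose_mul, transpose_transpose]

namespace IsFullRankFactor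

variable {Q : Matrix n n ℝ} {B : Matrix n κ ℝ} {L : Matrix κ n ℝ}

theorem transpose_mul_transpose (h : IsFullRankFactor Q B L) : Bᵀ * Lᵀ = 1 := by
  rw [← transpose_mul, h.left_inv, transpose_one]

theorem mul_conj_transpose (h : IsFullRankFactor Q B L) (M : Matrix κ κ ℝ) :
    L * (B * M * Bᵀ) * Lᵀ = M := by
  rw [Matrix.mul_assoc, Matrix.mul_assoc (B * M), h.transpose_mul_transpose, Matrix.mul_one,
    ← Matrix.mul_assoc, h.left_inv, Matrix.one_mul]

theorem conj_eq_one (h : IsFullRankFactor Q B L) : L * Q * Lᵀ = 1 := by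
  simpa [← h.eq_mul_transpose] using h.mul_conj_transpose 1

theorem mul_left_inv_mul_of_posSemidef_sub (h : IsFullRankFactor Q B L) {J : Matrix n l ℝ}
    (hJ : (Q - J * Jᵀ).PosSemidef) : B * (L * J) = J := by
  classical
  set T := 1 - B * L with hT
  have hTQ : T * Q = 0 := by
    rw [hT, Matrix.sub_mul, h.eq_mul_transpose, Matrix.one_mul, Matrix.mul_assoc B,
      ← Matrix.mul_assoc L, h.left_inv, Matrix.one_mul, sub_self]
  have hneg : T * (Q - J * Jᵀ) * Tᵀ = -((T * J) * (T * J)ᵀ) := by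
    simp only [Matrix.mul_sub, hTQ, zero_sub, Matrix.neg_mul, transpose_mul, Matrix.mul_assoc]
  have hTJ := eq_zero_of_posSemidef_neg_mul_transpose
    (hneg ▸ posSemidef_mul_mul_transpose hJ T)
  rw [hT, Matrix.sub_mul, Matrix.one_mul, sub_eq_zero, Matrix.mul_assoc] at hTJ
  exact hTJ.symm

theorem sub_mul_transpose_eq (h : IsFullRankFactor Q B L) {J : Matrix n l ℝ}
    (hJ : (Q - J * Jᵀ).PosSemidef) :
    Q - J * Jᵀ = B * (1 - (L * J) * (L * J)ᵀ) * Bᵀ := by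
  calc Q - J * Jᵀ = B * Bᵀ - B * (L * J) * (B * (L * J))ᵀ := by
        rw [h.mul_left_inv_mul_of_posSemidef_sub hJ, h.eq_mul_transpose]
    _ = _ := by
        simp only [transpose_mul, Matrix.mul_sub, Matrix.sub_mul, Matrix.mul_one, Matrix.mul_assoc]

theorem posSemidef_one_sub (h : IsFullRankFactor Q B L) {J : Matrix n l ℝ}
    (hJ : (Q - J * Jᵀ).PosSemidef) : (1 - (L * J) * (L * J)ᵀ).PosSemidef := by
  rw [← h.mul_conj_transpose (1 - (L * J) * (L * J)ᵀ), ← h.sub_mul_transpose_eq hJ]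
  exact posSemidef_mul_mul_transpose hJ L

theorem rank_conj (h : IsFullRankFactor Q B L) (M : Matrix κ κ ℝ) :
    (B * M * Bᵀ).rank = M.rank := by
  refine le_antisymm ((rank_mul_le_left _ _).trans (rank_mul_le_right _ _)) ?_
  calc M.rank = (L * (B * M * Bᵀ) * Lᵀ).rank := by rw [h.mul_conj_transpose]
    _ ≤ (B * M * Bᵀ).rank := (rank_mul_le_left _ _).trans (rank_mul_le_right _ _)

theorem rank_eq (h : IsFullRankFactor Q B L) : Q.rank = Fintype.card κ := by
  rw [h.eq_mul_transpose, ← rank_one (R := ℝ) (n := κ), ← h.rank_conj 1, Matrix.mul_one]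

theorem det_gram_ne_zero (h : IsFullRankFactor Q B L) : (Bᵀ * B).det ≠ 0 := by
  intro hdet
  have hlt := rank_lt_card_of_det_eq_zero hdet
  rw [rank_transpose_mul_self, ← rank_self_mul_transpose, ← h.eq_mul_transpose, h.rank_eq] at hlt
  exact lt_irrefl _ hlt

end IsFullRankFactor

end FullRankFactorization

section PseudoInverse

theorem IsPinv.eq {m n : ℕ} {A : Matrix (Fin m) (Fin n) ℝ} {B C : Matrix (Fin n) (Fin m) ℝ}
    (hB : IsPinv A B) (hC : IsPinv A C) : B = C := by
  obtain ⟨hB₁, hB₂, hB₃, hB₄⟩ := hB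
  obtain ⟨hC₁, hC₂, hC₃, hC₄⟩ := hC
  have hAB : A * B = A * C := by
    calc A * B = A * C * (A * B) := by rw [← Matrix.mul_assoc, hC₁]
      _ = ((A * B) * (A * C))ᵀ := by rw [transpose_mul, hB₃, hC₃]
      _ = A * C := by rw [← Matrix.mul_assoc, hB₁, hC₃]
  have hBA : B * A = C * A := by
    calc B * A = B * A * (C * A) := by rw [Matrix.mul_assoc, ← Matrix.mul_assoc A, hC₁]
      _ = ((C * A) * (B * A))ᵀ := by rw [transpose_mul, hB₄, hC₄]
      _ = C * A := by rw [Matrix.mul_assoc, ← Matrix.mul_assoc A, hB₁, hC₄]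
  calc B = C * A * B := by rw [← hBA, hB₂]
    _ = C := by rw [Matrix.mul_assoc, hAB, ← Matrix.mul_assoc, hC₂]

theorem IsFullRankFactor.pinv_eq {n : ℕ} {κ : Type*} [Fintype κ] [DecidableEq κ]
    {Q : Matrix (Fin n) (Fin n) ℝ} {B : Matrix (Fin n) κ ℝ} {L : Matrix κ (Fin n) ℝ}
    (h : IsFullRankFactor Q B L) : pinv Q = Lᵀ * L := by
  have hright : Q * (Lᵀ * L) = B * L := by
    rw [h.eq_mul_transpose, Matrix.mul_assoc, ← Matrix.mul_assoc Bᵀ, h.transpose_mul_transpose,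
      Matrix.one_mul]
  have hleft : Lᵀ * L * Q = B * L := by
    rw [h.eq_mul_transpose, Matrix.mul_assoc, ← Matrix.mul_assoc L, h.left_inv, Matrix.one_mul,
      ← transpose_mul, h.mul_symm]
  have hpinv : IsPinv Q (Lᵀ * L) := by
    refine ⟨?_, ?_, by rw [hright, h.mul_symm], by rw [hleft, h.mul_symm]⟩
    · rw [hright, h.eq_mul_transpose, Matrix.mul_assoc, ← Matrix.mul_assoc L, h.left_inv,
        Matrix.one_mul]
    · rw [hleft, ← h.mul_symm, transpose_mul, Matrix.mul_assoc, ← Matrix.mul_assoc Bᵀ,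
        h.transpose_mul_transpose, Matrix.one_mul]
  have hex : ∃ A, IsPinv Q A := ⟨_, hpinv⟩
  rw [pinv, dif_pos hex]
  exact hex.choose_spec.eq hpinv

end PseudoInverse

section DeterminantRatio

theorem filter_roots_X_pow_mul {p : Polynomial ℝ} (hp : p ≠ 0) (k : ℕ) :
    ((Polynomial.X ^ k * p).roots.filter (· ≠ 0)) = p.roots.filter (· ≠ 0) := by
  rw [Polynomial.roots_mul (mul_ne_zero (pow_ne_zero k Polynomial.X_ne_zero) hp),
    Polynomial.roots_X_pow, Multiset.filter_add, add_eq_right, Multiset.filter_eq_nil]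
  intro a ha
  simp [Multiset.mem_singleton.1 (Multiset.mem_of_mem_nsmul ha)]

theorem pdet_mul_comm {m n : ℕ} (A : Matrix (Fin m) (Fin n) ℝ) (B : Matrix (Fin n) (Fin m) ℝ) :
    pdet (A * B) = pdet (B * A) := by
  rw [pdet, pdet, ← filter_roots_X_pow_mul (charpoly_monic _).ne_zero (Fintype.card (Fin n)),
    charpoly_mul_comm', filter_roots_X_pow_mul (charpoly_monic _).ne_zero]

theorem pdet_eq_det_of_posDef {n : ℕ} {A : Matrix (Fin n) (Fin n) ℝ} (hA : A.PosDef) :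
    pdet A = A.det := by
  rw [pdet, hA.1.roots_charpoly_eq_eigenvalues, hA.1.det_eq_prod_eigenvalues,
    Multiset.filter_eq_self.2]
  · rfl
  · intro a ha
    obtain ⟨i, -, rfl⟩ := Multiset.mem_map.1 ha
    simpa using (hA.eigenvalues_pos i).ne'

theorem pdet_mul_transpose_self {n r : ℕ} {C : Matrix (Fin n) (Fin r) ℝ}
    (hC : (Cᵀ * C).det ≠ 0) : pdet (C * Cᵀ) = (Cᵀ * C).det := by
  have hpsd : (Cᵀ * C).PosSemidef := by simpa using posSemidef_mul_transpose_self Cᵀ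
  rw [pdet_mul_comm, pdet_eq_det_of_posDef (hpsd.posDef_iff_det_ne_zero.2 hC)]

/-- `½ log (1 / d)`, with the value `∞` at `d = 0`: the value of `halfLogDetRatio` in coordinates
where the numerator matrix is the identity. -/
def halfLogInv (d : ℝ) : ℝ≥0∞ :=
  if d = 0 then ⊤ else ENNReal.ofReal (-(1 / 2) * Real.log d)

theorem halfLogInv_le_halfLogInv {a b : ℝ} (ha : 0 ≤ a) (hab : a ≤ b) :
    halfLogInv b ≤ halfLogInv a := by
  unfold halfLogInv
  rcases ha.eq_or_lt with rfl | ha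
  · simp
  · rw [if_neg ha.ne', if_neg (ha.trans_le hab).ne']
    exact ENNReal.ofReal_le_ofReal (by linarith [Real.log_le_log ha hab])

theorem IsFullRankFactor.halfLogDetRatio_conj {n r : ℕ} {Q : Matrix (Fin n) (Fin n) ℝ}
    {B : Matrix (Fin n) (Fin r) ℝ} {L : Matrix (Fin r) (Fin n) ℝ} (h : IsFullRankFactor Q B L)
    {M : Matrix (Fin r) (Fin r) ℝ} (hM : M.PosSemidef) :
    halfLogDetRatio Q (B * M * Bᵀ) = halfLogInv M.det := by
  rw [halfLogDetRatio, halfLogInv, h.rank_eq, h.rank_conj]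
  by_cases hd : M.det = 0
  · rw [if_pos hd, if_neg (rank_lt_card_of_det_eq_zero hd).ne']
  rw [if_neg hd, if_pos (rank_of_det_ne_zero hd).symm]
  obtain ⟨R, rfl⟩ := exists_eq_mul_transpose hM
  have hR : R.det ≠ 0 := left_ne_zero_of_mul (det_mul R Rᵀ ▸ hd)
  have hB := h.det_gram_ne_zero
  have hBR : B * (R * Rᵀ) * Bᵀ = (B * R) * (B * R)ᵀ := by
    simp only [transpose_mul, Matrix.mul_assoc]
  have hdet : ((B * R)ᵀ * (B * R)).det = R.det * (Bᵀ * B).det * R.det := by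
    rw [transpose_mul, Matrix.mul_assoc, ← Matrix.mul_assoc Bᵀ, det_mul, det_mul, det_transpose]
    ring
  have hratio : (Bᵀ * B).det / (R.det * (Bᵀ * B).det * R.det) = (R.det * R.det)⁻¹ := by
    field_simp
  rw [hBR, h.eq_mul_transpose, pdet_mul_transpose_self hB,
    pdet_mul_transpose_self (hdet ▸ mul_ne_zero (mul_ne_zero hR hB) hR), hdet, hratio,
    Real.log_inv, det_mul, det_transpose]
  ring_nf

end DeterminantRatio

section SchurComplement

theorem transpose_mul_pinv_mul {n : ℕ} {r : Type*} [Fintype r]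
    {Q : Matrix (Fin n) (Fin n) ℝ} {J : Matrix (Fin n) r ℝ} (hQ : Q.PosSemidef)
    (hJ : (Q - J * Jᵀ).PosSemidef) : Jᵀ * pinv Q * Q = Jᵀ := by
  obtain ⟨k, B, L, h⟩ := exists_isFullRankFactor hQ
  have hJ' := congrArg transpose (h.mul_left_inv_mul_of_posSemidef_sub hJ)
  rw [← Matrix.mul_assoc, transpose_mul, h.mul_symm] at hJ'
  calc Jᵀ * pinv Q * Q = Jᵀ * (Lᵀ * (L * B) * Bᵀ) := by
        rw [h.pinv_eq, h.eq_mul_transpose]; simp only [Matrix.mul_assoc]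
    _ = Jᵀ := by rw [h.left_inv, Matrix.mul_one, ← transpose_mul, h.mul_symm, hJ']

variable {n : ℕ} {r : Type*} [DecidableEq r]

/-- The Schur complement `1 - Jᵀ Q† J`: the conditional covariance of a white Gaussian vector `N`
given a Gaussian vector `V` with `cov(V) = Q` and `cov(V, N) = J`. -/
def schur (Q : Matrix (Fin n) (Fin n) ℝ) (J : Matrix (Fin n) r ℝ) : Matrix r r ℝ :=
  1 - Jᵀ * pinv Q * J

variable {Q : Matrix (Fin n) (Fin n) ℝ} {J : Matrix (Fin n) r ℝ}

theorem IsFullRankFactor.schur_eq {κ : Type*} [Fintype κ] [DecidableEq κ]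
    {B : Matrix (Fin n) κ ℝ} {L : Matrix κ (Fin n) ℝ} (h : IsFullRankFactor Q B L)
    (J : Matrix (Fin n) r ℝ) : schur Q J = 1 - (L * J)ᵀ * (L * J) := by
  rw [schur, h.pinv_eq, transpose_mul]
  simp only [Matrix.mul_assoc]

variable [Fintype r]

theorem schur_posSemidef (hQ : Q.PosSemidef) (hJ : (Q - J * Jᵀ).PosSemidef) :
    (schur Q J).PosSemidef := by
  obtain ⟨k, B, L, h⟩ := exists_isFullRankFactor hQ
  set F := L * J with hF
  have hsum : 1 - Fᵀ * F = (1 - Fᵀ * F) * (1 - Fᵀ * F)ᵀ + Fᵀ * (1 - F * Fᵀ) * Fᵀᵀ := by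
    simp only [transpose_sub, transpose_one, transpose_mul, transpose_transpose, Matrix.mul_sub,
      Matrix.sub_mul, Matrix.mul_one, Matrix.one_mul, Matrix.mul_assoc]
    abel
  rw [h.schur_eq, ← hF, hsum]
  exact (posSemidef_mul_transpose_self _).add
    (posSemidef_mul_mul_transpose (h.posSemidef_one_sub hJ) _)

theorem halfLogDetRatio_sub_mul_transpose (hQ : Q.PosSemidef) (hJ : (Q - J * Jᵀ).PosSemidef) :
    halfLogDetRatio Q (Q - J * Jᵀ) = halfLogInv (schur Q J).det := by
  obtain ⟨k, B, L, h⟩ := exists_isFullRankFactor hQ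
  rw [h.schur_eq, det_one_sub_mul_comm, h.sub_mul_transpose_eq hJ,
    h.halfLogDetRatio_conj (h.posSemidef_one_sub hJ)]

/-- The error covariance of an arbitrary linear estimator `A V`; it is minimal for
`A = Jᵀ Q†`, where it equals `schur Q J`. -/
def linearError (Q : Matrix (Fin n) (Fin n) ℝ) (J : Matrix (Fin n) r ℝ)
    (A : Matrix r (Fin n) ℝ) : Matrix r r ℝ :=
  1 - A * J - (A * J)ᵀ + A * Q * Aᵀ

theorem linearError_eq_schur (hQ : Q.PosSemidef) (hJ : (Q - J * Jᵀ).PosSemidef) :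
    linearError Q J (Jᵀ * pinv Q) = schur Q J := by
  rw [linearError, transpose_mul_pinv_mul hQ hJ, transpose_mul (Jᵀ * pinv Q), sub_add_cancel,
    schur]

theorem det_schur_le_det_linearError (hQ : Q.PosSemidef) (hJ : (Q - J * Jᵀ).PosSemidef)
    (A : Matrix r (Fin n) ℝ) : (schur Q J).det ≤ (linearError Q J A).det := by
  refine det_le_det_of_posSemidef_sub (schur_posSemidef hQ hJ) ?_
  obtain ⟨k, B, L, h⟩ := exists_isFullRankFactor hQ
  have hsquare : linearError Q J A - schur Q J
      = (A * B - (L * J)ᵀ) * (A * B - (L * J)ᵀ)ᵀ := by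
    have hAJ : A * B * (L * J) = A * J := by
      rw [Matrix.mul_assoc, h.mul_left_inv_mul_of_posSemidef_sub hJ]
    have hAQ : A * B * (A * B)ᵀ = A * Q * Aᵀ := by
      rw [h.eq_mul_transpose, transpose_mul]; simp only [Matrix.mul_assoc]
    rw [linearError, h.schur_eq, transpose_sub, transpose_transpose, Matrix.mul_sub,
      Matrix.sub_mul, Matrix.sub_mul, hAJ, hAQ, ← transpose_mul, hAJ]
    abel
  exact hsquare ▸ posSemidef_mul_transpose_self _

end SchurComplement

section Optimization

variable {n r : ℕ}

/-- The feasible set of the rate distortion problem in coordinates where the remote source is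
white: `J = H B` for a full-rank factor `B` of `Q_{S|Y}`, `C` is the covariance of `X` with the
whitened source and `QX = Q_{X|Y}`, so that `J Cᵀ = Q_{X̂|Y}`, `J Cᵀ - J Jᵀ = Q_W` and
`QX - J Cᵀ = Σ_Δ`. -/
structure Feasible (C : Matrix (Fin n) (Fin r) ℝ) (QX : Matrix (Fin n) (Fin n) ℝ)
    (Δ : ℝ) (J : Matrix (Fin n) (Fin r) ℝ) : Prop where
  posSemidef : (J * Cᵀ).PosSemidef
  noise_posSemidef : (J * Cᵀ - J * Jᵀ).PosSemidef
  error_posSemidef : (QX - J * Cᵀ).PosSemidef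
  trace_le : (QX - J * Cᵀ).trace ≤ Δ

variable (C : Matrix (Fin n) (Fin r) ℝ) (QX : Matrix (Fin n) (Fin n) ℝ) (Δ : ℝ)

theorem isClosed_setOf_feasible : IsClosed {J | Feasible C QX Δ J} := by
  have hinter : {J | Feasible C QX Δ J} = ((fun J => J * Cᵀ) ⁻¹' {M | M.PosSemidef}) ∩
      (((fun J => J * Cᵀ - J * Jᵀ) ⁻¹' {M | M.PosSemidef}) ∩
      (((fun J => QX - J * Cᵀ) ⁻¹' {M | M.PosSemidef}) ∩ {J | (QX - J * Cᵀ).trace ≤ Δ})) :=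
    Set.ext fun J => ⟨fun h => ⟨h.1, h.2, h.3, h.4⟩, fun h => ⟨h.1, h.2.1, h.2.2.1, h.2.2.2⟩⟩
  rw [hinter]
  exact (isClosed_setOf_posSemidef.preimage (by fun_prop)).inter
    ((isClosed_setOf_posSemidef.preimage (by fun_prop)).inter
      ((isClosed_setOf_posSemidef.preimage (by fun_prop)).inter
        (isClosed_le (by fun_prop) continuous_const)))

theorem sq_apply_le_trace_mul_transpose {m n : Type*} [Fintype m] [Fintype n] (J : Matrix m n ℝ)
    (i : m) (j : n) : J i j ^ 2 ≤ (J * Jᵀ).trace := by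
  simp only [trace, diag_apply, mul_apply, transpose_apply, ← pow_two]
  calc J i j ^ 2 ≤ ∑ l, J i l ^ 2 :=
        Finset.single_le_sum (f := fun l => J i l ^ 2) (fun _ _ => sq_nonneg _)
          (Finset.mem_univ j)
    _ ≤ ∑ k, ∑ l, J k l ^ 2 := Finset.single_le_sum (f := fun k => ∑ l, J k l ^ 2)
          (fun _ _ => Finset.sum_nonneg fun _ _ => sq_nonneg _) (Finset.mem_univ i)

theorem isCompact_setOf_feasible : IsCompact {J | Feasible C QX Δ J} := by
  have hbox : IsCompact (Set.univ.pi fun _ : Fin n => Set.univ.pi fun _ : Fin r =>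
      Set.Icc (-√QX.trace) (√QX.trace)) :=
    isCompact_univ_pi fun _ => isCompact_univ_pi fun _ => isCompact_Icc
  refine hbox.of_isClosed_subset (isClosed_setOf_feasible C QX Δ)
    fun (J : Matrix (Fin n) (Fin r) ℝ) hJ i _ j _ => abs_le.1 (Real.abs_le_sqrt ?_)
  have hnoise := hJ.noise_posSemidef.trace_nonneg
  have herror := hJ.error_posSemidef.trace_nonneg
  rw [trace_sub] at hnoise herror
  linarith [sq_apply_le_trace_mul_transpose J i j]

/- The pseudoinverse is discontinuous, but by `det_schur_le_det_linearError` the objective is an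
infimum of continuous functions of `J`. -/
theorem upperSemicontinuousOn_det_schur :
    UpperSemicontinuousOn (fun J => (schur (J * Cᵀ) J).det) {J | Feasible C QX Δ J} := by
  intro J₀ hJ₀ y hy
  set A := J₀ᵀ * pinv (J₀ * Cᵀ) with hA
  have hcont : Continuous fun J => (linearError (J * Cᵀ) J A).det := by
    unfold linearError
    fun_prop
  have hlt₀ : (linearError (J₀ * Cᵀ) J₀ A).det < y := by
    rwa [hA, linearError_eq_schur hJ₀.posSemidef hJ₀.noise_posSemidef]
  filter_upwards [self_mem_nhdsWithin,
    nhdsWithin_le_nhds (hcont.continuousAt.eventually_lt_const hlt₀)] with J hJ hlt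
  exact (det_schur_le_det_linearError hJ.posSemidef hJ.noise_posSemidef A).trans_lt hlt

variable {C QX Δ}

theorem exists_feasible_forall_det_schur_le (h : ∃ J, Feasible C QX Δ J) :
    ∃ J, Feasible C QX Δ J ∧ ∀ J', Feasible C QX Δ J' →
      (schur (J' * Cᵀ) J').det ≤ (schur (J * Cᵀ) J).det := by
  obtain ⟨J, hJ, hmax⟩ := (upperSemicontinuousOn_det_schur C QX Δ).exists_isMaxOn h
    (isCompact_setOf_feasible C QX Δ)
  exact ⟨J, hJ, fun J' hJ' => hmax hJ'⟩

end Optimization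

section Moments

variable {Ω : Type*} [MeasurableSpace Ω] {μ : Measure Ω}
variable {ι κ l : Type*} {U U' : Ω → ι → ℝ} {V V' : Ω → κ → ℝ}

/-- The matrix `E[U Vᵀ]` of mixed second moments of two random vectors given by their
coordinates. -/
def crossMoment (μ : Measure Ω) (U : Ω → ι → ℝ) (V : Ω → κ → ℝ) : Matrix ι κ ℝ :=
  Matrix.of fun i j => ∫ ω, U ω i * V ω j ∂μ

theorem crossMoment_apply (i : ι) (j : κ) : crossMoment μ U V i j = ∫ ω, U ω i * V ω j ∂μ :=
  rfl

theorem crossMoment_transpose (U : Ω → ι → ℝ) (V : Ω → κ → ℝ) :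
    (crossMoment μ U V)ᵀ = crossMoment μ V U := by
  ext i j
  simp [crossMoment, mul_comm]

theorem crossMoment_congr (hU : U =ᵐ[μ] U') (hV : V =ᵐ[μ] V') :
    crossMoment μ U V = crossMoment μ U' V' := by
  ext i j
  refine integral_congr_ae ?_
  filter_upwards [hU, hV] with ω hω hω'
  rw [hω, hω']

variable [Fintype ι] [Fintype κ]

theorem memLp_mulVec (hU : MemLp U 2 μ) (A : Matrix κ ι ℝ) : MemLp (fun ω => A *ᵥ U ω) 2 μ :=
  (LinearMap.toContinuousLinearMap A.mulVecLin).comp_memLp' hU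

theorem integrable_eval_mul_eval (hU : MemLp U 2 μ) (hV : MemLp V 2 μ) (i : ι) (j : κ) :
    Integrable (fun ω => U ω i * V ω j) μ :=
  (hU.eval i).integrable_mul (hV.eval j)

theorem crossMoment_sub_left (hU : MemLp U 2 μ) (hU' : MemLp U' 2 μ) (hV : MemLp V 2 μ) :
    crossMoment μ (fun ω => U ω - U' ω) V = crossMoment μ U V - crossMoment μ U' V := by
  ext i j
  simp only [crossMoment_apply, Pi.sub_apply, sub_mul, Matrix.sub_apply]
  exact integral_sub (integrable_eval_mul_eval hU hV i j) (integrable_eval_mul_eval hU' hV i j)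

theorem crossMoment_mulVec_left (hU : MemLp U 2 μ) (hV : MemLp V 2 μ) (A : Matrix l ι ℝ) :
    crossMoment μ (fun ω => A *ᵥ U ω) V = A * crossMoment μ U V := by
  ext i j
  simp only [crossMoment_apply, Matrix.mulVec, dotProduct, mul_apply, Finset.sum_mul, mul_assoc]
  rw [integral_finsetSum _ fun k _ => (integrable_eval_mul_eval hU hV k j).const_mul _]
  simp only [integral_const_mul]

theorem crossMoment_sub_right (hU : MemLp U 2 μ) (hV : MemLp V 2 μ) (hV' : MemLp V' 2 μ) :
    crossMoment μ U (fun ω => V ω - V' ω) = crossMoment μ U V - crossMoment μ U V' := by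
  rw [← crossMoment_transpose, crossMoment_sub_left hV hV' hU, transpose_sub,
    crossMoment_transpose, crossMoment_transpose]

theorem crossMoment_mulVec_right (hU : MemLp U 2 μ) (hV : MemLp V 2 μ) (A : Matrix l κ ℝ) :
    crossMoment μ U (fun ω => A *ᵥ V ω) = crossMoment μ U V * Aᵀ := by
  rw [← crossMoment_transpose, crossMoment_mulVec_left hV hU, transpose_mul,
    crossMoment_transpose]

theorem crossMoment_mulVec_mulVec [Finite l] (hU : MemLp U 2 μ) (A : Matrix l ι ℝ) :
    crossMoment μ (fun ω => A *ᵥ U ω) (fun ω => A *ᵥ U ω) = A * crossMoment μ U U * Aᵀ := by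
  have := Fintype.ofFinite l
  rw [crossMoment_mulVec_left hU (memLp_mulVec hU A), crossMoment_mulVec_right hU hU,
    Matrix.mul_assoc]

theorem dotProduct_crossMoment_mulVec (hU : MemLp U 2 μ) (x : ι → ℝ) :
    x ⬝ᵥ (crossMoment μ U U *ᵥ x) = ∫ ω, (x ⬝ᵥ U ω) ^ 2 ∂μ := by
  have hrow := crossMoment_mulVec_mulVec hU (replicateRow Unit x)
  have hentry := congrFun (congrFun hrow ()) ()
  simp only [crossMoment_apply, ← sq] at hentry
  rw [dotProduct_mulVec]
  exact hentry.symm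

theorem posSemidef_crossMoment (hU : MemLp U 2 μ) : (crossMoment μ U U).PosSemidef := by
  refine PosSemidef.of_dotProduct_mulVec_nonneg ?_ fun x => ?_
  · rw [IsHermitian, conjTranspose_eq_transpose_of_trivial, crossMoment_transpose]
  · rw [star_trivial, dotProduct_crossMoment_mulVec hU]
    exact integral_nonneg fun ω => sq_nonneg _

theorem ae_eq_zero_of_crossMoment_eq_zero (hU : MemLp U 2 μ) (h0 : crossMoment μ U U = 0) :
    ∀ᵐ ω ∂μ, U ω = 0 := by
  have hcoord : ∀ i, ∀ᵐ ω ∂μ, U ω i = 0 := fun i => by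
    have hii := congrFun (congrFun h0 i) i
    simp only [crossMoment_apply, ← sq, Matrix.zero_apply] at hii
    filter_upwards [(integral_eq_zero_iff_of_nonneg (fun ω => sq_nonneg (U ω i))
      (hU.eval i).integrable_sq).1 hii] with ω hω
    simpa using hω
  filter_upwards [ae_all_iff.2 hcoord] with ω hω using funext hω

theorem ae_mulVec_eq_zero [Finite l] (hU : MemLp U 2 μ) {A : Matrix l ι ℝ}
    (hA : A * crossMoment μ U U = 0) : ∀ᵐ ω ∂μ, A *ᵥ U ω = 0 := by
  have := Fintype.ofFinite l
  exact ae_eq_zero_of_crossMoment_eq_zero (memLp_mulVec hU A) (by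
    rw [crossMoment_mulVec_mulVec hU, hA, Matrix.zero_mul])

theorem IsFullRankFactor.ae_eq_mulVec {r : Type*} [Fintype r] [DecidableEq r]
    {B : Matrix ι r ℝ} {L : Matrix r ι ℝ} (hB : IsFullRankFactor (crossMoment μ U U) B L)
    (hU : MemLp U 2 μ) : U =ᵐ[μ] fun ω => B *ᵥ (L *ᵥ U ω) := by
  classical
  have hker : (1 - B * L) * crossMoment μ U U = 0 := by
    rw [hB.eq_mul_transpose, Matrix.sub_mul, Matrix.one_mul, Matrix.mul_assoc,
      ← Matrix.mul_assoc L, hB.left_inv, Matrix.one_mul, sub_self]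
  filter_upwards [ae_mulVec_eq_zero hU hker] with ω hω
  rwa [sub_mulVec, one_mulVec, ← mulVec_mulVec, sub_eq_zero] at hω

theorem crossMoment_sub_sub (hU : MemLp U 2 μ) (hU' : MemLp U' 2 μ) :
    crossMoment μ (fun ω => U ω - U' ω) (fun ω => U ω - U' ω) =
      crossMoment μ U U - crossMoment μ U U' - (crossMoment μ U U')ᵀ + crossMoment μ U' U' := by
  rw [crossMoment_sub_left (V := fun ω => U ω - U' ω) hU hU' (hU.sub hU'),
    crossMoment_sub_right hU hU hU', crossMoment_sub_right hU' hU hU', crossMoment_transpose]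
  abel

theorem crossMoment_eq_zero_of_indepFun (hU : MemLp U 2 μ) (hV : MemLp V 2 μ)
    (h : IndepFun U V μ) (h0 : ∀ i, ∫ ω, U ω i ∂μ = 0) : crossMoment μ U V = 0 := by
  ext i j
  have hmul := (h.comp (measurable_pi_apply i)
    (measurable_pi_apply j)).integral_fun_mul_eq_mul_integral
    (hU.eval i).aestronglyMeasurable (hV.eval j).aestronglyMeasurable
  exact hmul.trans (mul_eq_zero_of_left (h0 i) _)

/-- The normal equations: they say that `Γ U` is the best linear estimate of `V` given `U`. -/
theorem exists_mul_crossMoment_eq (hU : MemLp U 2 μ) (hV : MemLp V 2 μ) :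
    ∃ Γ : Matrix κ ι ℝ, Γ * crossMoment μ U U = crossMoment μ V U := by
  obtain ⟨r, B, L, hB⟩ := exists_isFullRankFactor (posSemidef_crossMoment hU)
  refine ⟨crossMoment μ V U * Lᵀ * L, ?_⟩
  calc crossMoment μ V U * Lᵀ * L * crossMoment μ U U
      = crossMoment μ V U * Lᵀ * (L * B) * Bᵀ := by
        rw [hB.eq_mul_transpose]; simp only [Matrix.mul_assoc]
    _ = crossMoment μ V U * Lᵀ * Bᵀ := by rw [hB.left_inv, Matrix.mul_one]
    _ = crossMoment μ V fun ω => B *ᵥ (L *ᵥ U ω) := by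
        rw [crossMoment_mulVec_right hV (memLp_mulVec hU L), crossMoment_mulVec_right hV hU]
    _ = crossMoment μ V U := crossMoment_congr (ae_eq_refl V) (hB.ae_eq_mulVec hU).symm

end Moments

section Divergence

variable {α : Type*} [MeasurableSpace α] {ρ π : Measure α} [IsProbabilityMeasure ρ]
  [IsProbabilityMeasure π] {φ : α → ℝ}

/-- The Donsker–Varadhan bound: for the tilted measure `π.tilted φ = exp φ · π` the difference
`D(ρ ‖ π) - ∫ φ dρ` is the nonnegative divergence `D(ρ ‖ π.tilted φ)`. -/
theorem ofReal_integral_le_klDiv (hφ : Integrable φ ρ) (hm : Measurable φ)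
    (hexp : ∫⁻ x, ENNReal.ofReal (Real.exp (φ x)) ∂π = 1) :
    ENNReal.ofReal (∫ x, φ x ∂ρ) ≤ InformationTheory.klDiv ρ π := by
  by_cases htop : InformationTheory.klDiv ρ π = ⊤
  · exact htop ▸ le_top
  obtain ⟨hac, hllr⟩ := InformationTheory.klDiv_ne_top_iff.1 htop
  have hexp_nonneg : 0 ≤ᵐ[π] fun x => Real.exp (φ x) := ae_of_all _ fun x => (Real.exp_pos _).le
  have hexp_int : Integrable (fun x => Real.exp (φ x)) π :=
    ⟨by fun_prop, by
      rw [hasFiniteIntegral_iff_ofReal hexp_nonneg, hexp]; exact ENNReal.one_lt_top⟩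
  have hexp_one : ∫ x, Real.exp (φ x) ∂π = 1 := by
    rw [integral_eq_lintegral_of_nonneg_ae hexp_nonneg hexp_int.aestronglyMeasurable, hexp,
      ENNReal.toReal_one]
  have := isProbabilityMeasure_tilted hexp_int
  have htilt := integral_llr_tilted_right hac hφ hexp_int hllr
  have hgibbs := InformationTheory.integral_llr_add_sub_measure_univ_nonneg
    (hac.trans (absolutelyContinuous_tilted hexp_int))
    (integrable_llr_tilted_right hac hφ hllr hexp_int)
  rw [hexp_one, Real.log_one] at htilt
  rw [InformationTheory.klDiv_of_ac_of_integrable hac hllr]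
  simp only [probReal_univ] at hgibbs ⊢
  exact ENNReal.ofReal_le_ofReal (by linarith)

theorem klDiv_of_eq_withDensity_exp (hm : Measurable φ)
    (hρ : ρ = π.withDensity fun x => ENNReal.ofReal (Real.exp (φ x))) (hφ : Integrable φ ρ) :
    InformationTheory.klDiv ρ π = ENNReal.ofReal (∫ x, φ x ∂ρ) := by
  have hac : ρ ≪ π := hρ ▸ withDensity_absolutelyContinuous _ _
  have hllr : llr ρ π =ᵐ[ρ] φ := by
    have hdens := Measure.rnDeriv_withDensity π
      (f := fun x => ENNReal.ofReal (Real.exp (φ x))) (by fun_prop)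
    rw [← hρ] at hdens
    filter_upwards [hac.ae_le hdens] with x hx
    rw [llr_def]
    dsimp only
    rw [hx, ENNReal.toReal_ofReal (Real.exp_pos _).le, Real.log_exp]
  rw [InformationTheory.klDiv_of_ac_of_integrable hac ((integrable_congr hllr).2 hφ),
    integral_congr_ae hllr]
  simp

end Divergence

section GaussianDensity

/-- The logarithm of the density of `N(u, v)` with respect to `N(0, 1)`, the test function of the
Donsker–Varadhan bound. -/
def gaussianLogDensity (v u x : ℝ) : ℝ :=
  -(1 / 2) * Real.log v - (x - u) ^ 2 / (2 * v) + x ^ 2 / 2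

@[fun_prop]
theorem measurable_gaussianLogDensity {β : Type*} [MeasurableSpace β] {v : ℝ} {f g : β → ℝ}
    (hf : Measurable f) (hg : Measurable g) :
    Measurable fun b => gaussianLogDensity v (f b) (g b) := by
  unfold gaussianLogDensity; fun_prop

theorem gaussianReal_eq_withDensity (u : ℝ) {v : ℝ} (hv : 0 < v) :
    gaussianReal u v.toNNReal = (gaussianReal 0 1).withDensity
      fun x => ENNReal.ofReal (Real.exp (gaussianLogDensity v u x)) := by
  rw [gaussianReal_of_var_ne_zero _ (by simpa using hv), gaussianReal_of_var_ne_zero _ one_ne_zero,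
    ← withDensity_mul _ (measurable_gaussianPDF _ _) (by fun_prop)]
  congr 1
  ext x
  have hsqrt : √v = Real.exp (1 / 2 * Real.log v) := by
    rw [← Real.exp_log (Real.sqrt_pos.2 hv), Real.log_sqrt hv.le]; ring_nf
  simp only [Pi.mul_apply, gaussianPDF]
  rw [← ENNReal.ofReal_mul (gaussianPDFReal_nonneg _ _ _)]
  simp only [gaussianPDFReal, Real.coe_toNNReal _ hv.le, NNReal.coe_one, mul_one, sub_zero]
  rw [Real.sqrt_mul (by positivity), mul_inv, mul_assoc, mul_assoc, ← Real.exp_add, hsqrt,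
    ← Real.exp_neg, ← Real.exp_add, gaussianLogDensity]
  congr 3
  ring

variable {ι : Type*} [Fintype ι]

theorem lintegral_pi_prod {α : ι → Type*} [∀ i, MeasurableSpace (α i)] (γ : ∀ i, Measure (α i))
    [∀ i, IsProbabilityMeasure (γ i)] {f : ∀ i, α i → ℝ≥0∞} (hf : ∀ i, Measurable (f i)) :
    ∫⁻ x, ∏ i, f i (x i) ∂(Measure.pi γ) = ∏ i, ∫⁻ x, f i x ∂(γ i) := by
  rw [lintegral_prod_eq_prod_lintegral_of_indepFun Finset.univ _
    (iIndepFun_pi (X := f) fun i => (hf i).aemeasurable)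
    fun i => (hf i).comp (measurable_pi_apply i)]
  exact Finset.prod_congr rfl fun i _ => (measurePreserving_eval γ i).lintegral_comp (hf i)

theorem pi_withDensity {α : ι → Type*} [∀ i, MeasurableSpace (α i)] {γ : ∀ i, Measure (α i)}
    [∀ i, IsProbabilityMeasure (γ i)] {f : ∀ i, α i → ℝ≥0∞} (hf : ∀ i, Measurable (f i))
    [∀ i, SigmaFinite ((γ i).withDensity (f i))] :
    Measure.pi (fun i => (γ i).withDensity (f i))
      = (Measure.pi γ).withDensity fun x => ∏ i, f i (x i) := by
  refine Measure.pi_eq fun s hs => ?_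
  have hprod : (Set.univ.pi s).indicator (fun x => ∏ i, f i (x i))
      = fun x => ∏ i, (s i).indicator (f i) (x i) := by
    ext x
    by_cases hx : ∀ i, x i ∈ s i
    · simp [hx]
    · obtain ⟨i, hi⟩ := not_forall.1 hx
      rw [Set.indicator_of_notMem (by simpa [Set.mem_pi] using ⟨i, hi⟩)]
      exact (Finset.prod_eq_zero (Finset.mem_univ i) (Set.indicator_of_notMem hi _)).symm
  rw [withDensity_apply _ (MeasurableSet.univ_pi hs),
    ← lintegral_indicator (MeasurableSet.univ_pi hs), hprod,
    lintegral_pi_prod γ fun i => (hf i).indicator (hs i)]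
  simp only [lintegral_indicator (hs _), withDensity_apply _ (hs _)]

/-- The standard Gaussian measure on `ι → ℝ`. -/
abbrev stdGaussianPi (ι : Type*) [Fintype ι] : Measure (ι → ℝ) :=
  Measure.pi fun _ => gaussianReal 0 1

/-- The logarithm of the density of `N(u, diag v)` with respect to `N(0, 1)`. -/
def gaussianLogDensityPi (v u x : ι → ℝ) : ℝ :=
  ∑ i, gaussianLogDensity (v i) (u i) (x i)

@[fun_prop]
theorem measurable_gaussianLogDensityPi {β : Type*} [MeasurableSpace β] {v : ι → ℝ}
    {f g : β → ι → ℝ} (hf : Measurable f) (hg : Measurable g) :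
    Measurable fun b => gaussianLogDensityPi v (f b) (g b) := by
  unfold gaussianLogDensityPi; fun_prop

theorem pi_gaussianReal_eq_withDensity (u : ι → ℝ) {v : ι → ℝ} (hv : ∀ i, 0 < v i) :
    Measure.pi (fun i => gaussianReal (u i) (v i).toNNReal) = (stdGaussianPi ι).withDensity
      fun x => ENNReal.ofReal (Real.exp (gaussianLogDensityPi v u x)) := by
  have : ∀ i, IsProbabilityMeasure ((gaussianReal 0 1).withDensity
      fun x => ENNReal.ofReal (Real.exp (gaussianLogDensity (v i) (u i) x))) := fun i => by
    rw [← gaussianReal_eq_withDensity (u i) (hv i)]; infer_instance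
  simp only [gaussianReal_eq_withDensity _ (hv _), gaussianLogDensityPi, Real.exp_sum,
    ENNReal.ofReal_prod_of_nonneg fun _ _ => (Real.exp_pos _).le]
  exact pi_withDensity fun i => by fun_prop

theorem lintegral_exp_gaussianLogDensityPi (u : ι → ℝ) {v : ι → ℝ} (hv : ∀ i, 0 < v i) :
    ∫⁻ x, ENNReal.ofReal (Real.exp (gaussianLogDensityPi v u x)) ∂(stdGaussianPi ι) = 1 := by
  rw [← setLIntegral_univ, ← withDensity_apply _ MeasurableSet.univ,
    ← pi_gaussianReal_eq_withDensity u hv, measure_univ]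

variable {Ω : Type*} [MeasurableSpace Ω] {μ : Measure Ω} {N U : Ω → ι → ℝ}

theorem integrable_gaussianLogDensity [IsFiniteMeasure μ] (hN : MemLp N 2 μ) (hU : MemLp U 2 μ)
    (v : ℝ) (i : ι) : Integrable (fun ω => gaussianLogDensity v (U ω i) (N ω i)) μ :=
  ((integrable_const _).sub (((hN.eval i).sub (hU.eval i)).integrable_sq.div_const _)).add
    ((hN.eval i).integrable_sq.div_const _)

theorem integrable_gaussianLogDensityPi [IsFiniteMeasure μ] (hN : MemLp N 2 μ) (hU : MemLp U 2 μ)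
    (v : ι → ℝ) : Integrable (fun ω => gaussianLogDensityPi v (U ω) (N ω)) μ :=
  integrable_finsetSum _ fun i _ => integrable_gaussianLogDensity hN hU (v i) i

theorem integral_gaussianLogDensityPi [IsProbabilityMeasure μ] (hN : MemLp N 2 μ)
    (hU : MemLp U 2 μ) (v : ι → ℝ) :
    ∫ ω, gaussianLogDensityPi v (U ω) (N ω) ∂μ
      = ∑ i, (-(1 / 2) * Real.log (v i)
          - crossMoment μ (fun ω => N ω - U ω) (fun ω => N ω - U ω) i i / (2 * v i)
          + crossMoment μ N N i i / 2) := by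
  unfold gaussianLogDensityPi
  rw [integral_finsetSum _ fun i _ => integrable_gaussianLogDensity hN hU (v i) i]
  refine Finset.sum_congr rfl fun i _ => ?_
  have herr : Integrable (fun ω => (N ω i - U ω i) ^ 2 / (2 * v i)) μ :=
    ((hN.eval i).sub (hU.eval i)).integrable_sq.div_const _
  have hdiff : Integrable
      (fun ω => -(1 / 2) * Real.log (v i) - (N ω i - U ω i) ^ 2 / (2 * v i)) μ :=
    (integrable_const _).sub herr
  simp only [gaussianLogDensity, crossMoment_apply, Pi.sub_apply, ← sq]
  rw [integral_add hdiff ((hN.eval i).integrable_sq.div_const _),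
    integral_sub (integrable_const _) herr, integral_div, integral_div]
  simp

end GaussianDensity

section CenteredGaussian

variable {Ω : Type*} [MeasurableSpace Ω] {μ : Measure Ω} {ι κ : Type*}

/-- The random vector `N` is jointly Gaussian with mean zero; its covariance `crossMoment μ N N`
may be singular. -/
structure IsCenteredGaussian (μ : Measure Ω) (N : Ω → ι → ℝ) : Prop where
  hasGaussianLaw : HasGaussianLaw N μ
  integral_eq_zero : ∀ i, ∫ ω, N ω i ∂μ = 0

namespace IsCenteredGaussian

variable {N : Ω → ι → ℝ}

theorem memLp [Fintype ι] (hN : IsCenteredGaussian μ N) : MemLp N 2 μ :=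
  MemLp.of_eval fun i => (hN.hasGaussianLaw.eval (X := fun i ω => N ω i) i).memLp_two

theorem mulVec [Fintype ι] [Finite κ] (hN : IsCenteredGaussian μ N) (A : Matrix κ ι ℝ) :
    IsCenteredGaussian μ fun ω => A *ᵥ N ω where
  hasGaussianLaw := by
    have := Fintype.ofFinite κ
    exact hN.hasGaussianLaw.map_fun (LinearMap.toContinuousLinearMap A.mulVecLin)
  integral_eq_zero k := by
    have := hN.hasGaussianLaw.isProbabilityMeasure
    simp only [Matrix.mulVec, dotProduct]
    rw [integral_finsetSum _ fun i _ => ((hN.memLp.eval i).integrable one_le_two).const_mul _]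
    simp [integral_const_mul, hN.integral_eq_zero]

theorem covariance_eval_eq [Finite ι] (hN : IsCenteredGaussian μ N) (i j : ι) :
    cov[fun ω => N ω i, fun ω => N ω j; μ] = crossMoment μ N N i j := by
  have := Fintype.ofFinite ι
  have := hN.hasGaussianLaw.isProbabilityMeasure
  rw [covariance_eq_sub (hN.memLp.eval i) (hN.memLp.eval j), hN.integral_eq_zero, zero_mul,
    sub_zero, crossMoment_apply]
  rfl

theorem map_eq_pi [Fintype ι] [DecidableEq ι] (hN : IsCenteredGaussian μ N) {σ : ι → ℝ}
    (hσ : crossMoment μ N N = diagonal σ) :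
    μ.map N = Measure.pi fun i => gaussianReal 0 (σ i).toNNReal := by
  have := hN.hasGaussianLaw.isProbabilityMeasure
  have hae : ∀ i, AEMeasurable (fun ω => N ω i) μ := fun i =>
    (hN.memLp.eval i).aestronglyMeasurable.aemeasurable
  have hind : iIndepFun (fun i ω => N ω i) μ :=
    hN.hasGaussianLaw.iIndepFun_of_covariance_eq_zero fun i j hij => by
      rw [hN.covariance_eval_eq, hσ, diagonal_apply_ne _ hij]
  refine ((iIndepFun_iff_map_fun_eq_pi_map hae).1 hind).trans ?_
  congr 1
  ext1 i
  rw [(hN.hasGaussianLaw.eval (X := fun i ω => N ω i) i).map_eq_gaussianReal,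
    hN.integral_eq_zero, ← covariance_self (hae i), hN.covariance_eval_eq, hσ, diagonal_apply_eq]

theorem map_eq_stdGaussianPi [Fintype ι] [DecidableEq ι] (hN : IsCenteredGaussian μ N)
    (h1 : crossMoment μ N N = 1) : μ.map N = stdGaussianPi ι := by
  simpa using hN.map_eq_pi (σ := fun _ => 1) (h1.trans diagonal_one.symm)

end IsCenteredGaussian

end CenteredGaussian

section MutualInformation

variable {Ω τ : Type*} [MeasurableSpace Ω] [MeasurableSpace τ] {μ : Measure Ω}

/-- The mutual information `I(T; N)`, as the divergence of the joint law from the product of the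
marginals. -/
def mutualInfo {β : Type*} [MeasurableSpace β] (μ : Measure Ω) (T : Ω → τ) (N : Ω → β) : ℝ≥0∞ :=
  InformationTheory.klDiv (μ.map fun ω => (T ω, N ω)) ((μ.map T).prod (μ.map N))

theorem mutualInfo_comp_le [IsProbabilityMeasure μ] {β β' : Type*} [MeasurableSpace β]
    [MeasurableSpace β'] {T : Ω → τ} {N : Ω → β} (hT : Measurable T) (hN : Measurable N)
    {g : β → β'} (hg : Measurable g) :
    mutualInfo μ T (fun ω => g (N ω)) ≤ mutualInfo μ T N := by
  have hproc := InformationTheory.klDiv_map_le (μ.map fun ω => (T ω, N ω))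
    ((μ.map T).prod (μ.map N)) (g := Prod.map id g) (by fun_prop)
  have : IsProbabilityMeasure (μ.map T) := Measure.isProbabilityMeasure_map hT.aemeasurable
  have : IsProbabilityMeasure (μ.map N) := Measure.isProbabilityMeasure_map hN.aemeasurable
  rwa [Measure.map_map (by fun_prop) (by fun_prop), ← Measure.map_prod_map _ _ measurable_id hg,
    Measure.map_id, Measure.map_map hg hN] at hproc

theorem mutualInfo_comp_eq [IsProbabilityMeasure μ] {β β' : Type*} [MeasurableSpace β]
    [MeasurableSpace β'] {T : Ω → τ} {N : Ω → β} (hT : Measurable T) (hN : Measurable N)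
    {g : β → β'} {g' : β' → β} (hg : Measurable g) (hg' : Measurable g')
    (hinv : Function.LeftInverse g' g) :
    mutualInfo μ T (fun ω => g (N ω)) = mutualInfo μ T N := by
  refine (mutualInfo_comp_le hT hN hg).antisymm ?_
  have hback := mutualInfo_comp_le (μ := μ) hT (hg.comp hN) hg'
  simp only [Function.comp_apply, hinv _] at hback
  exact hback

theorem mutualInfo_congr {β : Type*} [MeasurableSpace β] {T : Ω → τ} {N N' : Ω → β}
    (h : N =ᵐ[μ] N') : mutualInfo μ T N = mutualInfo μ T N' := by
  have hpair : (fun ω => (T ω, N ω)) =ᵐ[μ] fun ω => (T ω, N' ω) := by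
    filter_upwards [h] with ω hω
    rw [hω]
  rw [mutualInfo, mutualInfo, Measure.map_congr h, Measure.map_congr hpair]

theorem halfLogInv_le_of_tendsto {β : Type*} {l : Filter β} [l.NeBot] {f : β → ℝ} {x : ℝ}
    {a : ℝ≥0∞} (hf : Filter.Tendsto f l (nhds x)) (hpos : ∀ᶠ b in l, 0 < f b)
    (hle : ∀ᶠ b in l, halfLogInv (f b) ≤ a) : halfLogInv x ≤ a := by
  by_cases htop : a = ⊤
  · exact htop ▸ le_top
  have hexp : Real.exp (-2 * a.toReal) ≤ x := by
    refine ge_of_tendsto hf ?_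
    filter_upwards [hpos, hle] with b hb hba
    rw [halfLogInv, if_neg hb.ne', ← ENNReal.ofReal_toReal htop,
      ENNReal.ofReal_le_ofReal_iff ENNReal.toReal_nonneg] at hba
    rw [← Real.le_log_iff_exp_le hb]
    linarith
  have hx : 0 < x := (Real.exp_pos _).trans_le hexp
  rw [halfLogInv, if_neg hx.ne', ← ENNReal.ofReal_toReal htop]
  exact ENNReal.ofReal_le_ofReal (by linarith [(Real.le_log_iff_exp_le hx).2 hexp])

theorem map_prod_shear_eq_withDensity {G : Type*} [AddGroup G] [MeasurableSpace G]
    [MeasurableAdd₂ G] {π : Measure τ} {γ ν : Measure G} [SFinite π] [SFinite γ] [SFinite ν]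
    {u : τ → G} (hu : Measurable u) {f : τ × G → ℝ≥0∞} (hf : Measurable f)
    (hν : ∀ t, ν.map (fun x => x + u t) = γ.withDensity fun x => f (t, x)) :
    (π.prod ν).map (fun p => (p.1, p.2 + u p.1)) = (π.prod γ).withDensity f := by
  refine Measure.ext_of_lintegral _ fun g hg => ?_
  rw [lintegral_map hg (by fun_prop), lintegral_prod _ (by fun_prop),
    lintegral_withDensity_eq_lintegral_mul _ hf hg, lintegral_prod _ (by fun_prop)]
  refine lintegral_congr fun t => ?_
  calc ∫⁻ x, g (t, x + u t) ∂ν = ∫⁻ x, g (t, x) ∂(ν.map fun x => x + u t) :=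
        (lintegral_map (f := fun x => g (t, x)) (by fun_prop) (by fun_prop)).symm
    _ = ∫⁻ x, f (t, x) * g (t, x) ∂γ := by
        rw [hν, lintegral_withDensity_eq_lintegral_mul _ (by fun_prop) (by fun_prop)]
        rfl

theorem pi_gaussianReal_map_add {ι : Type*} [Fintype ι] (v u : ι → ℝ) :
    (Measure.pi fun i => gaussianReal 0 (v i).toNNReal).map (fun x => x + u)
      = Measure.pi fun i => gaussianReal (u i) (v i).toNNReal := by
  have hmap := Measure.pi_map_pi (μ := fun i => gaussianReal 0 (v i).toNNReal)
    (f := fun i x => x + u i) fun i => by fun_prop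
  simp only [gaussianReal_map_add_const, zero_add] at hmap
  exact hmap

end MutualInformation

section GaussianInformation

variable {Ω τ : Type*} [MeasurableSpace Ω] [MeasurableSpace τ] {μ : Measure Ω}
  {ι : Type*} [Fintype ι] [DecidableEq ι] {T : Ω → τ} {N : Ω → ι → ℝ} {u : τ → ι → ℝ}

theorem ofReal_integral_gaussianLogDensityPi_le_mutualInfo (hT : Measurable T) (hNm : Measurable N)
    (hN : IsCenteredGaussian μ N) (hN1 : crossMoment μ N N = 1) (hu : Measurable u)
    (hU : MemLp (fun ω => u (T ω)) 2 μ) {v : ι → ℝ} (hv : ∀ i, 0 < v i) :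
    ENNReal.ofReal (∫ ω, gaussianLogDensityPi v (u (T ω)) (N ω) ∂μ) ≤ mutualInfo μ T N := by
  have := hN.hasGaussianLaw.isProbabilityMeasure
  have hTN : AEMeasurable (fun ω => (T ω, N ω)) μ := (hT.prodMk hNm).aemeasurable
  have : IsProbabilityMeasure (μ.map T) := Measure.isProbabilityMeasure_map hT.aemeasurable
  have : IsProbabilityMeasure (μ.map N) := Measure.isProbabilityMeasure_map hNm.aemeasurable
  have : IsProbabilityMeasure (μ.map fun ω => (T ω, N ω)) := Measure.isProbabilityMeasure_map hTN
  have hφ : Measurable fun p : τ × (ι → ℝ) => gaussianLogDensityPi v (u p.1) p.2 := by fun_prop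
  rw [← integral_map hTN hφ.aestronglyMeasurable]
  refine ofReal_integral_le_klDiv ((integrable_map_measure hφ.aestronglyMeasurable hTN).2
    (integrable_gaussianLogDensityPi hN.memLp hU v)) hφ ?_
  rw [hN.map_eq_stdGaussianPi hN1, lintegral_prod _ (by fun_prop)]
  simp only [lintegral_exp_gaussianLogDensityPi _ hv, lintegral_const, measure_univ, mul_one]

theorem halfLogInv_prod_le_mutualInfo (hT : Measurable T) (hNm : Measurable N)
    (hN : IsCenteredGaussian μ N) (hN1 : crossMoment μ N N = 1) (hu : Measurable u)
    (hU : MemLp (fun ω => u (T ω)) 2 μ) :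
    halfLogInv (∏ i, crossMoment μ (fun ω => N ω - u (T ω)) (fun ω => N ω - u (T ω)) i i)
      ≤ mutualInfo μ T N := by
  have := hN.hasGaussianLaw.isProbabilityMeasure
  set σ : ι → ℝ := fun i => crossMoment μ (fun ω => N ω - u (T ω)) (fun ω => N ω - u (T ω)) i i
  have hσ : ∀ i, 0 ≤ σ i := fun i => integral_nonneg fun _ => mul_self_nonneg _
  have hpos : ∀ ε : ℝ, 0 < ε → ∀ i, 0 < σ i + ε := fun ε hε i => by linarith [hσ i]
  have hlim : Filter.Tendsto (fun ε : ℝ => ∏ i, (σ i + ε)) (nhdsWithin 0 (Set.Ioi 0))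
      (nhds (∏ i, σ i)) := by
    have hcont : Continuous fun ε : ℝ => ∏ i, (σ i + ε) := by fun_prop
    simpa using (hcont.tendsto 0).mono_left (nhdsWithin_le_nhds (s := Set.Ioi 0))
  refine halfLogInv_le_of_tendsto hlim ?_ ?_ <;> filter_upwards [self_mem_nhdsWithin] with ε hε
  · exact Finset.prod_pos fun i _ => hpos ε hε i
  rw [halfLogInv, if_neg (Finset.prod_pos fun i _ => hpos ε hε i).ne']
  refine le_trans (ENNReal.ofReal_le_ofReal ?_)
    (ofReal_integral_gaussianLogDensityPi_le_mutualInfo hT hNm hN hN1 hu hU (hpos ε hε))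
  rw [integral_gaussianLogDensityPi hN.memLp hU, Real.log_prod fun i _ => (hpos ε hε i).ne',
    Finset.mul_sum]
  refine Finset.sum_le_sum fun i _ => ?_
  have hratio : σ i / (2 * (σ i + ε)) ≤ 1 / 2 := by
    rw [div_le_div_iff₀ (by linarith [hpos ε hε i]) two_pos]
    linarith [Set.mem_Ioi.1 hε]
  rw [hN1, one_apply_eq]
  linarith

theorem map_prodMk_eq_withDensity (hT : Measurable T) (hNm : Measurable N) (hu : Measurable u)
    (hN : IsCenteredGaussian μ N) (hN1 : crossMoment μ N N = 1)
    (hR : IsCenteredGaussian μ fun ω => N ω - u (T ω)) {σ : ι → ℝ} (hσ0 : ∀ i, 0 < σ i)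
    (hσ : crossMoment μ (fun ω => N ω - u (T ω)) (fun ω => N ω - u (T ω)) = diagonal σ)
    (hind : IndepFun T (fun ω => N ω - u (T ω)) μ) :
    μ.map (fun ω => (T ω, N ω)) = ((μ.map T).prod (μ.map N)).withDensity
      fun p => ENNReal.ofReal (Real.exp (gaussianLogDensityPi σ (u p.1) p.2)) := by
  have := hN.hasGaussianLaw.isProbabilityMeasure
  have hRm : Measurable fun ω => N ω - u (T ω) := by fun_prop
  have hshear : μ.map (fun ω => (T ω, N ω))
      = (μ.map fun ω => (T ω, N ω - u (T ω))).map fun p => (p.1, p.2 + u p.1) := by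
    rw [Measure.map_map (by fun_prop) (hT.prodMk hRm)]
    simp only [Function.comp_def, sub_add_cancel]
  rw [hshear, (indepFun_iff_map_prod_eq_prod_map_map hT.aemeasurable hRm.aemeasurable).1 hind,
    hR.map_eq_pi hσ, hN.map_eq_stdGaussianPi hN1]
  refine map_prod_shear_eq_withDensity hu (by fun_prop) fun t => ?_
  rw [pi_gaussianReal_map_add, pi_gaussianReal_eq_withDensity _ hσ0]

theorem mutualInfo_eq_of_crossMoment_eq_diagonal (hT : Measurable T) (hNm : Measurable N)
    (hu : Measurable u) (hN : IsCenteredGaussian μ N) (hN1 : crossMoment μ N N = 1)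
    (hR : IsCenteredGaussian μ fun ω => N ω - u (T ω)) {σ : ι → ℝ} (hσ0 : ∀ i, 0 < σ i)
    (hσ : crossMoment μ (fun ω => N ω - u (T ω)) (fun ω => N ω - u (T ω)) = diagonal σ)
    (hind : IndepFun T (fun ω => N ω - u (T ω)) μ) :
    mutualInfo μ T N = halfLogInv (∏ i, σ i) := by
  have := hN.hasGaussianLaw.isProbabilityMeasure
  have hU : MemLp (fun ω => u (T ω)) 2 μ := by
    simpa only [Pi.sub_def, sub_sub_cancel] using hN.memLp.sub hR.memLp
  have hTN : AEMeasurable (fun ω => (T ω, N ω)) μ := (hT.prodMk hNm).aemeasurable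
  have : IsProbabilityMeasure (μ.map T) := Measure.isProbabilityMeasure_map hT.aemeasurable
  have : IsProbabilityMeasure (μ.map N) := Measure.isProbabilityMeasure_map hNm.aemeasurable
  have : IsProbabilityMeasure (μ.map fun ω => (T ω, N ω)) := Measure.isProbabilityMeasure_map hTN
  have hφ : Measurable fun p : τ × (ι → ℝ) => gaussianLogDensityPi σ (u p.1) p.2 := by fun_prop
  rw [mutualInfo, klDiv_of_eq_withDensity_exp hφ
      (map_prodMk_eq_withDensity hT hNm hu hN hN1 hR hσ0 hσ hind)
      ((integrable_map_measure hφ.aestronglyMeasurable hTN).2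
        (integrable_gaussianLogDensityPi hN.memLp hU σ)),
    integral_map hTN hφ.aestronglyMeasurable, integral_gaussianLogDensityPi hN.memLp hU, hσ, hN1,
    halfLogInv, if_neg (Finset.prod_pos fun i _ => hσ0 i).ne', Real.log_prod fun i _ => (hσ0 i).ne',
    Finset.mul_sum]
  congr 1
  refine Finset.sum_congr rfl fun i _ => ?_
  rw [diagonal_apply_eq, one_apply_eq]
  field_simp [(hσ0 i).ne']
  ring

theorem exists_rotation_crossMoment_sub {U : Ω → ι → ℝ} (hN : MemLp N 2 μ) (hU : MemLp U 2 μ) :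
    ∃ (O : Matrix ι ι ℝ) (σ : ι → ℝ), O * Oᵀ = 1 ∧ Oᵀ * O = 1 ∧ (∀ i, 0 ≤ σ i) ∧
      (crossMoment μ (fun ω => N ω - U ω) (fun ω => N ω - U ω)).det = ∏ i, σ i ∧
      crossMoment μ (fun ω => O *ᵥ N ω - O *ᵥ U ω) (fun ω => O *ᵥ N ω - O *ᵥ U ω)
        = diagonal σ := by
  have hE : MemLp (fun ω => N ω - U ω) 2 μ := hN.sub hU
  obtain ⟨O, σ, hO, hO', hσ, hM⟩ :=
    exists_eq_mul_diagonal_mul_transpose (posSemidef_crossMoment hE)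
  refine ⟨Oᵀ, σ, by simpa using hO, by simpa using hO', hσ, ?_, ?_⟩
  · rw [hM, det_mul_right_comm, hO', Matrix.one_mul, det_diagonal]
  · simp only [← mulVec_sub]
    rw [crossMoment_mulVec_mulVec hE, hM, transpose_transpose]
    calc Oᵀ * (O * diagonal σ * Oᵀ) * O = (Oᵀ * O) * diagonal σ * (Oᵀ * O) := by
          simp only [Matrix.mul_assoc]
      _ = diagonal σ := by rw [hO, Matrix.one_mul, Matrix.mul_one]

theorem halfLogInv_det_le_mutualInfo (hT : Measurable T) (hNm : Measurable N)
    (hN : IsCenteredGaussian μ N) (hN1 : crossMoment μ N N = 1) (hu : Measurable u)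
    (hU : MemLp (fun ω => u (T ω)) 2 μ) :
    halfLogInv (crossMoment μ (fun ω => N ω - u (T ω)) (fun ω => N ω - u (T ω))).det
      ≤ mutualInfo μ T N := by
  have := hN.hasGaussianLaw.isProbabilityMeasure
  obtain ⟨O, σ, hO, -, -, hdet, hσ⟩ := exists_rotation_crossMoment_sub hN.memLp hU
  have hO1 : crossMoment μ (fun ω => O *ᵥ N ω) (fun ω => O *ᵥ N ω) = 1 := by
    rw [crossMoment_mulVec_mulVec hN.memLp, hN1, Matrix.mul_one, hO]
  have hrot := halfLogInv_prod_le_mutualInfo hT (u := fun t => O *ᵥ u t) (by fun_prop)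
    (hN.mulVec O) hO1 (by fun_prop) (memLp_mulVec hU O)
  simp only [hσ, diagonal_apply_eq] at hrot
  rw [hdet]
  exact hrot.trans (mutualInfo_comp_le hT hNm (by fun_prop))

theorem mutualInfo_eq_halfLogInv_det (hT : Measurable T) (hNm : Measurable N) (hu : Measurable u)
    (hN : IsCenteredGaussian μ N) (hN1 : crossMoment μ N N = 1)
    (hR : IsCenteredGaussian μ fun ω => N ω - u (T ω))
    (hind : IndepFun T (fun ω => N ω - u (T ω)) μ) :
    mutualInfo μ T N
      = halfLogInv (crossMoment μ (fun ω => N ω - u (T ω)) (fun ω => N ω - u (T ω))).det := by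
  have := hN.hasGaussianLaw.isProbabilityMeasure
  have hU : MemLp (fun ω => u (T ω)) 2 μ := by
    simpa only [Pi.sub_def, sub_sub_cancel] using hN.memLp.sub hR.memLp
  obtain ⟨O, σ, hO, hO', hσ0, hdet, hσ⟩ := exists_rotation_crossMoment_sub hN.memLp hU
  by_cases h0 : ∏ i, σ i = 0
  · have htop : halfLogInv 0 ≤ mutualInfo μ T N := by
      simpa only [hdet, h0] using halfLogInv_det_le_mutualInfo hT hNm hN hN1 hu hU
    rw [halfLogInv, if_pos rfl, top_le_iff] at htop
    rw [hdet, h0, halfLogInv, if_pos rfl, htop]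
  have hσpos : ∀ i, 0 < σ i := fun i =>
    (hσ0 i).lt_of_ne' fun hi => h0 (Finset.prod_eq_zero (Finset.mem_univ i) hi)
  have hO1 : crossMoment μ (fun ω => O *ᵥ N ω) (fun ω => O *ᵥ N ω) = 1 := by
    rw [crossMoment_mulVec_mulVec hN.memLp, hN1, Matrix.mul_one, hO]
  have hrot := mutualInfo_eq_of_crossMoment_eq_diagonal hT (u := fun t => O *ᵥ u t) (by fun_prop)
    (by fun_prop) (hN.mulVec O) hO1 (by simpa only [mulVec_sub] using hR.mulVec O) hσpos hσ
    (by simpa only [Function.comp_def, id, mulVec_sub] using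
      hind.comp measurable_id (by fun_prop : Measurable fun x : ι → ℝ => O *ᵥ x))
  rw [hdet, ← hrot]
  exact (mutualInfo_comp_eq hT hNm (g := fun x => O *ᵥ x) (g' := fun x => Oᵀ *ᵥ x) (by fun_prop)
    (by fun_prop) fun x => by simp [mulVec_mulVec, hO']).symm

end GaussianInformation

section CondMutualInfo

variable {Ω υ ζ : Type*} [MeasurableSpace Ω] [MeasurableSpace υ] [MeasurableSpace ζ]

theorem klDiv_map_of_leftInverse {α β : Type*} [MeasurableSpace α] [MeasurableSpace β]
    (μ ν : Measure α) [IsFiniteMeasure μ] [IsFiniteMeasure ν] {g : α → β} {g' : β → α}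
    (hg : Measurable g) (hg' : Measurable g') (hinv : Function.LeftInverse g' g) :
    InformationTheory.klDiv (μ.map g) (ν.map g) = InformationTheory.klDiv μ ν := by
  refine (InformationTheory.klDiv_map_le μ ν hg).antisymm ?_
  have hback := InformationTheory.klDiv_map_le (μ.map g) (ν.map g) hg'
  rwa [Measure.map_map hg' hg, Measure.map_map hg' hg, hinv.comp_eq_id, Measure.map_id,
    Measure.map_id] at hback

/-- The channel that maps the input `y` to the law of `f (y, R)`, where the noise `R` has
law `ν`. -/
def noiseKernel {α β : Type*} [MeasurableSpace α] [MeasurableSpace β] (ν : Measure α) [SFinite ν]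
    (f : υ × α → β) : Kernel υ β :=
  (Kernel.id ×ₖ Kernel.const υ ν).map f

section NoiseKernel

variable {α β : Type*} [MeasurableSpace α] [MeasurableSpace β] {f : υ × α → β}

theorem noiseKernel_apply (ν : Measure α) [SFinite ν] (hf : Measurable f) (y : υ) :
    noiseKernel ν f y = ν.map fun r => f (y, r) := by
  rw [noiseKernel, Kernel.map_apply _ hf, Kernel.prod_apply, Kernel.id_apply, Kernel.const_apply,
    Measure.dirac_prod, Measure.map_map hf (by fun_prop)]
  rfl

instance (ν : Measure α) [SFinite ν] : IsSFiniteKernel (noiseKernel (υ := υ) ν f) :=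
  inferInstanceAs (IsSFiniteKernel ((Kernel.id ×ₖ Kernel.const υ ν).map f))

theorem compProd_noiseKernel (m : Measure υ) [SFinite m] (ν : Measure α) [SFinite ν]
    (hf : Measurable f) :
    m ⊗ₘ noiseKernel ν f = (m.prod ν).map fun p => (p.1, f p) := by
  refine Measure.ext_of_lintegral _ fun φ hφ => ?_
  rw [Measure.lintegral_compProd hφ, lintegral_map hφ (by fun_prop), lintegral_prod _ (by fun_prop)]
  refine lintegral_congr fun y => ?_
  rw [noiseKernel_apply ν hf, lintegral_map (by fun_prop) (by fun_prop)]

theorem condDistrib_ae_eq_noiseKernel {μ : Measure Ω} [IsProbabilityMeasure μ]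
    [StandardBorelSpace β] [Nonempty β] {R : Ω → α} {Y : Ω → υ} (hR : Measurable R)
    (hY : Measurable Y) (h : IndepFun Y R μ) (hf : Measurable f) :
    condDistrib (fun ω => f (Y ω, R ω)) Y μ =ᵐ[μ.map Y] noiseKernel (μ.map R) f := by
  have := Measure.isProbabilityMeasure_map (μ := μ) hR.aemeasurable
  have : IsMarkovKernel (noiseKernel (υ := υ) (μ.map R) f) := Kernel.IsMarkovKernel.map _ hf
  refine condDistrib_ae_eq_of_measure_eq_compProd Y (by fun_prop) ?_
  rw [compProd_noiseKernel _ _ hf,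
    ← (indepFun_iff_map_prod_eq_prod_map_map hY.aemeasurable hR.aemeasurable).1 h,
    Measure.map_map (by fun_prop) (by fun_prop)]
  rfl

end NoiseKernel

variable {μ : Measure Ω} [IsProbabilityMeasure μ]

theorem map_compProd_condDistrib_prodMkRight {n : ℕ} {R : Ω → Vec n} {Z : Ω → ζ} {Y : Ω → υ}
    {a : υ → Vec n} (hR : Measurable R) (hZ : Measurable Z) (hY : Measurable Y)
    (ha : Measurable a) (h : IndepFun Y R μ) :
    (μ.map fun ω => (Y ω, Z ω)) ⊗ₘ (condDistrib (fun ω => a (Y ω) + R ω) Y μ).prodMkRight ζ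
      = ((μ.map fun ω => (Y ω, Z ω)).prod (μ.map R)).map fun p => (p.1, a p.1.1 + p.2) := by
  have := Measure.isProbabilityMeasure_map (μ := μ) hR.aemeasurable
  have hf : Measurable fun p : υ × Vec n => a p.1 + p.2 := by fun_prop
  have hcond := condDistrib_ae_eq_noiseKernel hR hY h hf
  have hfst : (μ.map fun ω => (Y ω, Z ω)).map Prod.fst = μ.map Y := by
    rw [Measure.map_map measurable_fst (hY.prodMk hZ)]; rfl
  rw [← hfst] at hcond
  have hkernel : (condDistrib (fun ω => a (Y ω) + R ω) Y μ).prodMkRight ζ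
      =ᵐ[μ.map fun ω => (Y ω, Z ω)] noiseKernel (μ.map R) fun p => a p.1.1 + p.2 := by
    filter_upwards [ae_of_ae_map measurable_fst.aemeasurable hcond] with p hp
    rw [Kernel.prodMkRight_apply, hp, noiseKernel_apply _ hf, noiseKernel_apply _ (by fun_prop)]
  rw [Measure.compProd_congr hkernel, compProd_noiseKernel _ _ (by fun_prop)]

theorem condMutualInfo_eq_mutualInfo {n : ℕ} {R : Ω → Vec n} {Z : Ω → ζ} {Y : Ω → υ}
    {a : υ → Vec n} (hR : Measurable R) (hZ : Measurable Z) (hY : Measurable Y)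
    (ha : Measurable a) (h : IndepFun Y R μ) :
    condMutualInfo μ (fun ω => a (Y ω) + R ω) Z Y = mutualInfo μ (fun ω => (Y ω, Z ω)) R := by
  have := Measure.isProbabilityMeasure_map (μ := μ) hR.aemeasurable
  have hshear : Measurable fun p : (υ × ζ) × Vec n => (p.1, a p.1.1 + p.2) := by fun_prop
  have hjoint : (μ.map fun ω => ((Y ω, Z ω), a (Y ω) + R ω))
      = (μ.map fun ω => ((Y ω, Z ω), R ω)).map fun p => (p.1, a p.1.1 + p.2) := by
    rw [Measure.map_map hshear (by fun_prop)]; rfl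
  rw [condMutualInfo, map_compProd_condDistrib_prodMkRight hR hZ hY ha h, hjoint, mutualInfo]
  exact klDiv_map_of_leftInverse _ _ hshear (g' := fun p => (p.1, p.2 - a p.1.1)) (by fun_prop)
    fun p => by simp only [add_sub_cancel_left]

end CondMutualInfo

section SubSigmaAlgebra

theorem measureReal_inter_eq_setIntegral_condProb {Ω : Type*} {m m₀ : MeasurableSpace Ω}
    {μ : Measure Ω} [IsFiniteMeasure μ] (hm : m ≤ m₀) {E A : Set Ω} (hE : MeasurableSet[m] E)
    (hA : MeasurableSet A) : μ.real (E ∩ A) = ∫ ω in E, (μ⟦A | m⟧) ω ∂μ := by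
  rw [setIntegral_condExp hm ((integrable_const 1).indicator hA) hE, setIntegral_indicator hA]
  simp

theorem setIntegral_inter_eq_mul_of_indep {Ω : Type*} {m₁ m₂ m₀ : MeasurableSpace Ω} {μ : Measure Ω}
    (h₁ : m₁ ≤ m₀) (h₂ : m₂ ≤ m₀) (h : Indep m₁ m₂ μ) {E₁ E₂ : Set Ω}
    (hE₁ : MeasurableSet[m₁] E₁) (hE₂ : MeasurableSet[m₂] E₂) {q : Ω → ℝ}
    (hq : Measurable[m₂] q) :
    ∫ ω in E₁ ∩ E₂, q ω ∂μ = μ.real E₁ * ∫ ω in E₂, q ω ∂μ := by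
  have hqE : Measurable[m₂] (E₂.indicator q) := hq.indicator hE₂
  have hmul := Indep.setIntegral_eq_mul (f := id) h₁
    (indep_of_indep_of_le_right h hqE.comap_le) (hqE.mono h₂ le_rfl).aemeasurable hE₁
    aestronglyMeasurable_id
  simpa only [id_eq, setIntegral_indicator (h₂ _ hE₂), integral_indicator (h₂ _ hE₂)] using hmul

end SubSigmaAlgebra

section Conditioning

variable {Ω τ τ' : Type*} [MeasurableSpace Ω] [MeasurableSpace τ] [MeasurableSpace τ']
  {μ : Measure Ω}

theorem condCov_eq_crossMoment {m n : ℕ} {U R : Ω → Vec m} {U' R' : Ω → Vec n} {T : Ω → τ}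
    (h : μ[U | sig T] =ᵐ[μ] fun ω => U ω - R ω) (h' : μ[U' | sig T] =ᵐ[μ] fun ω => U' ω - R' ω) :
    condCov μ U U' T = crossMoment μ (fun ω => (R ω).ofLp) fun ω => (R' ω).ofLp := by
  ext i j
  refine integral_congr_ae ?_
  filter_upwards [h, h'] with ω hω hω'
  rw [hω, hω', sub_sub_cancel, sub_sub_cancel]

variable [IsProbabilityMeasure μ]

theorem condProb_ae_eq_of_indepFun {α ζ : Type*} [MeasurableSpace α] [MeasurableSpace ζ]
    [StandardBorelSpace ζ] [Nonempty ζ] {R : Ω → α} {T : Ω → τ} {F : τ × α → ζ}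
    (hR : Measurable R) (hT : Measurable T) (hF : Measurable F) (h : IndepFun T R μ) {B : Set ζ}
    (hB : MeasurableSet B) :
    μ⟦(fun ω => F (T ω, R ω)) ⁻¹' B | sig T⟧ =ᵐ[μ]
      fun ω => ((μ.map R).map fun r => F (T ω, r)).real B := by
  refine (condDistrib_ae_eq_condExp hT (by fun_prop) hB).symm.trans ?_
  filter_upwards [ae_of_ae_map hT.aemeasurable (condDistrib_ae_eq_noiseKernel hR hT h hF)]
    with ω hω
  rw [hω, noiseKernel_apply _ hF]

theorem condLawEq_of_indepFun {α ζ : Type*} [MeasurableSpace α] [MeasurableSpace ζ]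
    [StandardBorelSpace ζ] [Nonempty ζ] {R : Ω → α} {T : Ω → τ} {g : τ → τ'} {F : τ' × α → ζ}
    (hR : Measurable R) (hT : Measurable T) (hg : Measurable g) (hF : Measurable F)
    (h : IndepFun T R μ) :
    CondLawEq μ (fun ω => F (g (T ω), R ω)) T fun ω => g (T ω) := fun _ hB =>
  (condProb_ae_eq_of_indepFun (F := fun p => F (g p.1, p.2)) hR hT (by fun_prop) h hB).trans
    (condProb_ae_eq_of_indepFun hR (hg.comp hT) hF (h.comp hg measurable_id) hB).symm

theorem condExp_add_of_indepFun {E : Type*} [NormedAddCommGroup E] [NormedSpace ℝ E]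
    [CompleteSpace E] [MeasurableSpace E] [BorelSpace E] [SecondCountableTopology E]
    {R : Ω → E} {T : Ω → τ} {a : τ → E} (hR : Measurable R) (hT : Measurable T)
    (ha : Measurable a) (h : IndepFun T R μ) (haT : Integrable (fun ω => a (T ω)) μ)
    (hRi : Integrable R μ) (h0 : ∫ ω, R ω ∂μ = 0) :
    μ[fun ω => a (T ω) + R ω | sig T] =ᵐ[μ] fun ω => a (T ω) := by
  have hknown : μ[fun ω => a (T ω) | sig T] = fun ω => a (T ω) :=
    condExp_of_stronglyMeasurable hT.comap_le
      (ha.comp (comap_measurable T)).stronglyMeasurable haT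
  have hnoise : μ[R | sig T] =ᵐ[μ] fun _ => ∫ ω, R ω ∂μ :=
    condExp_indep_eq hR.comap_le hT.comap_le (comap_measurable R).stronglyMeasurable h.symm
  refine (condExp_add haT hRi _).trans ?_
  filter_upwards [hnoise] with ω hω
  rw [Pi.add_apply, hknown, hω, h0, add_zero]

theorem indepFun_of_condLawEq {α δ δ' ε ζ : Type*} [MeasurableSpace α] [MeasurableSpace δ]
    [MeasurableSpace δ'] [MeasurableSpace ε] [MeasurableSpace ζ] {A : Ω → α} {Z : Ω → ζ}
    {f : α → ε} {g : α → δ} {g' : δ → δ'} (hA : Measurable A) (hZ : Measurable Z)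
    (hf : Measurable f) (hg : Measurable g) (hg' : Measurable g')
    (hZA : CondLawEq μ Z A fun ω => g' (g (A ω)))
    (h : IndepFun (fun ω => f (A ω)) (fun ω => g (A ω)) μ) :
    IndepFun (fun ω => f (A ω)) (fun ω => (g (A ω), Z ω)) μ := by
  have he : Measurable fun ω => f (A ω) := hf.comp hA
  have hD : Measurable fun ω => g (A ω) := hg.comp hA
  have := Measure.isProbabilityMeasure_map (μ := μ) he.aemeasurable
  have := Measure.isProbabilityMeasure_map (μ := μ) (hD.prodMk hZ).aemeasurable
  have := Measure.isProbabilityMeasure_map (μ := μ) (he.prodMk (hD.prodMk hZ)).aemeasurable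
  rw [indepFun_iff_map_prod_eq_prod_map_map he.aemeasurable (hD.prodMk hZ).aemeasurable]
  refine Measure.ext_prod₃ fun {s} {t} {u} hs ht hu => ?_
  rw [Measure.prod_prod, Measure.map_apply (he.prodMk (hD.prodMk hZ)) (hs.prod (ht.prod hu)),
    Measure.map_apply he hs, Measure.map_apply (hD.prodMk hZ) (ht.prod hu),
    Set.mk_preimage_prod, Set.mk_preimage_prod, ← Set.inter_assoc,
    ← ENNReal.toReal_eq_toReal_iff' (by finiteness) (by finiteness), ENNReal.toReal_mul]
  set E₁ : Set Ω := (fun ω => f (A ω)) ⁻¹' s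
  set E₂ : Set Ω := (fun ω => g (A ω)) ⁻¹' t
  have hE₁ : MeasurableSet[sig A] E₁ := ⟨f ⁻¹' s, hf hs, rfl⟩
  have hE₂ : MeasurableSet[sig A] E₂ := ⟨g ⁻¹' t, hg ht, rfl⟩
  set q : Ω → ℝ := μ⟦Z ⁻¹' u | sig fun ω => g' (g (A ω))⟧
  have hcond : ∀ E : Set Ω, MeasurableSet[sig A] E →
      μ.real (E ∩ Z ⁻¹' u) = ∫ ω in E, q ω ∂μ := fun E hE =>
    (measureReal_inter_eq_setIntegral_condProb hA.comap_le hE (hZ hu)).trans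
      (integral_congr_ae (ae_restrict_of_ae (hZA u hu)))
  have hq : Measurable[sig fun ω => g (A ω)] q := stronglyMeasurable_condExp.measurable.mono
    (hg'.comp (comap_measurable fun ω => g (A ω))).comap_le le_rfl
  change μ.real _ = μ.real _ * μ.real _
  rw [hcond _ (hE₁.inter hE₂), hcond _ hE₂]
  exact setIntegral_inter_eq_mul_of_indep he.comap_le hD.comap_le h ⟨s, hs, rfl⟩ ⟨t, ht, rfl⟩ hq

end Conditioning

section Transfer

variable {Ω E : Type*} [MeasurableSpace Ω] [MeasurableSpace E] {μ : Measure Ω} {γ : Measure E}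
  {G : Ω → E}

theorem crossMoment_comp_measurePreserving {ι κ : Type*} {U : E → ι → ℝ} {V : E → κ → ℝ}
    (hG : MeasurePreserving G μ γ) (hU : Measurable U) (hV : Measurable V) :
    crossMoment μ (fun ω => U (G ω)) (fun ω => V (G ω)) = crossMoment γ U V := by
  ext i j
  have hm : Measurable fun v => U v i * V v j := by fun_prop
  rw [crossMoment_apply, crossMoment_apply, ← hG.map_eq,
    integral_map hG.aemeasurable hm.aestronglyMeasurable]

theorem indepFun_comp_measurePreserving {α β : Type*} [MeasurableSpace α] [MeasurableSpace β]
    {f : E → α} {g : E → β} (hG : MeasurePreserving G μ γ) (hf : Measurable f) (hg : Measurable g)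
    (h : IndepFun f g γ) : IndepFun (fun ω => f (G ω)) (fun ω => g (G ω)) μ := by
  rw [indepFun_iff_measure_inter_preimage_eq_mul] at h ⊢
  intro s t hs ht
  have hst := h s t hs ht
  rw [← hG.measure_preimage ((hf hs).inter (hg ht)).nullMeasurableSet,
    ← hG.measure_preimage (hf hs).nullMeasurableSet,
    ← hG.measure_preimage (hg ht).nullMeasurableSet] at hst
  exact hst

theorem IsCenteredGaussian.comp_measurePreserving {ι : Type*} [Finite ι] {N : E → ι → ℝ}
    (hN : IsCenteredGaussian γ N) (hNm : Measurable N) (hG : MeasurePreserving G μ γ) :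
    IsCenteredGaussian μ fun ω => N (G ω) where
  hasGaussianLaw := by
    have := Fintype.ofFinite ι
    have hmap : μ.map (fun ω => N (G ω)) = γ.map N := by
      rw [← hG.map_eq, Measure.map_map hNm hG.measurable]
      rfl
    exact ⟨hmap ▸ hN.hasGaussianLaw.isGaussian_map⟩
  integral_eq_zero i := by
    rw [← hN.integral_eq_zero i, ← hG.map_eq]
    exact (integral_map hG.aemeasurable
      ((measurable_pi_apply i).comp hNm).aestronglyMeasurable).symm

end Transfer

section GaussianLinear

/-- The continuous linear map `v ↦ A (L v)`. -/
def matComp {E ι κ : Type*} [NormedAddCommGroup E] [NormedSpace ℝ E] [Fintype ι]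
    (A : Matrix κ ι ℝ) (L : E →L[ℝ] (ι → ℝ)) : E →L[ℝ] (κ → ℝ) :=
  (LinearMap.toContinuousLinearMap A.mulVecLin).comp L

variable {E ι κ κ' : Type*} [NormedAddCommGroup E] [NormedSpace ℝ E]

variable [MeasurableSpace E] [BorelSpace E] {γ : Measure E}

section

variable [IsGaussian γ]

theorem memLp_two_eval_clm (L : E →L[ℝ] (ι → ℝ)) (i : ι) : MemLp (fun v => L v i) 2 γ :=
  ((IsGaussian.hasGaussianLaw_id (μ := γ)).map_fun
    ((ContinuousLinearMap.proj (R := ℝ) (φ := fun _ : ι => ℝ) i).comp L)).memLp_two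

theorem memLp_two_clm [Fintype ι] (L : E →L[ℝ] (ι → ℝ)) : MemLp L 2 γ :=
  MemLp.of_eval (memLp_two_eval_clm L)

theorem integrable_toLp_clm {n : ℕ} (L : E →L[ℝ] (Fin n → ℝ)) :
    Integrable (fun v => (WithLp.toLp 2 (L v) : Vec n)) γ :=
  ((EuclideanSpace.equiv (Fin n) ℝ).symm : _ →L[ℝ] Vec n).integrable_comp
    ((memLp_two_clm L).integrable one_le_two)

theorem integrable_mul_clm (L : E →L[ℝ] (ι → ℝ)) (M : E →L[ℝ] (κ → ℝ)) (i : ι) (j : κ) :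
    Integrable (fun v => L v i * M v j) γ :=
  (memLp_two_eval_clm L i).integrable_mul (memLp_two_eval_clm M j)

theorem crossMoment_clm_sub_left (L L' : E →L[ℝ] (ι → ℝ)) (M : E →L[ℝ] (κ → ℝ)) :
    crossMoment γ (L - L') M = crossMoment γ L M - crossMoment γ L' M := by
  ext i j
  exact (integral_congr_ae (ae_of_all _ fun v => sub_mul _ _ _)).trans
    (integral_sub (integrable_mul_clm L M i j) (integrable_mul_clm L' M i j))

theorem crossMoment_clm_sub_right (L : E →L[ℝ] (ι → ℝ)) (M M' : E →L[ℝ] (κ → ℝ)) :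
    crossMoment γ L (M - M') = crossMoment γ L M - crossMoment γ L M' := by
  rw [← crossMoment_transpose, crossMoment_clm_sub_left, transpose_sub, crossMoment_transpose,
    crossMoment_transpose]

theorem crossMoment_clm_add_left (L L' : E →L[ℝ] (ι → ℝ)) (M : E →L[ℝ] (κ → ℝ)) :
    crossMoment γ (L + L') M = crossMoment γ L M + crossMoment γ L' M := by
  ext i j
  exact (integral_congr_ae (ae_of_all _ fun v => add_mul _ _ _)).trans
    (integral_add (integrable_mul_clm L M i j) (integrable_mul_clm L' M i j))

theorem crossMoment_clm_add_right (L : E →L[ℝ] (ι → ℝ)) (M M' : E →L[ℝ] (κ → ℝ)) :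
    crossMoment γ L (M + M') = crossMoment γ L M + crossMoment γ L M' := by
  rw [← crossMoment_transpose, crossMoment_clm_add_left, transpose_add, crossMoment_transpose,
    crossMoment_transpose]

theorem crossMoment_matComp_left [Fintype ι] [Finite κ] (A : Matrix κ' ι ℝ)
    (L : E →L[ℝ] (ι → ℝ)) (M : E →L[ℝ] (κ → ℝ)) :
    crossMoment γ (matComp A L) M = A * crossMoment γ L M := by
  have := Fintype.ofFinite κ
  exact crossMoment_mulVec_left (memLp_two_clm L) (memLp_two_clm M) A

theorem crossMoment_matComp_right [Finite ι] [Fintype κ] (L : E →L[ℝ] (ι → ℝ))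
    (A : Matrix κ' κ ℝ) (M : E →L[ℝ] (κ → ℝ)) :
    crossMoment γ L (matComp A M) = crossMoment γ L M * Aᵀ := by
  rw [← crossMoment_transpose, crossMoment_matComp_left, transpose_mul, crossMoment_transpose]

variable [CompleteSpace E] [SecondCountableTopology E]
  {L : E →L[ℝ] (ι → ℝ)} {M : E →L[ℝ] (κ → ℝ)}

theorem isCenteredGaussian_clm [Finite ι] (hγ : ∫ v, v ∂γ = 0) (L : E →L[ℝ] (ι → ℝ)) :
    IsCenteredGaussian γ L where
  hasGaussianLaw := by
    have := Fintype.ofFinite ι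
    exact (IsGaussian.hasGaussianLaw_id (μ := γ)).map_fun L
  integral_eq_zero i := by
    have hcomm := ((ContinuousLinearMap.proj (R := ℝ) (φ := fun _ : ι => ℝ) i).comp
      L).integral_comp_comm (IsGaussian.integrable_id (μ := γ))
    simpa [hγ] using hcomm

theorem indepFun_of_crossMoment_eq_zero [Finite ι] [Finite κ] (hγ : ∫ v, v ∂γ = 0)
    (h : crossMoment γ M L = 0) : IndepFun M L γ := by
  have := Fintype.ofFinite ι
  have := Fintype.ofFinite κ
  refine HasGaussianLaw.indepFun_of_covariance_eval (X := fun i v => M v i)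
    (Y := fun j v => L v j) ((IsGaussian.hasGaussianLaw_id (μ := γ)).map_fun (M.prod L))
    fun i j => ?_
  rw [covariance_eq_sub (memLp_two_eval_clm M i) (memLp_two_eval_clm L j),
    (isCenteredGaussian_clm hγ M).integral_eq_zero, zero_mul, sub_zero]
  exact congrFun (congrFun h i) j

theorem indepFun_prodMk_of_crossMoment_eq_zero [Finite ι] [Finite κ] [Finite κ']
    {M' : E →L[ℝ] (κ' → ℝ)} (hγ : ∫ v, v ∂γ = 0) (h : crossMoment γ M L = 0)
    (h' : crossMoment γ M' L = 0) : IndepFun (fun v => (M v, M' v)) L γ := by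
  let K : E →L[ℝ] (κ ⊕ κ' → ℝ) := ContinuousLinearMap.pi (Sum.elim
    (fun k => (ContinuousLinearMap.proj (R := ℝ) (φ := fun _ : κ => ℝ) k).comp M)
    fun k => (ContinuousLinearMap.proj (R := ℝ) (φ := fun _ : κ' => ℝ) k).comp M')
  have hK : crossMoment γ K L = 0 := by
    ext (i | i) j
    · exact congrFun (congrFun h i) j
    · exact congrFun (congrFun h' i) j
  exact (indepFun_of_crossMoment_eq_zero hγ hK).comp (ψ := id)
    (φ := fun x => (fun k => x (Sum.inl k), fun k => x (Sum.inr k))) (by fun_prop) measurable_id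

end

variable {Ω τ : Type*} [MeasurableSpace Ω] [MeasurableSpace τ] {μ : Measure Ω} {G : Ω → E}
  {T : Ω → τ} {m n : ℕ}

theorem condExp_ae_eq_of_indepFun_clm [IsGaussian γ] [CompleteSpace E]
    [SecondCountableTopology E] [IsProbabilityMeasure μ] (hγ : ∫ v, v ∂γ = 0)
    (hG : MeasurePreserving G μ γ) {U : Ω → Vec n} {a : τ → Vec n} {L : E →L[ℝ] (Fin n → ℝ)}
    (hT : Measurable T) (ha : Measurable a) (hU : Integrable U μ)
    (hUa : ∀ ω, U ω = a (T ω) + WithLp.toLp 2 (L (G ω)))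
    (h : IndepFun T (fun ω => (WithLp.toLp 2 (L (G ω)) : Vec n)) μ) :
    μ[U | sig T] =ᵐ[μ] fun ω => a (T ω) := by
  let R : E →L[ℝ] Vec n := ((EuclideanSpace.equiv (Fin n) ℝ).symm : _ →L[ℝ] Vec n).comp L
  have hR : Integrable (fun ω => R (G ω)) μ :=
    hG.integrable_comp_of_integrable (integrable_toLp_clm L)
  have hR0 : ∫ ω, R (G ω) ∂μ = 0 := by
    rw [← integral_map hG.aemeasurable R.continuous.aestronglyMeasurable, hG.map_eq]
    exact (R.integral_comp_comm IsGaussian.integrable_id).trans (by simp only [id, hγ, map_zero])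
  have haT : Integrable (fun ω => a (T ω)) μ :=
    (hU.sub hR).congr (ae_of_all _ fun ω => sub_eq_of_eq_add (hUa ω))
  rw [show U = fun ω => a (T ω) + R (G ω) from funext hUa]
  exact condExp_add_of_indepFun (R.measurable.comp hG.measurable) hT ha h haT hR hR0

theorem condCov_eq_crossMoment_clm (hG : MeasurePreserving G μ γ) {U : Ω → Vec m} {U' : Ω → Vec n}
    {a : τ → Vec m} {a' : τ → Vec n} {L : E →L[ℝ] (Fin m → ℝ)} {L' : E →L[ℝ] (Fin n → ℝ)}
    (hUa : ∀ ω, U ω = a (T ω) + WithLp.toLp 2 (L (G ω)))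
    (hUa' : ∀ ω, U' ω = a' (T ω) + WithLp.toLp 2 (L' (G ω)))
    (h : μ[U | sig T] =ᵐ[μ] fun ω => a (T ω)) (h' : μ[U' | sig T] =ᵐ[μ] fun ω => a' (T ω)) :
    condCov μ U U' T = crossMoment γ L L' := by
  rw [condCov_eq_crossMoment (R := fun ω => WithLp.toLp 2 (L (G ω)))
    (R' := fun ω => WithLp.toLp 2 (L' (G ω)))
    (h.trans (ae_of_all _ fun ω => by simp only [hUa, add_sub_cancel_right]))
    (h'.trans (ae_of_all _ fun ω => by simp only [hUa', add_sub_cancel_right]))]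
  exact crossMoment_comp_measurePreserving hG L.measurable L'.measurable

end GaussianLinear

section SourceMoments

variable {nx ns ny : ℕ}

@[fun_prop]
theorem measurable_srcX : Measurable (srcX : Src nx ns ny → Vec nx) := measurable_fst

@[fun_prop]
theorem measurable_srcS : Measurable (srcS : Src nx ns ny → Vec ns) :=
  measurable_fst.comp measurable_snd

@[fun_prop]
theorem measurable_srcY : Measurable (srcY : Src nx ns ny → Vec ny) :=
  measurable_snd.comp measurable_snd

/-- The coordinates of `X`, as a continuous linear map of the source. -/
def cx : Src nx ns ny →L[ℝ] (Fin nx → ℝ) :=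
  (EuclideanSpace.equiv (Fin nx) ℝ : Vec nx →L[ℝ] _).comp (ContinuousLinearMap.fst ℝ _ _)

/-- The coordinates of `S`, as a continuous linear map of the source. -/
def cs : Src nx ns ny →L[ℝ] (Fin ns → ℝ) :=
  (EuclideanSpace.equiv (Fin ns) ℝ : Vec ns →L[ℝ] _).comp
    ((ContinuousLinearMap.fst ℝ _ _).comp (ContinuousLinearMap.snd ℝ _ _))

/-- The coordinates of `Y`, as a continuous linear map of the source. -/
def cy : Src nx ns ny →L[ℝ] (Fin ny → ℝ) :=
  (EuclideanSpace.equiv (Fin ny) ℝ : Vec ny →L[ℝ] _).comp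
    ((ContinuousLinearMap.snd ℝ _ _).comp (ContinuousLinearMap.snd ℝ _ _))

/-- The coefficient matrix `Q_{U,Y} Q_Y⁻¹` of the linear estimator `E[U|Y]`. -/
def gain {n : ℕ} (P : Measure (Src nx ns ny)) (U : Src nx ns ny →L[ℝ] (Fin n → ℝ)) :
    Matrix (Fin n) (Fin ny) ℝ :=
  crossMoment P U cy * (covY P)⁻¹

/-- The estimation error `U - E[U|Y]` of a linear function `U` of the source. -/
def residual {n : ℕ} (P : Measure (Src nx ns ny)) (U : Src nx ns ny →L[ℝ] (Fin n → ℝ)) :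
    Src nx ns ny →L[ℝ] (Fin n → ℝ) :=
  U - matComp (gain P U) cy

/-- The standing assumptions on a Gaussian law `P` of `(X, S, Y)`: zero mean and `Q_Y ≻ 0`. -/
structure IsCenteredSource (P : Measure (Src nx ns ny)) : Prop where
  integral_eq_zero : ∫ v, v ∂P = 0
  covY_posDef : (covY P).PosDef

variable {P : Measure (Src nx ns ny)} {m n : ℕ}

theorem eq_gain_add_residual (U : Src nx ns ny →L[ℝ] (Fin n → ℝ)) (v : Src nx ns ny) :
    (WithLp.toLp 2 (U v) : Vec n) =
      WithLp.toLp 2 (gain P U *ᵥ cy v) + WithLp.toLp 2 (residual P U v) := by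
  rw [← WithLp.toLp_add]
  exact congrArg _ (add_sub_cancel _ _).symm

namespace IsCenteredSource

variable [IsGaussian P]

theorem crossCov_eq (hP : IsCenteredSource P) {f : Src nx ns ny → Vec m} {g : Src nx ns ny → Vec n}
    {U : Src nx ns ny →L[ℝ] (Fin m → ℝ)} {V : Src nx ns ny →L[ℝ] (Fin n → ℝ)}
    (hU : ∀ v, (f v).ofLp = U v) (hV : ∀ v, (g v).ofLp = V v) :
    crossCov P f g = crossMoment P U V := by
  ext i j
  simp only [crossCov, of_apply, hU, hV]
  rw [covariance_eq_sub (memLp_two_eval_clm U i) (memLp_two_eval_clm V j),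
    (isCenteredGaussian_clm hP.integral_eq_zero U).integral_eq_zero, zero_mul, sub_zero]
  rfl

theorem covXY_eq (hP : IsCenteredSource P) : covXY P = crossMoment P cx cy :=
  hP.crossCov_eq (fun _ => rfl) fun _ => rfl

theorem covSY_eq (hP : IsCenteredSource P) : covSY P = crossMoment P cs cy :=
  hP.crossCov_eq (fun _ => rfl) fun _ => rfl

theorem covY_eq (hP : IsCenteredSource P) : covY P = crossMoment P cy cy :=
  hP.crossCov_eq (fun _ => rfl) fun _ => rfl

theorem crossMoment_residual_cy (hP : IsCenteredSource P) (U : Src nx ns ny →L[ℝ] (Fin n → ℝ)) :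
    crossMoment P (residual P U) cy = 0 := by
  rw [residual, crossMoment_clm_sub_left, crossMoment_matComp_left, ← hP.covY_eq, gain,
    nonsing_inv_mul_cancel_right _ _ ((isUnit_iff_isUnit_det _).1 hP.covY_posDef.isUnit), sub_self]

theorem indepFun_srcY_residual (hP : IsCenteredSource P) (U : Src nx ns ny →L[ℝ] (Fin n → ℝ)) :
    IndepFun srcY (fun v => (WithLp.toLp 2 (residual P U v) : Vec n)) P := by
  have h0 : crossMoment P cy (residual P U) = 0 := by
    rw [← crossMoment_transpose, hP.crossMoment_residual_cy, transpose_zero]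
  exact (indepFun_of_crossMoment_eq_zero hP.integral_eq_zero h0).comp
    (φ := fun y : Fin ny → ℝ => (WithLp.toLp 2 y : Vec ny))
    (ψ := fun x : Fin n → ℝ => (WithLp.toLp 2 x : Vec n)) (by fun_prop) (by fun_prop)

theorem condExp_srcY (hP : IsCenteredSource P) (U : Src nx ns ny →L[ℝ] (Fin n → ℝ)) :
    P[fun v => (WithLp.toLp 2 (U v) : Vec n) | sig srcY] =ᵐ[P]
      fun v => WithLp.toLp 2 (gain P U *ᵥ cy v) :=
  condExp_ae_eq_of_indepFun_clm hP.integral_eq_zero (MeasurePreserving.id P)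
    (a := fun y : Vec ny => WithLp.toLp 2 (gain P U *ᵥ y.ofLp)) measurable_srcY (by fun_prop)
    (integrable_toLp_clm U) (eq_gain_add_residual U) (hP.indepFun_srcY_residual U)

theorem condCov_srcY_eq (hP : IsCenteredSource P) (U : Src nx ns ny →L[ℝ] (Fin m → ℝ))
    (V : Src nx ns ny →L[ℝ] (Fin n → ℝ)) :
    condCov P (fun v => WithLp.toLp 2 (U v)) (fun v => WithLp.toLp 2 (V v)) srcY =
      crossMoment P (residual P U) (residual P V) :=
  condCov_eq_crossMoment_clm (MeasurePreserving.id P)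
    (a := fun y : Vec ny => WithLp.toLp 2 (gain P U *ᵥ y.ofLp))
    (a' := fun y : Vec ny => WithLp.toLp 2 (gain P V *ᵥ y.ofLp))
    (eq_gain_add_residual U) (eq_gain_add_residual V) (hP.condExp_srcY U) (hP.condExp_srcY V)

theorem covXgY_eq (hP : IsCenteredSource P) :
    covXgY P = crossMoment P (residual P cx) (residual P cx) := hP.condCov_srcY_eq cx cx

theorem covSgY_eq (hP : IsCenteredSource P) :
    covSgY P = crossMoment P (residual P cs) (residual P cs) := hP.condCov_srcY_eq cs cs

theorem covXSgY_eq (hP : IsCenteredSource P) :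
    covXSgY P = crossMoment P (residual P cx) (residual P cs) := hP.condCov_srcY_eq cx cs

theorem covSgY_posSemidef (hP : IsCenteredSource P) : (covSgY P).PosSemidef := by
  rw [hP.covSgY_eq]
  exact posSemidef_crossMoment (memLp_two_clm _)

end IsCenteredSource

end SourceMoments

section Whitening

variable {nx ns ny r : ℕ}

/-- The vector `N = L (S - E[S|Y])`. If `Q_{S|Y} = B Bᵀ` and `L B = 1`, then `N` is standard normal,
independent of `Y`, and `S = E[S|Y] + B N`. -/
def whiteS (P : Measure (Src nx ns ny)) (L : Matrix (Fin r) (Fin ns) ℝ) :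
    Src nx ns ny →L[ℝ] (Fin r → ℝ) :=
  matComp L (residual P cs)

/-- The matrix `E[X Nᵀ]`, for the white vector `N` of `whiteS`. -/
def whiteC (P : Measure (Src nx ns ny)) (L : Matrix (Fin r) (Fin ns) ℝ) :
    Matrix (Fin nx) (Fin r) ℝ := covXSgY P * Lᵀ

/-- The innovation `X - E[X|S, Y]`, the part of `X` that is independent of `(S, Y)`. -/
def innov (P : Measure (Src nx ns ny)) (L : Matrix (Fin r) (Fin ns) ℝ) :
    Src nx ns ny →L[ℝ] (Fin nx → ℝ) :=
  residual P cx - matComp (whiteC P L) (whiteS P L)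

variable {P : Measure (Src nx ns ny)} [IsGaussian P] {B : Matrix (Fin ns) (Fin r) ℝ}
  {L : Matrix (Fin r) (Fin ns) ℝ}

namespace IsCenteredSource

theorem crossMoment_whiteS (hP : IsCenteredSource P) (hB : IsFullRankFactor (covSgY P) B L) :
    crossMoment P (whiteS P L) (whiteS P L) = 1 := by
  rw [whiteS, crossMoment_matComp_left, crossMoment_matComp_right, ← hP.covSgY_eq,
    ← Matrix.mul_assoc, hB.conj_eq_one]

theorem residual_cs_ae_eq (hP : IsCenteredSource P) (hB : IsFullRankFactor (covSgY P) B L) :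
    residual P cs =ᵐ[P] fun v => B *ᵥ whiteS P L v := by
  rw [hP.covSgY_eq] at hB
  exact hB.ae_eq_mulVec (memLp_two_clm _)

theorem crossMoment_residual_cs (hP : IsCenteredSource P) (hB : IsFullRankFactor (covSgY P) B L)
    {n : ℕ} (U : Src nx ns ny →L[ℝ] (Fin n → ℝ)) :
    crossMoment P U (residual P cs) = crossMoment P U (whiteS P L) * Bᵀ := by
  rw [← crossMoment_matComp_right]
  exact crossMoment_congr (ae_eq_refl _) (hP.residual_cs_ae_eq hB)

theorem crossMoment_residual_cx_whiteS (hP : IsCenteredSource P) :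
    crossMoment P (residual P cx) (whiteS P L) = whiteC P L := by
  rw [whiteS, crossMoment_matComp_right, ← hP.covXSgY_eq, whiteC]

theorem covXSgY_eq_whiteC_mul (hP : IsCenteredSource P) (hB : IsFullRankFactor (covSgY P) B L) :
    covXSgY P = whiteC P L * Bᵀ := by
  rw [hP.covXSgY_eq, hP.crossMoment_residual_cs hB, hP.crossMoment_residual_cx_whiteS]

theorem crossMoment_whiteS_cy (hP : IsCenteredSource P) :
    crossMoment P (whiteS P L) cy = 0 := by
  rw [whiteS, crossMoment_matComp_left, hP.crossMoment_residual_cy, Matrix.mul_zero]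

theorem crossMoment_innov_residual_cs (hP : IsCenteredSource P)
    (hB : IsFullRankFactor (covSgY P) B L) : crossMoment P (innov P L) (residual P cs) = 0 := by
  rw [hP.crossMoment_residual_cs hB, innov, crossMoment_clm_sub_left, crossMoment_matComp_left,
    hP.crossMoment_whiteS hB, hP.crossMoment_residual_cx_whiteS, Matrix.mul_one, sub_self,
    Matrix.zero_mul]

theorem crossMoment_innov_cy (hP : IsCenteredSource P) : crossMoment P (innov P L) cy = 0 := by
  rw [innov, crossMoment_clm_sub_left, crossMoment_matComp_left, hP.crossMoment_whiteS_cy,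
    hP.crossMoment_residual_cy, Matrix.mul_zero, sub_self]

theorem condMutualInfo_eq_mutualInfo_whiteS (hP : IsCenteredSource P)
    (hB : IsFullRankFactor (covSgY P) B L) {Ω ζ : Type*} [MeasurableSpace Ω] [MeasurableSpace ζ]
    {μ : Measure Ω} [IsProbabilityMeasure μ] {ξ : Ω → Src nx ns ny} (hξ : MeasurePreserving ξ μ P)
    {Z : Ω → ζ} (hZ : Measurable Z) :
    condMutualInfo μ (fun ω => srcS (ξ ω)) Z (fun ω => srcY (ξ ω))
      = mutualInfo μ (fun ω => (srcY (ξ ω), Z ω)) fun ω => whiteS P L (ξ ω) := by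
  have hY : Measurable fun ω => srcY (ξ ω) := measurable_srcY.comp hξ.measurable
  have hR : Measurable fun ω => (WithLp.toLp 2 (residual P cs (ξ ω)) : Vec ns) :=
    ((WithLp.measurable_toLp 2 _).comp (residual P cs).measurable).comp hξ.measurable
  have hind : IndepFun (fun ω => srcY (ξ ω)) (fun ω => WithLp.toLp 2 (residual P cs (ξ ω))) μ :=
    indepFun_comp_measurePreserving hξ measurable_srcY
      ((WithLp.measurable_toLp 2 _).comp (residual P cs).measurable) (hP.indepFun_srcY_residual cs)
  have hwhite : (fun ω => (WithLp.toLp 2 (residual P cs (ξ ω)) : Vec ns)) =ᵐ[μ]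
      fun ω => WithLp.toLp 2 (B *ᵥ whiteS P L (ξ ω)) :=
    hξ.quasiMeasurePreserving.ae ((hP.residual_cs_ae_eq hB).fun_comp (WithLp.toLp 2))
  rw [show (fun ω => srcS (ξ ω)) = fun ω =>
      WithLp.toLp 2 (gain P cs *ᵥ (srcY (ξ ω)).ofLp) + WithLp.toLp 2 (residual P cs (ξ ω)) from
    funext fun ω => eq_gain_add_residual cs (ξ ω),
    condMutualInfo_eq_mutualInfo (a := fun y : Vec ny => WithLp.toLp 2 (gain P cs *ᵥ y.ofLp))
      hR hZ hY (by fun_prop) hind]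
  refine le_antisymm ?_ ?_
  · rw [mutualInfo_congr hwhite]
    exact mutualInfo_comp_le (hY.prodMk hZ) ((whiteS P L).measurable.comp hξ.measurable)
      (g := fun x => (WithLp.toLp 2 (B *ᵥ x) : Vec ns)) (by fun_prop)
  · exact mutualInfo_comp_le (hY.prodMk hZ) hR (g := fun x : Vec ns => L *ᵥ x.ofLp) (by fun_prop)

end IsCenteredSource

end Whitening

section ChannelAlgebra

variable {nx ns ny r : ℕ} {P : Measure (Src nx ns ny)} {H : Matrix (Fin nx) (Fin ns) ℝ}
  {QW D : Matrix (Fin nx) (Fin nx) ℝ} {B : Matrix (Fin ns) (Fin r) ℝ}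
  {L : Matrix (Fin r) (Fin ns) ℝ}

theorem covHatgY_sub_mul_transpose (hB : IsFullRankFactor (covSgY P) B L) :
    covHatgY P H QW - (H * B) * (H * B)ᵀ = QW := by
  rw [covHatgY, hB.eq_mul_transpose, transpose_mul]
  simp only [Matrix.mul_assoc, add_sub_cancel_left]

theorem covSgHatY_eq_mul_schur_mul (hB : IsFullRankFactor (covSgY P) B L) :
    covSgHatY P H QW = B * schur (covHatgY P H QW) (H * B) * Bᵀ := by
  rw [covSgHatY, schur, hB.eq_mul_transpose, transpose_mul, Matrix.mul_sub, Matrix.sub_mul,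
    Matrix.mul_one]
  simp only [Matrix.mul_assoc]

theorem posSemidef_covHatgY_sub (hS : (covSgY P).PosSemidef) :
    (covHatgY P H QW - QW).PosSemidef := by
  rw [covHatgY, add_sub_cancel_right]
  exact posSemidef_mul_mul_transpose hS H

namespace IsChannelParam

theorem covHatgY_eq (h : IsChannelParam P H QW D) : covHatgY P H QW = H * (covXSgY P)ᵀ := by
  rw [covHatgY, h.noise_eq, add_sub_cancel]

theorem covHatgY_posSemidef (h : IsChannelParam P H QW D) : (covHatgY P H QW).PosSemidef :=
  h.covHatgY_eq ▸ h.mul_posSemidef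

theorem covHatgY_eq_sub (h : IsChannelParam P H QW D) : covHatgY P H QW = covXgY P - D :=
  h.covHatgY_eq.trans h.mul_eq_sub

theorem covHatgY_sub_posSemidef (h : IsChannelParam P H QW D)
    (hB : IsFullRankFactor (covSgY P) B L) :
    (covHatgY P H QW - (H * B) * (H * B)ᵀ).PosSemidef :=
  (covHatgY_sub_mul_transpose hB).symm ▸ h.noise_posSemidef

theorem schur_posSemidef (h : IsChannelParam P H QW D) (hB : IsFullRankFactor (covSgY P) B L) :
    (schur (covHatgY P H QW) (H * B)).PosSemidef :=
  RemoteRDF.schur_posSemidef h.covHatgY_posSemidef (h.covHatgY_sub_posSemidef hB)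

theorem covSgHatY_posSemidef (h : IsChannelParam P H QW D)
    (hB : IsFullRankFactor (covSgY P) B L) : (covSgHatY P H QW).PosSemidef := by
  rw [covSgHatY_eq_mul_schur_mul hB]
  exact posSemidef_mul_mul_transpose (h.schur_posSemidef hB) B

theorem mul_pinv_mul (h : IsChannelParam P H QW D) (hB : IsFullRankFactor (covSgY P) B L) :
    covSgY P * Hᵀ * pinv (covHatgY P H QW) * covHatgY P H QW = covSgY P * Hᵀ := by
  have hBJ : covSgY P * Hᵀ = B * (H * B)ᵀ := by
    rw [hB.eq_mul_transpose, transpose_mul, Matrix.mul_assoc]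
  rw [hBJ, Matrix.mul_assoc, Matrix.mul_assoc, ← Matrix.mul_assoc _ (pinv _),
    transpose_mul_pinv_mul h.covHatgY_posSemidef (h.covHatgY_sub_posSemidef hB)]

theorem halfLogDetRatio_source (h : IsChannelParam P H QW D)
    (hB : IsFullRankFactor (covSgY P) B L) :
    halfLogDetRatio (covSgY P) (covSgHatY P H QW)
      = halfLogInv (schur (covHatgY P H QW) (H * B)).det := by
  rw [covSgHatY_eq_mul_schur_mul hB, hB.halfLogDetRatio_conj (h.schur_posSemidef hB)]

theorem halfLogDetRatio_channel (h : IsChannelParam P H QW D)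
    (hB : IsFullRankFactor (covSgY P) B L) :
    halfLogDetRatio (covHatgY P H QW) QW = halfLogInv (schur (covHatgY P H QW) (H * B)).det := by
  rw [← halfLogDetRatio_sub_mul_transpose h.covHatgY_posSemidef (h.covHatgY_sub_posSemidef hB),
    covHatgY_sub_mul_transpose hB]

variable [IsGaussian P]

theorem posSemidef_covSgY_sub (h : IsChannelParam P H QW D) (hP : IsCenteredSource P) :
    (covSgY P - covSgHatY P H QW).PosSemidef := by
  obtain ⟨r, B, L, hB⟩ := exists_isFullRankFactor hP.covSgY_posSemidef
  have hSt : (covSgY P)ᵀ = covSgY P := by simpa using hP.covSgY_posSemidef.1.eq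
  set K := covSgY P * Hᵀ * pinv (covHatgY P H QW) with hK
  have hconj : covSgY P - covSgHatY P H QW = K * covHatgY P H QW * Kᵀ := by
    have hsymm : K * H * covSgY P = (K * H * covSgY P)ᵀ := by
      have := (h.covSgHatY_posSemidef hB).1.eq
      rw [conjTranspose_eq_transpose_of_trivial, covSgHatY, transpose_sub, hSt] at this
      exact (sub_right_injective this).symm
    rw [covSgHatY, sub_sub_cancel, ← hK, hsymm, hK, h.mul_pinv_mul hB]
    simp only [transpose_mul, hSt, Matrix.mul_assoc]
  exact hconj ▸ posSemidef_mul_mul_transpose h.covHatgY_posSemidef K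

theorem covHatgY_eq_mul_whiteC (h : IsChannelParam P H QW D) (hP : IsCenteredSource P)
    (hB : IsFullRankFactor (covSgY P) B L) : covHatgY P H QW = (H * B) * (whiteC P L)ᵀ := by
  rw [h.covHatgY_eq, hP.covXSgY_eq_whiteC_mul hB, transpose_mul, transpose_transpose,
    Matrix.mul_assoc]

theorem feasible (h : IsChannelParam P H QW D) (hP : IsCenteredSource P)
    (hB : IsFullRankFactor (covSgY P) B L) (hD : D.PosSemidef) {Δ : ℝ} (htr : D.trace ≤ Δ) :
    Feasible (whiteC P L) (covXgY P) Δ (H * B) := by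
  have hhat := h.covHatgY_eq_mul_whiteC hP hB
  have herr : covXgY P - (H * B) * (whiteC P L)ᵀ = D := by
    rw [← hhat, h.covHatgY_eq_sub, sub_sub_cancel]
  exact ⟨hhat ▸ h.covHatgY_posSemidef, hhat ▸ h.covHatgY_sub_posSemidef hB, herr.symm ▸ hD,
    herr.symm ▸ htr⟩

end IsChannelParam

theorem Feasible.isChannelParam [IsGaussian P] {Δ : ℝ} {J : Matrix (Fin nx) (Fin r) ℝ}
    (h : Feasible (whiteC P L) (covXgY P) Δ J) (hP : IsCenteredSource P)
    (hB : IsFullRankFactor (covSgY P) B L) :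
    IsChannelParam P (J * L) (J * (whiteC P L)ᵀ - J * Jᵀ) (covXgY P - J * (whiteC P L)ᵀ) := by
  have hJ : J * L * B = J := by rw [Matrix.mul_assoc, hB.left_inv, Matrix.mul_one]
  have hcross : J * L * (covXSgY P)ᵀ = J * (whiteC P L)ᵀ := by
    rw [hP.covXSgY_eq_whiteC_mul hB, transpose_mul, transpose_transpose, ← Matrix.mul_assoc, hJ]
  have hsymm : (J * (whiteC P L)ᵀ)ᵀ = J * (whiteC P L)ᵀ := by simpa using h.posSemidef.1.eq
  refine ⟨h.noise_posSemidef, ?_, ?_, hcross ▸ h.posSemidef, ?_⟩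
  · rw [hcross, sub_sub_cancel]
  · rw [hcross, ← hsymm, ← hcross, transpose_mul, transpose_transpose]
  · rw [hcross, hB.eq_mul_transpose, ← Matrix.mul_assoc, hJ, Matrix.mul_assoc, ← transpose_mul, hJ]

end ChannelAlgebra

section ChannelMoments

variable {nx ns ny m : ℕ}

/-- The joint law of the source `(X, S, Y)` and the channel noise `W`. -/
abbrev jointLaw (P : Measure (Src nx ns ny)) (QW : Matrix (Fin nx) (Fin nx) ℝ) :
    Measure (Src nx ns ny × Vec nx) :=
  P.prod (multivariateGaussian 0 QW)

/-- A linear function of the source, as a function of source and noise. -/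
def ofSrc {ι : Type*} (U : Src nx ns ny →L[ℝ] (ι → ℝ)) :
    Src nx ns ny × Vec nx →L[ℝ] (ι → ℝ) :=
  U.comp (ContinuousLinearMap.fst ℝ _ _)

/-- The coordinates of the noise `W`. -/
def cw : Src nx ns ny × Vec nx →L[ℝ] (Fin nx → ℝ) :=
  (EuclideanSpace.equiv (Fin nx) ℝ : Vec nx →L[ℝ] _).comp (ContinuousLinearMap.snd ℝ _ _)

/-- The vector `H (S - E[S|Y]) + W`, which is both `Z - E[Z|Y]` and `X̂ - E[X̂|Y]`. -/
def chanRes (P : Measure (Src nx ns ny)) (H : Matrix (Fin nx) (Fin ns) ℝ) :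
    Src nx ns ny × Vec nx →L[ℝ] (Fin nx → ℝ) :=
  matComp H (ofSrc (residual P cs)) + cw

/-- The reconstruction error `X - X̂`. -/
def chanErr (P : Measure (Src nx ns ny)) (H : Matrix (Fin nx) (Fin ns) ℝ) :
    Src nx ns ny × Vec nx →L[ℝ] (Fin nx → ℝ) :=
  ofSrc (residual P cx) - chanRes P H

/-- The coefficient matrix of `X̂ - E[X̂|Y]` in the estimator `E[S|X̂, Y]`. -/
def postGain (P : Measure (Src nx ns ny)) (H : Matrix (Fin nx) (Fin ns) ℝ)
    (QW : Matrix (Fin nx) (Fin nx) ℝ) : Matrix (Fin ns) (Fin nx) ℝ :=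
  covSgY P * Hᵀ * pinv (covHatgY P H QW)

/-- The estimation error `S - E[S|X̂, Y]`. -/
def chanPost (P : Measure (Src nx ns ny)) (H : Matrix (Fin nx) (Fin ns) ℝ)
    (QW : Matrix (Fin nx) (Fin nx) ℝ) : Src nx ns ny × Vec nx →L[ℝ] (Fin ns → ℝ) :=
  ofSrc (residual P cs) - matComp (postGain P H QW) (chanRes P H)

variable {P : Measure (Src nx ns ny)} {H : Matrix (Fin nx) (Fin ns) ℝ}
  {QW D : Matrix (Fin nx) (Fin nx) ℝ}

theorem crossMoment_ofSrc_ofSrc {ι κ : Type*} [Finite ι] [Finite κ]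
    (U : Src nx ns ny →L[ℝ] (ι → ℝ)) (V : Src nx ns ny →L[ℝ] (κ → ℝ)) :
    crossMoment (jointLaw P QW) (ofSrc U) (ofSrc V) = crossMoment P U V :=
  have := Fintype.ofFinite ι
  have := Fintype.ofFinite κ
  crossMoment_comp_measurePreserving measurePreserving_fst (γ := P) (U := U) (V := V)
    U.measurable V.measurable

variable [IsGaussian P]

theorem crossMoment_cw_cw (hQW : QW.PosSemidef) :
    crossMoment (jointLaw P QW) cw cw = QW := by
  let e : Vec nx →L[ℝ] (Fin nx → ℝ) := EuclideanSpace.equiv (Fin nx) ℝ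
  have hsnd : crossMoment (jointLaw P QW) cw cw = crossMoment (multivariateGaussian 0 QW) e e :=
    crossMoment_comp_measurePreserving measurePreserving_snd e.measurable e.measurable
  rw [hsnd]
  ext i j
  have hcov := covariance_eq_sub (memLp_two_eval_clm (γ := multivariateGaussian 0 QW) e i)
    (memLp_two_eval_clm e j)
  rw [(isCenteredGaussian_clm integral_id_multivariateGaussian e).integral_eq_zero, zero_mul,
    sub_zero] at hcov
  exact hcov.symm.trans (covariance_eval_multivariateGaussian hQW i j)

namespace IsCenteredSource

theorem crossMoment_ofSrc_cw (hP : IsCenteredSource P) {ι : Type*} [Finite ι]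
    (U : Src nx ns ny →L[ℝ] (ι → ℝ)) : crossMoment (jointLaw P QW) (ofSrc U) cw = 0 := by
  ext i j
  refine (integral_prod_mul (fun v => U v i) fun w : Vec nx => w j).trans ?_
  rw [(isCenteredGaussian_clm hP.integral_eq_zero U).integral_eq_zero, zero_mul]
  rfl

theorem integral_jointLaw (hP : IsCenteredSource P) : ∫ v, v ∂(jointLaw P QW) = 0 := by
  have hid : Integrable (fun v => v) (jointLaw P QW) := IsGaussian.integrable_id
  refine Prod.ext ?_ ?_
  · rw [fst_integral hid, integral_fun_fst (f := fun v => v), hP.integral_eq_zero, smul_zero]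
    rfl
  · rw [snd_integral hid, integral_fun_snd (f := fun v => v), integral_id_multivariateGaussian,
      smul_zero]
    rfl

theorem crossMoment_ofSrc_chanRes (hP : IsCenteredSource P) {ι : Type*} [Finite ι]
    (U : Src nx ns ny →L[ℝ] (ι → ℝ)) :
    crossMoment (jointLaw P QW) (ofSrc U) (chanRes P H) =
      crossMoment P U (residual P cs) * Hᵀ := by
  rw [chanRes, crossMoment_clm_add_right, crossMoment_matComp_right, crossMoment_ofSrc_ofSrc,
    hP.crossMoment_ofSrc_cw, add_zero]

theorem crossMoment_cy_chanRes (hP : IsCenteredSource P) :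
    crossMoment (jointLaw P QW) (ofSrc cy) (chanRes P H) = 0 := by
  rw [hP.crossMoment_ofSrc_chanRes, ← crossMoment_transpose, hP.crossMoment_residual_cy,
    transpose_zero, Matrix.zero_mul]

theorem crossMoment_cy_residual (hP : IsCenteredSource P) (U : Src nx ns ny →L[ℝ] (Fin m → ℝ)) :
    crossMoment (jointLaw P QW) (ofSrc cy) (ofSrc (residual P U)) = 0 := by
  rw [crossMoment_ofSrc_ofSrc, ← crossMoment_transpose, hP.crossMoment_residual_cy, transpose_zero]

theorem crossMoment_chanRes_chanRes (hP : IsCenteredSource P) (hQW : QW.PosSemidef) :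
    crossMoment (jointLaw P QW) (chanRes P H) (chanRes P H) = covHatgY P H QW := by
  have hcw : crossMoment (jointLaw P QW) cw (chanRes P H) = QW := by
    rw [chanRes, crossMoment_clm_add_right, crossMoment_matComp_right, crossMoment_cw_cw hQW,
      ← crossMoment_transpose, hP.crossMoment_ofSrc_cw, transpose_zero, Matrix.zero_mul, zero_add]
  nth_rewrite 1 [chanRes]
  rw [crossMoment_clm_add_left, crossMoment_matComp_left, hP.crossMoment_ofSrc_chanRes, hcw,
    ← hP.covSgY_eq, covHatgY, Matrix.mul_assoc]

theorem crossMoment_cy_chanErr (hP : IsCenteredSource P) :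
    crossMoment (jointLaw P QW) (ofSrc cy) (chanErr P H) = 0 := by
  rw [chanErr, crossMoment_clm_sub_right, hP.crossMoment_cy_residual, hP.crossMoment_cy_chanRes,
    sub_zero]

theorem crossMoment_cy_chanPost (hP : IsCenteredSource P) :
    crossMoment (jointLaw P QW) (ofSrc cy) (chanPost P H QW) = 0 := by
  rw [chanPost, crossMoment_clm_sub_right, crossMoment_matComp_right, hP.crossMoment_cy_residual,
    hP.crossMoment_cy_chanRes, Matrix.zero_mul, sub_zero]

end IsCenteredSource

namespace IsChannelParam

theorem crossMoment_residual_cx_chanRes (h : IsChannelParam P H QW D) (hP : IsCenteredSource P) :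
    crossMoment (jointLaw P QW) (ofSrc (residual P cx)) (chanRes P H) = covHatgY P H QW := by
  rw [hP.crossMoment_ofSrc_chanRes, ← hP.covXSgY_eq, ← h.mul_symm, h.covHatgY_eq]

theorem crossMoment_chanRes_chanErr (h : IsChannelParam P H QW D) (hP : IsCenteredSource P) :
    crossMoment (jointLaw P QW) (chanRes P H) (chanErr P H) = 0 := by
  rw [← crossMoment_transpose, chanErr, crossMoment_clm_sub_left,
    h.crossMoment_residual_cx_chanRes hP, hP.crossMoment_chanRes_chanRes h.noise_posSemidef,
    sub_self, transpose_zero]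

theorem crossMoment_chanErr_chanErr (h : IsChannelParam P H QW D) (hP : IsCenteredSource P) :
    crossMoment (jointLaw P QW) (chanErr P H) (chanErr P H) = D := by
  nth_rewrite 1 [chanErr]
  rw [crossMoment_clm_sub_left, h.crossMoment_chanRes_chanErr hP, sub_zero, chanErr,
    crossMoment_clm_sub_right, crossMoment_ofSrc_ofSrc, h.crossMoment_residual_cx_chanRes hP,
    ← hP.covXgY_eq, h.covHatgY_eq_sub, sub_sub_cancel]

theorem postGain_mul_covHatgY (h : IsChannelParam P H QW D) (hP : IsCenteredSource P) :
    postGain P H QW * covHatgY P H QW = covSgY P * Hᵀ := by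
  obtain ⟨r, B, L, hB⟩ := exists_isFullRankFactor hP.covSgY_posSemidef
  exact h.mul_pinv_mul hB

theorem crossMoment_chanRes_chanPost (h : IsChannelParam P H QW D) (hP : IsCenteredSource P) :
    crossMoment (jointLaw P QW) (chanRes P H) (chanPost P H QW) = 0 := by
  rw [← crossMoment_transpose, chanPost, crossMoment_clm_sub_left, crossMoment_matComp_left,
    hP.crossMoment_chanRes_chanRes h.noise_posSemidef, h.postGain_mul_covHatgY hP,
    hP.crossMoment_ofSrc_chanRes, ← hP.covSgY_eq, sub_self, transpose_zero]

theorem crossMoment_chanPost_chanPost (h : IsChannelParam P H QW D) (hP : IsCenteredSource P) :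
    crossMoment (jointLaw P QW) (chanPost P H QW) (chanPost P H QW) = covSgHatY P H QW := by
  have hSt : (covSgY P)ᵀ = covSgY P := by rw [hP.covSgY_eq, crossMoment_transpose]
  have hres : crossMoment (jointLaw P QW) (chanPost P H QW) (chanPost P H QW) =
      crossMoment (jointLaw P QW) (chanPost P H QW) (ofSrc (residual P cs)) := by
    nth_rewrite 2 [chanPost]
    rw [crossMoment_clm_sub_right, crossMoment_matComp_right, ← crossMoment_transpose (chanRes P H),
      h.crossMoment_chanRes_chanPost hP, transpose_zero, Matrix.zero_mul, sub_zero]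
  rw [hres, chanPost, crossMoment_clm_sub_left, crossMoment_matComp_left, crossMoment_ofSrc_ofSrc,
    ← crossMoment_transpose (ofSrc _), hP.crossMoment_ofSrc_chanRes, ← hP.covSgY_eq, transpose_mul,
    transpose_transpose, hSt, covSgHatY, postGain]
  simp only [Matrix.mul_assoc]

end IsChannelParam

end ChannelMoments

section SquareError

variable {Ω : Type*} [MeasurableSpace Ω] {μ : Measure Ω} {n : ℕ}

theorem lintegral_enorm_sq_eq_trace_crossMoment {U : Ω → Vec n}
    (hU : MemLp (fun ω => (U ω).ofLp) 2 μ) :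
    ∫⁻ ω, ‖U ω‖ₑ ^ 2 ∂μ =
      ENNReal.ofReal (crossMoment μ (fun ω => (U ω).ofLp) fun ω => (U ω).ofLp).trace := by
  have hnorm : ∀ ω, ‖U ω‖ₑ ^ 2 = ENNReal.ofReal (∑ i, U ω i * U ω i) := fun ω => by
    rw [← ofReal_norm, ← ENNReal.ofReal_pow (norm_nonneg _), EuclideanSpace.real_norm_sq_eq]
    simp only [sq]
  simp only [hnorm]
  rw [← ofReal_integral_eq_lintegral_ofReal
    (integrable_finsetSum _ fun i _ => integrable_eval_mul_eval hU hU i i)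
    (ae_of_all _ fun ω => Finset.sum_nonneg fun i _ => mul_self_nonneg _),
    integral_finsetSum _ fun i _ => integrable_eval_mul_eval hU hU i i]
  rfl

theorem memLp_two_ofLp_of_lintegral_ne_top {U : Ω → Vec n} (hUm : Measurable U)
    (hU : ∫⁻ ω, ‖U ω‖ₑ ^ 2 ∂μ ≠ ⊤) : MemLp (fun ω => (U ω).ofLp) 2 μ := by
  have h : MemLp U 2 μ := by
    refine ⟨hUm.aestronglyMeasurable, ?_⟩
    rw [eLpNorm_lt_top_iff_lintegral_rpow_enorm_lt_top two_ne_zero ENNReal.ofNat_ne_top]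
    simpa only [ENNReal.toReal_ofNat, ENNReal.rpow_ofNat] using hU.lt_top
  exact MemLp.of_eval fun i => h.eval_piLp i

end SquareError

section TestChannel

variable {nx ns ny : ℕ} {P : Measure (Src nx ns ny)} {H : Matrix (Fin nx) (Fin ns) ℝ}
  {QW D : Matrix (Fin nx) (Fin nx) ℝ}

@[fun_prop]
theorem measurable_toEuclideanLin {m n : ℕ} (A : Matrix (Fin m) (Fin n) ℝ) :
    Measurable (toEuclideanLin A) :=
  (LinearMap.continuous_of_finiteDimensional (toEuclideanLin A)).measurable

@[fun_prop]
theorem measurable_chanDec (P : Measure (Src nx ns ny)) (H : Matrix (Fin nx) (Fin ns) ℝ) :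
    Measurable (chanDec P H) :=
  ((measurable_toEuclideanLin _).comp measurable_fst).add measurable_snd

/-- A channel output with estimate `K Y` given `Y`; the auxiliary variable `Z` and the
reconstruction `X̂` of the test channel are both of this form. -/
def channelOutput (P : Measure (Src nx ns ny)) (H : Matrix (Fin nx) (Fin ns) ℝ)
    (K : Matrix (Fin nx) (Fin ny) ℝ) (p : Src nx ns ny × Vec nx) : Vec nx :=
  WithLp.toLp 2 (K *ᵥ (srcY p.1).ofLp) + WithLp.toLp 2 (chanRes P H p)

/-- The estimator `E[S|V, Y]`, as a function of `(V, Y)`, for a channel output `V` whose estimate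
given `Y` is `K Y`. -/
def postMean (P : Measure (Src nx ns ny)) (H : Matrix (Fin nx) (Fin ns) ℝ)
    (QW : Matrix (Fin nx) (Fin nx) ℝ) (K : Matrix (Fin nx) (Fin ny) ℝ) (t : Vec nx × Vec ny) :
    Vec ns :=
  WithLp.toLp 2 (gain P cs *ᵥ t.2.ofLp + postGain P H QW *ᵥ (t.1.ofLp - K *ᵥ t.2.ofLp))

theorem measurable_postMean (K : Matrix (Fin nx) (Fin ny) ℝ) :
    Measurable (postMean P H QW K) := by
  unfold postMean
  fun_prop

@[fun_prop]
theorem measurable_channelOutput (K : Matrix (Fin nx) (Fin ny) ℝ) :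
    Measurable (channelOutput P H K) := by
  unfold channelOutput
  fun_prop

theorem srcS_eq_postMean_add (K : Matrix (Fin nx) (Fin ny) ℝ) (p : Src nx ns ny × Vec nx) :
    srcS p.1 = postMean P H QW K (channelOutput P H K p, srcY p.1) +
      WithLp.toLp 2 (chanPost P H QW p) := by
  have hdiff : (channelOutput P H K p).ofLp - K *ᵥ (srcY p.1).ofLp = chanRes P H p :=
    add_sub_cancel_left _ _
  have hpost : chanPost P H QW p = (srcS p.1).ofLp - gain P cs *ᵥ (srcY p.1).ofLp -
      postGain P H QW *ᵥ chanRes P H p := rfl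
  rw [postMean, hdiff, hpost, ← WithLp.toLp_add, sub_sub, add_sub_cancel]

theorem chanZ_eq_channelOutput (P : Measure (Src nx ns ny)) (H : Matrix (Fin nx) (Fin ns) ℝ)
    {Ω : Type*} (X : Ω → Vec nx) (S : Ω → Vec ns) (Y : Ω → Vec ny) (W : Ω → Vec nx) :
    chanZ H S W = fun ω => channelOutput P H (H * gain P cs) ((X ω, S ω, Y ω), W ω) := by
  funext ω
  have hres : chanRes P H ((X ω, S ω, Y ω), W ω) =
      H *ᵥ ((S ω).ofLp - gain P cs *ᵥ (Y ω).ofLp) + (W ω).ofLp := rfl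
  rw [channelOutput, hres, mulVec_sub, mulVec_mulVec, ← WithLp.toLp_add, ← add_assoc, srcY,
    add_sub_cancel]
  rfl

theorem srcX_eq_channelOutput_add (p : Src nx ns ny × Vec nx) :
    srcX p.1 = channelOutput P H (gain P cx) p + WithLp.toLp 2 (chanErr P H p) := by
  have herr : chanErr P H p =
      (srcX p.1).ofLp - gain P cx *ᵥ (srcY p.1).ofLp - chanRes P H p := rfl
  rw [channelOutput, herr, ← WithLp.toLp_add, ← WithLp.toLp_add, sub_sub, add_sub_cancel]

variable [IsGaussian P]

theorem IsCenteredSource.chanX_eq_channelOutput (hP : IsCenteredSource P)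
    (H : Matrix (Fin nx) (Fin ns) ℝ) {Ω : Type*} (X : Ω → Vec nx) (S : Ω → Vec ns)
    (Y : Ω → Vec ny) (W : Ω → Vec nx) :
    chanX P H S Y W = fun ω => channelOutput P H (gain P cx) ((X ω, S ω, Y ω), W ω) := by
  funext ω
  have hlin : ∀ A : Matrix (Fin nx) (Fin ny) ℝ, toEuclideanLin A (Y ω) =
    WithLp.toLp 2 (A *ᵥ (Y ω).ofLp) := fun _ => rfl
  have hZ : chanZ H S W ω = WithLp.toLp 2 ((H * gain P cs) *ᵥ (Y ω).ofLp) +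
      WithLp.toLp 2 (chanRes P H ((X ω, S ω, Y ω), W ω)) :=
    congrFun (chanZ_eq_channelOutput P H X S Y W) ω
  rw [chanX, chanDec, hZ, channelOutput, hlin, hP.covXY_eq, hP.covSY_eq, Matrix.sub_mul,
    Matrix.mul_assoc, ← gain, ← gain, sub_mulVec, WithLp.toLp_sub, srcY, ← add_assoc,
    sub_add_cancel]

end TestChannel

section TestChannelLaw

variable {nx ns ny n : ℕ} {P : Measure (Src nx ns ny)}
  {H : Matrix (Fin nx) (Fin ns) ℝ} {QW D : Matrix (Fin nx) (Fin nx) ℝ}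
  {K : Matrix (Fin nx) (Fin ny) ℝ} {Ω τ : Type*} [MeasurableSpace Ω] [MeasurableSpace τ]
  {μ : Measure Ω} {G : Ω → Src nx ns ny × Vec nx}

theorem measurePreserving_source (hG : MeasurePreserving G μ (jointLaw P QW)) :
    MeasurePreserving (fun ω => (G ω).1) μ P :=
  measurePreserving_fst.comp hG

variable [IsGaussian P]

theorem integrable_srcX (hG : MeasurePreserving G μ (jointLaw P QW)) :
    Integrable (fun ω => srcX (G ω).1) μ :=
  (measurePreserving_source hG).integrable_comp_of_integrable (integrable_toLp_clm cx)

theorem integrable_srcS (hG : MeasurePreserving G μ (jointLaw P QW)) :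
    Integrable (fun ω => srcS (G ω).1) μ :=
  (measurePreserving_source hG).integrable_comp_of_integrable (integrable_toLp_clm cs)

theorem integrable_channelOutput (hG : MeasurePreserving G μ (jointLaw P QW)) :
    Integrable (fun ω => channelOutput P H K (G ω)) μ :=
  hG.integrable_comp_of_integrable
    ((integrable_toLp_clm (matComp K (ofSrc cy))).add (integrable_toLp_clm (chanRes P H)))

namespace IsCenteredSource

theorem indepFun_chanRes_srcY (hP : IsCenteredSource P)
    (hG : MeasurePreserving G μ (jointLaw P QW))
    {L : Src nx ns ny × Vec nx →L[ℝ] (Fin n → ℝ)}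
    (hres : crossMoment (jointLaw P QW) (chanRes P H) L = 0)
    (hy : crossMoment (jointLaw P QW) (ofSrc cy) L = 0)
    {φ : Vec nx × Vec ny → τ} (hφ : Measurable φ) :
    IndepFun (fun ω => φ (WithLp.toLp 2 (chanRes P H (G ω)), srcY (G ω).1))
      (fun ω => (WithLp.toLp 2 (L (G ω)) : Vec n)) μ :=
  (indepFun_comp_measurePreserving hG (by fun_prop) L.measurable
    (indepFun_prodMk_of_crossMoment_eq_zero hP.integral_jointLaw hres hy)).comp
    (φ := fun p : (Fin nx → ℝ) × (Fin ny → ℝ) => φ (WithLp.toLp 2 p.1, WithLp.toLp 2 p.2))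
    (ψ := fun x : Fin n → ℝ => (WithLp.toLp 2 x : Vec n)) (by fun_prop) (by fun_prop)

theorem indepFun_srcY_chanRes (hP : IsCenteredSource P)
    (hG : MeasurePreserving G μ (jointLaw P QW)) :
    IndepFun (fun ω => srcY (G ω).1) (fun ω => (WithLp.toLp 2 (chanRes P H (G ω)) : Vec nx)) μ :=
  (indepFun_comp_measurePreserving hG (ofSrc cy).measurable (chanRes P H).measurable
    (indepFun_of_crossMoment_eq_zero hP.integral_jointLaw hP.crossMoment_cy_chanRes)).comp
    (φ := fun y : Fin ny → ℝ => (WithLp.toLp 2 y : Vec ny))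
    (ψ := fun x : Fin nx → ℝ => (WithLp.toLp 2 x : Vec nx)) (by fun_prop) (by fun_prop)

variable [IsProbabilityMeasure μ]

theorem condExp_channelOutput (hP : IsCenteredSource P)
    (hG : MeasurePreserving G μ (jointLaw P QW)) :
    μ[fun ω => channelOutput P H K (G ω) | sig fun ω => srcY (G ω).1] =ᵐ[μ]
      fun ω => WithLp.toLp 2 (K *ᵥ (srcY (G ω).1).ofLp) :=
  condExp_ae_eq_of_indepFun_clm hP.integral_jointLaw hG
    (a := fun y : Vec ny => WithLp.toLp 2 (K *ᵥ y.ofLp))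
    (measurable_srcY.comp (measurePreserving_source hG).measurable) (by fun_prop)
    (integrable_channelOutput hG) (fun _ => rfl) (hP.indepFun_srcY_chanRes hG)

theorem condExp_srcX_srcY (hP : IsCenteredSource P)
    (hG : MeasurePreserving G μ (jointLaw P QW)) :
    μ[fun ω => srcX (G ω).1 | sig fun ω => srcY (G ω).1] =ᵐ[μ]
      fun ω => WithLp.toLp 2 (gain P cx *ᵥ (srcY (G ω).1).ofLp) :=
  condExp_ae_eq_of_indepFun_clm hP.integral_eq_zero (measurePreserving_source hG)
    (a := fun y : Vec ny => WithLp.toLp 2 (gain P cx *ᵥ y.ofLp))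
    (measurable_srcY.comp (measurePreserving_source hG).measurable) (by fun_prop)
    (integrable_srcX hG) (fun ω => eq_gain_add_residual cx (G ω).1)
    (indepFun_comp_measurePreserving (measurePreserving_source hG) measurable_srcY
      ((WithLp.measurable_toLp 2 _).comp (residual P cx).measurable)
      (hP.indepFun_srcY_residual cx))

theorem condCov_channelOutput (hP : IsCenteredSource P) (hQW : QW.PosSemidef)
    (hG : MeasurePreserving G μ (jointLaw P QW)) :
    condCov μ (fun ω => channelOutput P H K (G ω)) (fun ω => channelOutput P H K (G ω))
      (fun ω => srcY (G ω).1) = covHatgY P H QW :=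
  (condCov_eq_crossMoment_clm hG (a := fun y : Vec ny => WithLp.toLp 2 (K *ᵥ y.ofLp))
    (a' := fun y : Vec ny => WithLp.toLp 2 (K *ᵥ y.ofLp)) (fun _ => rfl) (fun _ => rfl)
    (hP.condExp_channelOutput hG) (hP.condExp_channelOutput hG)).trans
    (hP.crossMoment_chanRes_chanRes hQW)

end IsCenteredSource

namespace IsChannelParam

theorem indepFun_chanErr (h : IsChannelParam P H QW D) (hP : IsCenteredSource P)
    (hG : MeasurePreserving G μ (jointLaw P QW)) {φ : Vec nx × Vec ny → τ} (hφ : Measurable φ) :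
    IndepFun (fun ω => φ (WithLp.toLp 2 (chanRes P H (G ω)), srcY (G ω).1))
      (fun ω => (WithLp.toLp 2 (chanErr P H (G ω)) : Vec nx)) μ :=
  hP.indepFun_chanRes_srcY hG (h.crossMoment_chanRes_chanErr hP) hP.crossMoment_cy_chanErr hφ

theorem indepFun_chanPost (h : IsChannelParam P H QW D) (hP : IsCenteredSource P)
    (hG : MeasurePreserving G μ (jointLaw P QW)) {φ : Vec nx × Vec ny → τ} (hφ : Measurable φ) :
    IndepFun (fun ω => φ (WithLp.toLp 2 (chanRes P H (G ω)), srcY (G ω).1))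
      (fun ω => (WithLp.toLp 2 (chanPost P H QW (G ω)) : Vec ns)) μ :=
  hP.indepFun_chanRes_srcY hG (h.crossMoment_chanRes_chanPost hP) hP.crossMoment_cy_chanPost hφ

theorem secondMoment_chanErr (h : IsChannelParam P H QW D) (hP : IsCenteredSource P)
    (hG : MeasurePreserving G μ (jointLaw P QW)) :
    secondMoment μ (fun ω => srcX (G ω).1 - channelOutput P H (gain P cx) (G ω)) = D := by
  have herr : (fun ω => srcX (G ω).1 - channelOutput P H (gain P cx) (G ω)) =
      fun ω => WithLp.toLp 2 (chanErr P H (G ω)) :=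
    funext fun ω => sub_eq_of_eq_add' (srcX_eq_channelOutput_add (G ω))
  rw [herr, ← h.crossMoment_chanErr_chanErr hP]
  exact crossMoment_comp_measurePreserving hG (chanErr P H).measurable (chanErr P H).measurable

theorem mse_channelOutput (h : IsChannelParam P H QW D) (hP : IsCenteredSource P)
    (hG : MeasurePreserving G μ (jointLaw P QW)) :
    mse μ (fun ω => srcX (G ω).1) (fun ω => channelOutput P H (gain P cx) (G ω)) =
      ENNReal.ofReal D.trace := by
  have herr : ∀ ω, (srcX (G ω).1 - channelOutput P H (gain P cx) (G ω)).ofLp =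
      chanErr P H (G ω) := fun ω =>
    congrArg WithLp.ofLp (sub_eq_of_eq_add' (srcX_eq_channelOutput_add (G ω)))
  have hmem : MemLp (fun ω => chanErr P H (G ω)) 2 μ :=
    (memLp_two_clm (chanErr P H)).comp_measurePreserving hG
  rw [mse, lintegral_enorm_sq_eq_trace_crossMoment (by simpa only [herr] using hmem),
    ← h.secondMoment_chanErr hP hG]
  rfl

variable [IsProbabilityMeasure μ]

theorem condExp_srcX (h : IsChannelParam P H QW D) (hP : IsCenteredSource P)
    (hG : MeasurePreserving G μ (jointLaw P QW)) {φ : Vec nx × Vec ny → τ} (hφ : Measurable φ)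
    {a : τ → Vec nx} (ha : Measurable a)
    (haφ : ∀ x y, a (φ (x, y)) = WithLp.toLp 2 (gain P cx *ᵥ y.ofLp) + x) :
    μ[fun ω => srcX (G ω).1 |
        sig fun ω => φ (WithLp.toLp 2 (chanRes P H (G ω)), srcY (G ω).1)] =ᵐ[μ]
      fun ω => channelOutput P H (gain P cx) (G ω) := by
  have hGm := hG.measurable
  have hX : ∀ ω, srcX (G ω).1 = a (φ (WithLp.toLp 2 (chanRes P H (G ω)), srcY (G ω).1)) +
      WithLp.toLp 2 (chanErr P H (G ω)) := fun ω =>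
    (haφ _ _).symm ▸ srcX_eq_channelOutput_add (G ω)
  exact (condExp_ae_eq_of_indepFun_clm hP.integral_jointLaw hG (by fun_prop) ha
    (integrable_srcX hG) hX (h.indepFun_chanErr hP hG hφ)).trans (ae_of_all _ fun _ => haφ _ _)

theorem condLawEq_srcX {τ' : Type*} [MeasurableSpace τ'] (h : IsChannelParam P H QW D)
    (hP : IsCenteredSource P) (hG : MeasurePreserving G μ (jointLaw P QW))
    {φ : Vec nx × Vec ny → τ} (hφ : Measurable φ) {g : τ → τ'} (hg : Measurable g)
    {a : τ' → Vec nx} (ha : Measurable a)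
    (haφ : ∀ x y, a (g (φ (x, y))) = WithLp.toLp 2 (gain P cx *ᵥ y.ofLp) + x) :
    CondLawEq μ (fun ω => srcX (G ω).1)
      (fun ω => φ (WithLp.toLp 2 (chanRes P H (G ω)), srcY (G ω).1))
      (fun ω => g (φ (WithLp.toLp 2 (chanRes P H (G ω)), srcY (G ω).1))) := by
  have hGm := hG.measurable
  have hX : (fun ω => srcX (G ω).1) = fun ω =>
      a (g (φ (WithLp.toLp 2 (chanRes P H (G ω)), srcY (G ω).1))) +
        WithLp.toLp 2 (chanErr P H (G ω)) :=
    funext fun ω => (haφ _ _).symm ▸ srcX_eq_channelOutput_add (G ω)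
  rw [hX]
  exact condLawEq_of_indepFun (F := fun p : τ' × Vec nx => a p.1 + p.2)
    (by fun_prop) (by fun_prop) hg (by fun_prop) (h.indepFun_chanErr hP hG hφ)

theorem condCov_srcS (h : IsChannelParam P H QW D) (hP : IsCenteredSource P)
    (hG : MeasurePreserving G μ (jointLaw P QW)) :
    condCov μ (fun ω => srcS (G ω).1) (fun ω => srcS (G ω).1)
      (fun ω => (channelOutput P H K (G ω), srcY (G ω).1)) = covSgHatY P H QW := by
  have hS : ∀ ω, srcS (G ω).1 = postMean P H QW K (channelOutput P H K (G ω), srcY (G ω).1) +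
      WithLp.toLp 2 (chanPost P H QW (G ω)) := fun ω => srcS_eq_postMean_add K (G ω)
  have hind := h.indepFun_chanPost hP hG
    (φ := fun t : Vec nx × Vec ny => (WithLp.toLp 2 (K *ᵥ t.2.ofLp) + t.1, t.2)) (by fun_prop)
  have hexp := condExp_ae_eq_of_indepFun_clm hP.integral_jointLaw hG
    (((measurable_channelOutput K).comp hG.measurable).prodMk
      (measurable_srcY.comp (measurePreserving_source hG).measurable))
    (measurable_postMean K) (integrable_srcS hG) hS hind
  rw [condCov_eq_crossMoment_clm hG hS hS hexp hexp, h.crossMoment_chanPost_chanPost hP]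

theorem crossMoment_matComp_chanPost (h : IsChannelParam P H QW D) (hP : IsCenteredSource P)
    {r : ℕ} {B : Matrix (Fin ns) (Fin r) ℝ} {L : Matrix (Fin r) (Fin ns) ℝ}
    (hB : IsFullRankFactor (covSgY P) B L) :
    crossMoment (jointLaw P QW) (matComp L (chanPost P H QW)) (matComp L (chanPost P H QW)) =
      schur (covHatgY P H QW) (H * B) := by
  rw [crossMoment_matComp_left, crossMoment_matComp_right, h.crossMoment_chanPost_chanPost hP,
    covSgHatY_eq_mul_schur_mul hB, ← Matrix.mul_assoc, hB.mul_conj_transpose]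

theorem condMutualInfo_channelOutput (h : IsChannelParam P H QW D) (hP : IsCenteredSource P)
    (hG : MeasurePreserving G μ (jointLaw P QW)) :
    condMutualInfo μ (fun ω => srcS (G ω).1) (fun ω => channelOutput P H K (G ω))
      (fun ω => srcY (G ω).1) = halfLogDetRatio (covSgY P) (covSgHatY P H QW) := by
  obtain ⟨r, B, L, hB⟩ := exists_isFullRankFactor hP.covSgY_posSemidef
  have hξ := measurePreserving_source hG
  have hGm := hG.measurable
  have hZ : Measurable fun ω => channelOutput P H K (G ω) :=
    (measurable_channelOutput K).comp hG.measurable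
  let est : Vec ny × Vec nx → Fin r → ℝ := fun t =>
    (L * postGain P H QW) *ᵥ (t.2.ofLp - K *ᵥ t.1.ofLp)
  have hpost : ∀ ω, whiteS P L (G ω).1 - est (srcY (G ω).1, channelOutput P H K (G ω)) =
      matComp L (chanPost P H QW) (G ω) := fun ω => by
    have hdiff : (channelOutput P H K (G ω)).ofLp - K *ᵥ (srcY (G ω).1).ofLp =
      chanRes P H (G ω) := add_sub_cancel_left _ _
    simp only [est, hdiff, ← mulVec_mulVec]
    exact (mulVec_sub L _ _).symm
  have hgauss : ∀ M : Src nx ns ny × Vec nx →L[ℝ] (Fin r → ℝ),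
      IsCenteredGaussian μ fun ω => M (G ω) := fun M =>
    (isCenteredGaussian_clm hP.integral_jointLaw M).comp_measurePreserving M.measurable hG
  have hwhite : crossMoment μ (fun ω => whiteS P L (G ω).1) (fun ω => whiteS P L (G ω).1) = 1 :=
    (crossMoment_comp_measurePreserving hξ (whiteS P L).measurable
      (whiteS P L).measurable).trans (hP.crossMoment_whiteS hB)
  have hind : IndepFun (fun ω => (srcY (G ω).1, channelOutput P H K (G ω)))
      (fun ω => matComp L (chanPost P H QW) (G ω)) μ :=
    (h.indepFun_chanPost hP hG
      (φ := fun t : Vec nx × Vec ny => (t.2, WithLp.toLp 2 (K *ᵥ t.2.ofLp) + t.1))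
      (by fun_prop)).comp (φ := id) (ψ := fun x : Vec ns => L *ᵥ x.ofLp) (by fun_prop) (by fun_prop)
  rw [hP.condMutualInfo_eq_mutualInfo_whiteS hB hξ hZ,
    mutualInfo_eq_halfLogInv_det (T := fun ω => (srcY (G ω).1, channelOutput P H K (G ω)))
      (N := fun ω => whiteS P L (G ω).1) (u := est) (by fun_prop)
      ((whiteS P L).measurable.comp hξ.measurable) (by fun_prop) (hgauss (ofSrc (whiteS P L)))
      hwhite (by simpa only [hpost] using hgauss _) (by simpa only [hpost] using hind)]
  simp only [hpost]
  rw [crossMoment_comp_measurePreserving hG (ContinuousLinearMap.measurable _)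
    (ContinuousLinearMap.measurable _), h.crossMoment_matComp_chanPost hP hB,
    h.halfLogDetRatio_source hB]

end IsChannelParam

end TestChannelLaw

section Realization

variable {nx ns ny : ℕ} {P : Measure (Src nx ns ny)}
  {H : Matrix (Fin nx) (Fin ns) ℝ} {QW D : Matrix (Fin nx) (Fin nx) ℝ} {Δ : ℝ}
  {Ω : Type*} [MeasurableSpace Ω] {μ : Measure Ω}
  {X : Ω → Vec nx} {S : Ω → Vec ns} {Y : Ω → Vec ny} {W : Ω → Vec nx}

theorem isRealization_of_measurePreserving [IsProbabilityMeasure P]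
    {G : Ω → Src nx ns ny × Vec nx} (hG : MeasurePreserving G μ (jointLaw P QW)) :
    IsRealization P QW μ (fun ω => srcX (G ω).1) (fun ω => srcS (G ω).1)
      (fun ω => srcY (G ω).1) (fun ω => (G ω).2) where
  measurable_X := measurable_srcX.comp hG.measurable.fst
  measurable_S := measurable_srcS.comp hG.measurable.fst
  measurable_Y := measurable_srcY.comp hG.measurable.fst
  measurable_W := hG.measurable.snd
  law_source := (measurePreserving_source hG).map_eq
  law_noise := (measurePreserving_snd.comp hG).map_eq
  indep := indepFun_comp_measurePreserving hG measurable_snd measurable_fst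
    (indepFun_prod measurable_id measurable_id).symm

theorem measurePreserving_prodMk_sub [IsProbabilityMeasure P]
    {s : Src nx ns ny → Vec nx} (hs : Measurable s) :
    MeasurePreserving (fun q : Src nx ns ny × Vec nx => (q.1, q.2 - s q.1))
      ((jointLaw P QW).map fun p => (p.1, s p.1 + p.2)) (jointLaw P QW) := by
  refine ⟨by fun_prop, ?_⟩
  rw [Measure.map_map (by fun_prop) (by fun_prop)]
  have hid : (fun q : Src nx ns ny × Vec nx => (q.1, q.2 - s q.1)) ∘
      (fun p => (p.1, s p.1 + p.2)) = id :=
    funext fun p => Prod.ext rfl (add_sub_cancel_left _ _)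
  rw [hid, Measure.map_id]

namespace IsRealization

theorem measurable_chanZ (hr : IsRealization P QW μ X S Y W) : Measurable (chanZ H S W) :=
  ((measurable_toEuclideanLin H).comp hr.measurable_S).add hr.measurable_W

theorem measurable_chanX (hr : IsRealization P QW μ X S Y W) : Measurable (chanX P H S Y W) :=
  (measurable_chanDec P H).comp (hr.measurable_Y.prodMk hr.measurable_chanZ)

variable [IsProbabilityMeasure μ]

theorem measurePreserving (hr : IsRealization P QW μ X S Y W) :
    MeasurePreserving (fun ω => ((X ω, S ω, Y ω), W ω)) μ (jointLaw P QW) := by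
  have hsrc : Measurable fun ω => (X ω, S ω, Y ω) :=
    hr.measurable_X.prodMk (hr.measurable_S.prodMk hr.measurable_Y)
  refine ⟨hsrc.prodMk hr.measurable_W, ?_⟩
  rw [(indepFun_iff_map_prod_eq_prod_map_map hsrc.aemeasurable
    hr.measurable_W.aemeasurable).1 hr.indep.symm, hr.law_source, hr.law_noise]

theorem condLawEq_chanZ (hr : IsRealization P QW μ X S Y W) :
    CondLawEq μ (chanZ H S W) (fun ω => (X ω, S ω, Y ω)) S :=
  condLawEq_of_indepFun (R := W) (T := fun ω => (X ω, S ω, Y ω))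
    (g := fun v : Src nx ns ny => srcS v)
    (F := fun p : Vec ns × Vec nx => toEuclideanLin H p.1 + p.2) hr.measurable_W
    (hr.measurable_X.prodMk (hr.measurable_S.prodMk hr.measurable_Y)) measurable_srcS
    (by fun_prop) hr.indep.symm

theorem condLawEq_chanX (hr : IsRealization P QW μ X S Y W) :
    CondLawEq μ (chanX P H S Y W) (fun ω => (X ω, S ω, Y ω)) fun ω => (S ω, Y ω) :=
  condLawEq_of_indepFun (R := W) (T := fun ω => (X ω, S ω, Y ω))
    (g := fun v : Src nx ns ny => (srcS v, srcY v))
    (F := fun p : (Vec ns × Vec ny) × Vec nx =>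
      chanDec P H (p.1.2, toEuclideanLin H p.1.1 + p.2)) hr.measurable_W
    (hr.measurable_X.prodMk (hr.measurable_S.prodMk hr.measurable_Y))
    (measurable_srcS.prodMk measurable_srcY) (by fun_prop) hr.indep.symm

variable [IsGaussian P]

theorem condMutualInfo_chanZ (hr : IsRealization P QW μ X S Y W) (hP : IsCenteredSource P)
    (h : IsChannelParam P H QW D) :
    condMutualInfo μ S (chanZ H S W) Y = halfLogDetRatio (covSgY P) (covSgHatY P H QW) := by
  rw [chanZ_eq_channelOutput P H X S Y W]
  exact h.condMutualInfo_channelOutput hP hr.measurePreserving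

theorem condMutualInfo_chanX (hr : IsRealization P QW μ X S Y W) (hP : IsCenteredSource P)
    (h : IsChannelParam P H QW D) :
    condMutualInfo μ S (chanX P H S Y W) Y = halfLogDetRatio (covSgY P) (covSgHatY P H QW) := by
  rw [hP.chanX_eq_channelOutput H X S Y W]
  exact h.condMutualInfo_channelOutput hP hr.measurePreserving

theorem structuralProperties (hr : IsRealization P QW μ X S Y W) (hP : IsCenteredSource P)
    (h : IsChannelParam P H QW D) :
    StructuralProperties P H QW D μ X S Y (chanZ H S W) (chanX P H S Y W) := by
  have hG := hr.measurePreserving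
  have hsrc := fun K => h.condCov_srcS (K := K) hP hG
  have hhat := fun K => hP.condCov_channelOutput (H := H) (K := K) h.noise_posSemidef hG
  have hinfo := (hr.condMutualInfo_chanZ hP h).trans (hr.condMutualInfo_chanX hP h).symm
  have hmarkov := hr.condLawEq_chanZ (H := H)
  let hat : Vec nx × Vec ny → Vec nx := fun t => WithLp.toLp 2 (gain P cx *ᵥ t.2.ofLp) + t.1
  let aux : Vec nx × Vec ny → Vec nx := fun t =>
    WithLp.toLp 2 ((H * gain P cs) *ᵥ t.2.ofLp) + t.1
  have hhatm : Measurable hat := by fun_prop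
  have hauxm : Measurable aux := by fun_prop
  have hall : Measurable fun t => (hat t, t.2, aux t) := by fun_prop
  have hpair : Measurable fun t => (hat t, t.2) := by fun_prop
  have hexp := h.condExp_srcX hP hG hhatm measurable_id fun _ _ => rfl
  rw [chanZ_eq_channelOutput P H X S Y W] at hinfo hmarkov ⊢
  rw [hP.chanX_eq_channelOutput H X S Y W] at hinfo ⊢
  exact
    { error_cov := h.secondMoment_chanErr hP hG
      source_law := h.condLawEq_srcX hP hG hall (measurable_fst.prodMk measurable_snd.fst)
        measurable_fst fun _ _ => rfl
      source_law_hat := h.condLawEq_srcX hP hG hpair measurable_fst measurable_id fun _ _ => rfl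
      aux_markov := hmarkov
      info_eq := hinfo
      cov_source_eq := (hsrc _).trans (hsrc _).symm
      cov_hat_eq := (hhat _).trans (hhat _).symm
      cov_source_formula := hsrc _
      cov_hat_formula := hhat _
      cov_hat_sub := (hhat _).trans h.covHatgY_eq_sub
      condExp_eq := (h.condExp_srcX hP hG hall measurable_fst fun _ _ => rfl).trans hexp.symm
      condExp_hat := hexp
      condExp_side := (hP.condExp_srcX_srcY hG).trans (hP.condExp_channelOutput hG).symm }

theorem mse_chanX_le (hr : IsRealization P QW μ X S Y W) (hP : IsCenteredSource P)
    (h : IsChannelParam P H QW D) (htr : D.trace ≤ Δ) :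
    mse μ X (chanX P H S Y W) ≤ ENNReal.ofReal Δ := by
  rw [hP.chanX_eq_channelOutput H X S Y W]
  exact (h.mse_channelOutput hP hr.measurePreserving).le.trans (ENNReal.ofReal_le_ofReal htr)

theorem decAdmissible (hr : IsRealization P QW μ X S Y W) (hP : IsCenteredSource P)
    (h : IsChannelParam P H QW D) (htr : D.trace ≤ Δ) :
    DecAdmissible μ X S Y (chanZ H S W) (chanDec P H) Δ :=
  ⟨hr.measurable_chanZ, measurable_chanDec P H, hr.condLawEq_chanZ, hr.mse_chanX_le hP h htr⟩

theorem encAdmissible (hr : IsRealization P QW μ X S Y W) (hP : IsCenteredSource P)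
    (h : IsChannelParam P H QW D) (htr : D.trace ≤ Δ) :
    EncAdmissible μ X S Y (chanX P H S Y W) Δ :=
  ⟨hr.measurable_chanX, hr.condLawEq_chanX, hr.mse_chanX_le hP h htr⟩

end IsRealization

variable [IsGaussian P]

theorem IsChannelParam.exists_isDecLaw (h : IsChannelParam P H QW D) (hP : IsCenteredSource P)
    (htr : D.trace ≤ Δ) :
    ∃ ρ : ProbabilityMeasure (Src nx ns ny × Vec nx), IsDecLaw P Δ ρ ∧
      condMutualInfo (ρ : Measure (Src nx ns ny × Vec nx)) (fun v => srcS v.1) Prod.snd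
        (fun v => srcY v.1) = halfLogDetRatio (covSgY P) (covSgHatY P H QW) := by
  let s : Src nx ns ny → Vec nx := fun v => toEuclideanLin H (srcS v)
  have hs : Measurable s := by fun_prop
  have hshift : Measurable fun p : Src nx ns ny × Vec nx => (p.1, s p.1 + p.2) := by fun_prop
  have hG := measurePreserving_prodMk_sub (P := P) (QW := QW) hs
  have hr := isRealization_of_measurePreserving hG
  have := Measure.isProbabilityMeasure_map (μ := jointLaw P QW) hshift.aemeasurable
  have hZ : chanZ H (fun v : Src nx ns ny × Vec nx => srcS v.1) (fun v => v.2 - s v.1) =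
      Prod.snd := funext fun v => add_sub_cancel _ _
  have hadm := hr.decAdmissible hP h htr
  have hrate := hr.condMutualInfo_chanZ hP h
  rw [hZ] at hadm hrate
  exact ⟨⟨_, this⟩, ⟨(measurePreserving_source hG).map_eq, _, hadm⟩, hrate⟩

theorem IsChannelParam.exists_isEncLaw (h : IsChannelParam P H QW D) (hP : IsCenteredSource P)
    (htr : D.trace ≤ Δ) :
    ∃ ρ : ProbabilityMeasure (Src nx ns ny × Vec nx), IsEncLaw P Δ ρ ∧
      condMutualInfo (ρ : Measure (Src nx ns ny × Vec nx)) (fun v => srcS v.1) Prod.snd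
        (fun v => srcY v.1) = halfLogDetRatio (covSgY P) (covSgHatY P H QW) := by
  let s : Src nx ns ny → Vec nx := fun v => chanDec P H (srcY v, toEuclideanLin H (srcS v))
  have hs : Measurable s := by fun_prop
  have hshift : Measurable fun p : Src nx ns ny × Vec nx => (p.1, s p.1 + p.2) := by fun_prop
  have hG := measurePreserving_prodMk_sub (P := P) (QW := QW) hs
  have hr := isRealization_of_measurePreserving hG
  have := Measure.isProbabilityMeasure_map (μ := jointLaw P QW) hshift.aemeasurable
  have hX : chanX P H (fun v : Src nx ns ny × Vec nx => srcS v.1) (fun v => srcY v.1)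
      (fun v => v.2 - s v.1) = Prod.snd :=
    funext fun v => (add_assoc _ _ _).symm.trans (add_sub_cancel _ _)
  have hadm := hr.encAdmissible hP h htr
  have hrate := hr.condMutualInfo_chanX hP h
  rw [hX] at hadm hrate
  exact ⟨⟨_, this⟩, ⟨(measurePreserving_source hG).map_eq, hadm⟩, hrate⟩

end Realization

section LinearEstimation

variable {Ω ι κ : Type*} [MeasurableSpace Ω] {μ : Measure Ω} [Fintype ι] [Fintype κ]
  {x V : Ω → ι → ℝ} {U : Ω → κ → ℝ} {Γ : Matrix ι κ ℝ}

theorem crossMoment_mulVec_eq_self (hx : MemLp x 2 μ) (hU : MemLp U 2 μ)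
    (hΓ : Γ * crossMoment μ U U = crossMoment μ x U) :
    crossMoment μ x (fun ω => Γ *ᵥ U ω) =
      crossMoment μ (fun ω => Γ *ᵥ U ω) fun ω => Γ *ᵥ U ω := by
  rw [crossMoment_mulVec_right hx hU, crossMoment_mulVec_mulVec hU, hΓ]

theorem crossMoment_sub_self_of_eq (hx : MemLp x 2 μ) (hV : MemLp V 2 μ)
    (hxV : crossMoment μ x V = crossMoment μ V V) :
    crossMoment μ (fun ω => x ω - V ω) (fun ω => x ω - V ω) =
      crossMoment μ x x - crossMoment μ V V := by
  rw [crossMoment_sub_sub hx hV, hxV, crossMoment_transpose, sub_add_cancel]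

theorem trace_sub_crossMoment_mulVec_le {U : Ω → ι → ℝ} {Γ : Matrix ι ι ℝ} (hx : MemLp x 2 μ)
    (hU : MemLp U 2 μ) (hΓ : Γ * crossMoment μ U U = crossMoment μ x U) :
    (crossMoment μ x x - crossMoment μ (fun ω => Γ *ᵥ U ω) fun ω => Γ *ᵥ U ω).trace ≤
      (crossMoment μ (fun ω => x ω - U ω) fun ω => x ω - U ω).trace := by
  have hV := memLp_mulVec hU Γ
  have hVU : crossMoment μ (fun ω => Γ *ᵥ U ω) U = crossMoment μ x U := by
    rw [crossMoment_mulVec_left hU hU, hΓ]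
  have hpythagoras : crossMoment μ (fun ω => x ω - U ω) (fun ω => x ω - U ω) =
      (crossMoment μ x x - crossMoment μ (fun ω => Γ *ᵥ U ω) fun ω => Γ *ᵥ U ω) +
        crossMoment μ (fun ω => Γ *ᵥ U ω - U ω) fun ω => Γ *ᵥ U ω - U ω := by
    rw [crossMoment_sub_sub hx hU, crossMoment_sub_sub hV hU, hVU]
    abel
  rw [hpythagoras, trace_add]
  exact le_add_of_nonneg_right (posSemidef_crossMoment (hV.sub hU)).trace_nonneg

variable {r : Type*} [Fintype r] {N : Ω → r → ℝ} {C : Matrix ι r ℝ}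

theorem crossMoment_mul_transpose_eq_self (hx : MemLp x 2 μ) (hV : MemLp V 2 μ)
    (hN : MemLp N 2 μ) (hxV : crossMoment μ x V = crossMoment μ V V)
    (hC : crossMoment μ (fun ω => x ω - C *ᵥ N ω) V = 0) :
    crossMoment μ V N * Cᵀ = crossMoment μ V V := by
  have hCN := memLp_mulVec hN C
  rw [crossMoment_sub_left hx hCN hV, hxV, sub_eq_zero] at hC
  rw [← crossMoment_mulVec_right hV hN, ← crossMoment_transpose, ← hC, crossMoment_transpose]

theorem posSemidef_crossMoment_sub_mul_transpose [DecidableEq r] (hV : MemLp V 2 μ)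
    (hN : MemLp N 2 μ) (hN1 : crossMoment μ N N = 1) :
    (crossMoment μ V V - crossMoment μ V N * (crossMoment μ V N)ᵀ).PosSemidef := by
  set J := crossMoment μ V N
  have hJN := memLp_mulVec hN J
  have h := posSemidef_crossMoment (hV.sub hJN)
  have hexpand := crossMoment_sub_sub hV hJN
  rw [crossMoment_mulVec_right hV hN, crossMoment_mulVec_mulVec hN, hN1, Matrix.mul_one,
    transpose_mul, transpose_transpose, sub_add_cancel] at hexpand
  exact hexpand ▸ h

end LinearEstimation

section GaussianEstimation

variable {Ω τ : Type*} [MeasurableSpace Ω] [MeasurableSpace τ] {μ : Measure Ω} {T : Ω → τ}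
  {n r : ℕ} {N : Ω → Fin r → ℝ} {u : τ → Fin n → ℝ}

theorem halfLogInv_det_schur_le_mutualInfo (hT : Measurable T) (hNm : Measurable N)
    (hN : IsCenteredGaussian μ N) (hN1 : crossMoment μ N N = 1) (hu : Measurable u)
    (hU : MemLp (fun ω => u (T ω)) 2 μ) :
    halfLogInv (schur (crossMoment μ (fun ω => u (T ω)) fun ω => u (T ω))
      (crossMoment μ (fun ω => u (T ω)) N)).det ≤ mutualInfo μ T N := by
  set Q := crossMoment μ (fun ω => u (T ω)) fun ω => u (T ω)
  set J := crossMoment μ (fun ω => u (T ω)) N with hJ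
  set A := Jᵀ * pinv Q
  have herror : crossMoment μ (fun ω => N ω - A *ᵥ u (T ω)) (fun ω => N ω - A *ᵥ u (T ω)) =
      linearError Q J A := by
    rw [crossMoment_sub_sub hN.memLp (memLp_mulVec hU A), crossMoment_mulVec_right hN.memLp hU,
      crossMoment_mulVec_mulVec hU, hN1, ← crossMoment_transpose _ N, ← hJ, ← transpose_mul,
      transpose_transpose, sub_right_comm, linearError]
  rw [← linearError_eq_schur (posSemidef_crossMoment hU)
    (posSemidef_crossMoment_sub_mul_transpose hU hN.memLp hN1), ← herror]
  exact halfLogInv_det_le_mutualInfo hT hNm hN hN1 (u := fun t => A *ᵥ u t) (by fun_prop)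
    (memLp_mulVec hU A)

theorem exists_feasible_halfLogInv_le_mutualInfo {x : Ω → Fin n → ℝ}
    {C : Matrix (Fin n) (Fin r) ℝ} {Δ : ℝ} (hT : Measurable T) (hNm : Measurable N)
    (hN : IsCenteredGaussian μ N) (hN1 : crossMoment μ N N = 1) (hx : MemLp x 2 μ)
    (hx0 : ∀ i, ∫ ω, (x ω - C *ᵥ N ω) i ∂μ = 0) (hind : IndepFun (fun ω => x ω - C *ᵥ N ω) T μ)
    (hu : Measurable u) (hU : MemLp (fun ω => u (T ω)) 2 μ)
    (htr : (crossMoment μ (fun ω => x ω - u (T ω)) fun ω => x ω - u (T ω)).trace ≤ Δ) :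
    ∃ J, Feasible C (crossMoment μ x x) Δ J ∧
      halfLogInv (schur (J * Cᵀ) J).det ≤ mutualInfo μ T N := by
  obtain ⟨Γ, hΓ⟩ := exists_mul_crossMoment_eq hU hx
  have hΓu : Measurable fun t => Γ *ᵥ u t := by fun_prop
  have hV : MemLp (fun ω => Γ *ᵥ u (T ω)) 2 μ := memLp_mulVec hU Γ
  have hxV := crossMoment_mulVec_eq_self hx hU hΓ
  have he : MemLp (fun ω => x ω - C *ᵥ N ω) 2 μ := hx.sub (memLp_mulVec hN.memLp C)
  have hindV : IndepFun (fun ω => x ω - C *ᵥ N ω) (fun ω => Γ *ᵥ u (T ω)) μ :=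
    hind.comp measurable_id hΓu
  have heV := crossMoment_eq_zero_of_indepFun he hV hindV hx0
  have hJC := crossMoment_mul_transpose_eq_self hx hV hN.memLp hxV heV
  refine ⟨crossMoment μ (fun ω => Γ *ᵥ u (T ω)) N, ⟨?_, ?_, ?_, ?_⟩, ?_⟩ <;> rw [hJC]
  · exact posSemidef_crossMoment hV
  · exact posSemidef_crossMoment_sub_mul_transpose hV hN.memLp hN1
  · rw [← crossMoment_sub_self_of_eq hx hV hxV]
    exact posSemidef_crossMoment (hx.sub hV)
  · exact (trace_sub_crossMoment_mulVec_le hx hU hΓ).trans htr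
  · exact halfLogInv_det_schur_le_mutualInfo (u := fun t => Γ *ᵥ u t) hT hNm hN hN1 hΓu hV

end GaussianEstimation

section Converse

variable {nx ns ny r : ℕ} {P : Measure (Src nx ns ny)} [IsGaussian P]
  {B : Matrix (Fin ns) (Fin r) ℝ} {L : Matrix (Fin r) (Fin ns) ℝ} {Δ : ℝ}
  {Ω ζ : Type*} [MeasurableSpace Ω] [MeasurableSpace ζ] {μ : Measure Ω} [IsProbabilityMeasure μ]
  {ξ : Ω → Src nx ns ny} {Z : Ω → ζ}

namespace IsCenteredSource

theorem indepFun_innov_srcS_srcY (hP : IsCenteredSource P)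
    (hB : IsFullRankFactor (covSgY P) B L) :
    IndepFun (innov P L) (fun v => (srcS v, srcY v)) P := by
  have hS : crossMoment P (residual P cs) (innov P L) = 0 := by
    rw [← crossMoment_transpose, hP.crossMoment_innov_residual_cs hB, transpose_zero]
  have hY : crossMoment P cy (innov P L) = 0 := by
    rw [← crossMoment_transpose, hP.crossMoment_innov_cy, transpose_zero]
  have hind := (indepFun_prodMk_of_crossMoment_eq_zero hP.integral_eq_zero hS hY).symm
  have hSY : (fun v : Src nx ns ny => (srcS v, srcY v)) = fun v =>
      (WithLp.toLp 2 (gain P cs *ᵥ cy v) + WithLp.toLp 2 (residual P cs v),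
        WithLp.toLp 2 (cy v)) :=
    funext fun v => Prod.ext (eq_gain_add_residual cs v) rfl
  rw [hSY]
  exact hind.comp measurable_id (ψ := fun p : (Fin ns → ℝ) × (Fin ny → ℝ) =>
    ((WithLp.toLp 2 (gain P cs *ᵥ p.2) + WithLp.toLp 2 p.1 : Vec ns),
      (WithLp.toLp 2 p.2 : Vec ny))) (by fun_prop)

theorem indepFun_innov (hP : IsCenteredSource P) (hB : IsFullRankFactor (covSgY P) B L)
    {δ : Type*} [MeasurableSpace δ] (hξ : MeasurePreserving ξ μ P) (hZ : Measurable Z)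
    {g : Vec ns × Vec ny → δ} (hg : Measurable g)
    (hM : CondLawEq μ Z ξ fun ω => g (srcS (ξ ω), srcY (ξ ω))) :
    IndepFun (fun ω => innov P L (ξ ω)) (fun ω => (srcY (ξ ω), Z ω)) μ := by
  have hSY : Measurable fun v : Src nx ns ny => (srcS v, srcY v) := by fun_prop
  have hind := indepFun_of_condLawEq hξ.measurable hZ (innov P L).measurable hSY hg hM
    (indepFun_comp_measurePreserving hξ (innov P L).measurable hSY
      (hP.indepFun_innov_srcS_srcY hB))
  exact hind.comp measurable_id (ψ := fun t : (Vec ns × Vec ny) × ζ => (t.1.2, t.2)) (by fun_prop)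

theorem exists_feasible_le_condMutualInfo (hP : IsCenteredSource P)
    (hB : IsFullRankFactor (covSgY P) B L) (hΔ : 0 ≤ Δ) (hξ : MeasurePreserving ξ μ P)
    (hZ : Measurable Z) {f : Vec ny × ζ → Vec nx} (hf : Measurable f)
    (hdist : mse μ (fun ω => srcX (ξ ω)) (fun ω => f (srcY (ξ ω), Z ω)) ≤ ENNReal.ofReal Δ)
    (hind : IndepFun (fun ω => innov P L (ξ ω)) (fun ω => (srcY (ξ ω), Z ω)) μ) :
    ∃ J, Feasible (whiteC P L) (covXgY P) Δ J ∧
      halfLogInv (schur (J * (whiteC P L)ᵀ) J).det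
        ≤ condMutualInfo μ (fun ω => srcS (ξ ω)) Z (fun ω => srcY (ξ ω)) := by
  have hT : Measurable fun ω => (srcY (ξ ω), Z ω) :=
    (measurable_srcY.comp hξ.measurable).prodMk hZ
  have hcg : ∀ {k : ℕ} (M : Src nx ns ny →L[ℝ] (Fin k → ℝ)),
      IsCenteredGaussian μ fun ω => M (ξ ω) := fun M =>
    (isCenteredGaussian_clm hP.integral_eq_zero M).comp_measurePreserving M.measurable hξ
  have hmoment : ∀ {k : ℕ} (M : Src nx ns ny →L[ℝ] (Fin k → ℝ)),
      crossMoment μ (fun ω => M (ξ ω)) (fun ω => M (ξ ω)) = crossMoment P M M := fun M =>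
    crossMoment_comp_measurePreserving hξ M.measurable M.measurable
  -- `u (Y, Z)` is the reconstruction, centred at `E[X|Y]`.
  let u : Vec ny × ζ → Fin nx → ℝ := fun t => (f t).ofLp - gain P cx *ᵥ t.1.ofLp
  have herr : ∀ ω, residual P cx (ξ ω) - u (srcY (ξ ω), Z ω) =
      (srcX (ξ ω) - f (srcY (ξ ω), Z ω)).ofLp := fun ω => sub_sub_sub_cancel_right _ _ _
  have hmem : MemLp (fun ω => (srcX (ξ ω) - f (srcY (ξ ω), Z ω)).ofLp) 2 μ :=
    memLp_two_ofLp_of_lintegral_ne_top ((measurable_srcX.comp hξ.measurable).sub (hf.comp hT))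
      (ne_top_of_le_ne_top ENNReal.ofReal_ne_top hdist)
  have htr := (lintegral_enorm_sq_eq_trace_crossMoment hmem).symm.trans_le hdist
  rw [ENNReal.ofReal_le_ofReal_iff hΔ] at htr
  have hx : MemLp (fun ω => residual P cx (ξ ω)) 2 μ := (hcg _).memLp
  have hU : MemLp (fun ω => u (srcY (ξ ω), Z ω)) 2 μ := by
    simp only [← herr] at hmem
    simpa only [Pi.sub_def, sub_sub_cancel] using hx.sub hmem
  rw [hP.condMutualInfo_eq_mutualInfo_whiteS hB hξ hZ, hP.covXgY_eq, ← hmoment]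
  exact exists_feasible_halfLogInv_le_mutualInfo hT ((whiteS P L).measurable.comp hξ.measurable)
    (hcg (whiteS P L)) ((hmoment _).trans (hP.crossMoment_whiteS hB)) hx
    (hcg (innov P L)).integral_eq_zero hind (by fun_prop) hU (by simpa only [herr] using htr)

theorem exists_feasible_of_isDecLaw (hP : IsCenteredSource P)
    (hB : IsFullRankFactor (covSgY P) B L) (hΔ : 0 ≤ Δ)
    {ρ : ProbabilityMeasure (Src nx ns ny × ζ)} (hρ : IsDecLaw P Δ ρ) :
    ∃ J, Feasible (whiteC P L) (covXgY P) Δ J ∧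
      halfLogInv (schur (J * (whiteC P L)ᵀ) J).det ≤
        condMutualInfo (ρ : Measure (Src nx ns ny × ζ)) (fun v => srcS v.1) Prod.snd
          fun v => srcY v.1 := by
  obtain ⟨hlaw, f, hadm⟩ := hρ
  have hξ : MeasurePreserving Prod.fst (ρ : Measure (Src nx ns ny × ζ)) P := ⟨measurable_fst, hlaw⟩
  exact hP.exists_feasible_le_condMutualInfo hB hΔ hξ measurable_snd hadm.measurable_rec
    hadm.distortion (hP.indepFun_innov hB hξ measurable_snd measurable_fst hadm.markov)

theorem exists_feasible_of_isEncLaw (hP : IsCenteredSource P)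
    (hB : IsFullRankFactor (covSgY P) B L) (hΔ : 0 ≤ Δ)
    {ρ : ProbabilityMeasure (Src nx ns ny × Vec nx)} (hρ : IsEncLaw P Δ ρ) :
    ∃ J, Feasible (whiteC P L) (covXgY P) Δ J ∧
      halfLogInv (schur (J * (whiteC P L)ᵀ) J).det ≤
        condMutualInfo (ρ : Measure (Src nx ns ny × Vec nx)) (fun v => srcS v.1) Prod.snd
          fun v => srcY v.1 := by
  obtain ⟨hlaw, hadm⟩ := hρ
  have hξ : MeasurePreserving Prod.fst (ρ : Measure (Src nx ns ny × Vec nx)) P :=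
    ⟨measurable_fst, hlaw⟩
  exact hP.exists_feasible_le_condMutualInfo hB hΔ hξ measurable_snd (f := Prod.snd)
    measurable_snd hadm.distortion
    (hP.indepFun_innov hB hξ measurable_snd (g := id) measurable_id hadm.markov)

end IsCenteredSource

end Converse

section Optimality

variable {nx ns ny r : ℕ} {P : Measure (Src nx ns ny)} {B : Matrix (Fin ns) (Fin r) ℝ}
  {L : Matrix (Fin r) (Fin ns) ℝ} {Δ : ℝ}

/-- The infimum of the rates of the test channels with distortion at most `Δ`, in the coordinates
where the remote source is white; the common value of the four optimization problems. -/
def feasibleRate (P : Measure (Src nx ns ny)) (L : Matrix (Fin r) (Fin ns) ℝ) (Δ : ℝ) : ℝ≥0∞ :=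
  ⨅ (J : Matrix (Fin nx) (Fin r) ℝ) (_ : Feasible (whiteC P L) (covXgY P) Δ J),
    halfLogInv (schur (J * (whiteC P L)ᵀ) J).det

theorem exists_feasible_eq_feasibleRate (h : ∃ J, Feasible (whiteC P L) (covXgY P) Δ J) :
    ∃ J, Feasible (whiteC P L) (covXgY P) Δ J ∧
      halfLogInv (schur (J * (whiteC P L)ᵀ) J).det = feasibleRate P L Δ := by
  obtain ⟨J, hJ, hmax⟩ := exists_feasible_forall_det_schur_le h
  refine ⟨J, hJ, le_antisymm (le_iInf₂ fun J' hJ' => ?_) (iInf₂_le J hJ)⟩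
  exact halfLogInv_le_halfLogInv
    (schur_posSemidef hJ'.posSemidef hJ'.noise_posSemidef).det_nonneg (hmax J' hJ')

variable [IsGaussian P]

theorem Feasible.schur_covHatgY {J : Matrix (Fin nx) (Fin r) ℝ}
    (h : Feasible (whiteC P L) (covXgY P) Δ J) (hP : IsCenteredSource P)
    (hB : IsFullRankFactor (covSgY P) B L) :
    schur (covHatgY P (J * L) (J * (whiteC P L)ᵀ - J * Jᵀ)) (J * L * B) =
      schur (J * (whiteC P L)ᵀ) J := by
  have hJ : J * L * B = J := by rw [Matrix.mul_assoc, hB.left_inv, Matrix.mul_one]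
  rw [(h.isChannelParam hP hB).covHatgY_eq_mul_whiteC hP hB, hJ]

namespace IsCenteredSource

theorem rdfDec_eq (hP : IsCenteredSource P) (hB : IsFullRankFactor (covSgY P) B L) (hΔ : 0 ≤ Δ) :
    rdfDec P Δ = feasibleRate P L Δ := by
  refine le_antisymm (le_iInf₂ fun J hJ => ?_)
    (le_iInf fun ζ => le_iInf fun _ => le_iInf₂ fun ρ hρ => ?_)
  · have h := hJ.isChannelParam hP hB
    obtain ⟨ρ, hρ, hI⟩ := h.exists_isDecLaw hP hJ.trace_le
    rw [h.halfLogDetRatio_source hB, hJ.schur_covHatgY hP hB] at hI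
    rw [← hI]
    exact iInf_le_of_le (Vec nx) (iInf_le_of_le inferInstance (iInf₂_le ρ hρ))
  · obtain ⟨J, hJ, hle⟩ := hP.exists_feasible_of_isDecLaw hB hΔ hρ
    exact (iInf₂_le J hJ).trans hle

theorem rdfEnc_eq (hP : IsCenteredSource P) (hB : IsFullRankFactor (covSgY P) B L) (hΔ : 0 ≤ Δ) :
    rdfEnc P Δ = feasibleRate P L Δ := by
  refine le_antisymm (le_iInf₂ fun J hJ => ?_) (le_iInf₂ fun ρ hρ => ?_)
  · have h := hJ.isChannelParam hP hB
    obtain ⟨ρ, hρ, hI⟩ := h.exists_isEncLaw hP hJ.trace_le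
    rw [h.halfLogDetRatio_source hB, hJ.schur_covHatgY hP hB] at hI
    rw [← hI]
    exact iInf₂_le ρ hρ
  · obtain ⟨J, hJ, hle⟩ := hP.exists_feasible_of_isEncLaw hB hΔ hρ
    exact (iInf₂_le J hJ).trans hle

theorem sourceCharacterization_eq (hP : IsCenteredSource P)
    (hB : IsFullRankFactor (covSgY P) B L) : sourceCharacterization P Δ = feasibleRate P L Δ := by
  refine le_antisymm (le_iInf₂ fun J hJ => ?_)
    (le_iInf fun H => le_iInf fun QW => le_iInf₂ fun D hD => ?_)
  · have h := hJ.isChannelParam hP hB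
    rw [← hJ.schur_covHatgY hP hB, ← h.halfLogDetRatio_source hB]
    exact iInf_le_of_le _ (iInf_le_of_le _ (iInf₂_le _ ⟨h, hJ.error_posSemidef, hJ.trace_le,
      h.posSemidef_covSgY_sub hP, h.covSgHatY_posSemidef hB⟩))
  · rw [hD.1.halfLogDetRatio_source hB, hD.1.covHatgY_eq_mul_whiteC hP hB]
    exact iInf₂_le _ (hD.1.feasible hP hB hD.2.1 hD.2.2.1)

theorem channelCharacterization_eq (hP : IsCenteredSource P)
    (hB : IsFullRankFactor (covSgY P) B L) :
    channelCharacterization P Δ = feasibleRate P L Δ := by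
  refine le_antisymm (le_iInf₂ fun J hJ => ?_)
    (le_iInf fun H => le_iInf fun QW => le_iInf₂ fun D hD => ?_)
  · have h := hJ.isChannelParam hP hB
    rw [← hJ.schur_covHatgY hP hB, ← h.halfLogDetRatio_channel hB]
    exact iInf_le_of_le _ (iInf_le_of_le _ (iInf₂_le _ ⟨h, hJ.error_posSemidef, hJ.trace_le,
      posSemidef_covHatgY_sub hP.covSgY_posSemidef, h.noise_posSemidef⟩))
  · rw [hD.1.halfLogDetRatio_channel hB, hD.1.covHatgY_eq_mul_whiteC hP hB]
    exact iInf₂_le _ (hD.1.feasible hP hB hD.2.1 hD.2.2.1)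

end IsCenteredSource

end Optimality

end RemoteRDF

end

theorem theorem5 {nx ns ny : ℕ} (P : Measure (RemoteRDF.Src nx ns ny)) [IsGaussian P]
    (hmean : ∫ v, v ∂P = 0) (hY : (RemoteRDF.covY P).PosDef) (Δ : ℝ) (hΔ : 0 ≤ Δ) :
    -- every test channel of the stated form exists and has the structural properties
    (∀ (H : Matrix (Fin nx) (Fin ns) ℝ) (QW D : Matrix (Fin nx) (Fin nx) ℝ),
      RemoteRDF.IsChannelParam P H QW D →
      (∃ (Ω : Type) (_ : MeasurableSpace Ω) (μ : ProbabilityMeasure Ω)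
        (X : Ω → RemoteRDF.Vec nx) (S : Ω → RemoteRDF.Vec ns) (Y : Ω → RemoteRDF.Vec ny)
        (W : Ω → RemoteRDF.Vec nx),
        RemoteRDF.IsRealization P QW (μ : Measure Ω) X S Y W) ∧
      (∀ (Ω : Type*) [MeasurableSpace Ω] (μ : Measure Ω) [IsProbabilityMeasure μ]
        (X : Ω → RemoteRDF.Vec nx) (S : Ω → RemoteRDF.Vec ns) (Y : Ω → RemoteRDF.Vec ny)
        (W : Ω → RemoteRDF.Vec nx),
        RemoteRDF.IsRealization P QW μ X S Y W →
        RemoteRDF.StructuralProperties P H QW D μ X S Y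
          (RemoteRDF.chanZ H S W) (RemoteRDF.chanX P H S Y W))) ∧
    -- if any auxiliary variable is admissible, a test channel of this form achieves the rate
    ((∃ (ζ : Type) (_ : MeasurableSpace ζ)
        (ρ : ProbabilityMeasure (RemoteRDF.Src nx ns ny × ζ)), RemoteRDF.IsDecLaw P Δ ρ) →
      ∃ (H : Matrix (Fin nx) (Fin ns) ℝ) (QW D : Matrix (Fin nx) (Fin nx) ℝ),
        RemoteRDF.IsChannelParam P H QW D ∧ D.PosSemidef ∧ D.trace ≤ Δ ∧
        RemoteRDF.halfLogDetRatio (RemoteRDF.covSgY P) (RemoteRDF.covSgHatY P H QW) =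
          RemoteRDF.rdfDec P Δ ∧
        RemoteRDF.halfLogDetRatio (RemoteRDF.covHatgY P H QW) QW = RemoteRDF.rdfDec P Δ ∧
        ∀ (Ω : Type*) [MeasurableSpace Ω] (μ : Measure Ω) [IsProbabilityMeasure μ]
          (X : Ω → RemoteRDF.Vec nx) (S : Ω → RemoteRDF.Vec ns) (Y : Ω → RemoteRDF.Vec ny)
          (W : Ω → RemoteRDF.Vec nx),
          RemoteRDF.IsRealization P QW μ X S Y W →
          RemoteRDF.DecAdmissible μ X S Y (RemoteRDF.chanZ H S W) (RemoteRDF.chanDec P H) Δ ∧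
          RemoteRDF.EncAdmissible μ X S Y (RemoteRDF.chanX P H S Y W) Δ ∧
          RemoteRDF.condMutualInfo μ S (RemoteRDF.chanZ H S W) Y = RemoteRDF.rdfDec P Δ) ∧
    -- the two rate distortion functions coincide, and have the two characterizations
    RemoteRDF.rdfDec P Δ = RemoteRDF.rdfEnc P Δ ∧
    RemoteRDF.rdfDec P Δ = RemoteRDF.sourceCharacterization P Δ ∧
    RemoteRDF.rdfDec P Δ = RemoteRDF.channelCharacterization P Δ := by
  have hP : RemoteRDF.IsCenteredSource P := ⟨hmean, hY⟩
  obtain ⟨r, B, L, hB⟩ := RemoteRDF.exists_isFullRankFactor hP.covSgY_posSemidef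
  have hdec := hP.rdfDec_eq hB hΔ
  refine ⟨fun H QW D h => ⟨⟨_, _, ⟨RemoteRDF.jointLaw P QW, inferInstance⟩, _, _, _, _,
      RemoteRDF.isRealization_of_measurePreserving (MeasurePreserving.id _)⟩,
      fun Ω _ μ _ X S Y W hr => hr.structuralProperties hP h⟩, ?_,
    hdec.trans (hP.rdfEnc_eq hB hΔ).symm,
    hdec.trans (hP.sourceCharacterization_eq hB).symm,
    hdec.trans (hP.channelCharacterization_eq hB).symm⟩
  rintro ⟨ζ, _, ρ, hρ⟩
  obtain ⟨J₀, hJ₀, -⟩ := hP.exists_feasible_of_isDecLaw hB hΔ hρ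
  obtain ⟨J, hJ, hrate⟩ := RemoteRDF.exists_feasible_eq_feasibleRate ⟨J₀, hJ₀⟩
  have h := hJ.isChannelParam hP hB
  rw [← hJ.schur_covHatgY hP hB, ← hdec] at hrate
  have hsrc := (h.halfLogDetRatio_source hB).trans hrate
  exact ⟨_, _, _, h, hJ.error_posSemidef, hJ.trace_le, hsrc,
    (h.halfLogDetRatio_channel hB).trans hrate, fun Ω _ μ _ X S Y W hr =>
    ⟨hr.decAdmissible hP h hJ.trace_le, hr.encAdmissible hP h hJ.trace_le,
      (hr.condMutualInfo_chanZ hP h).trans hsrc⟩⟩
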